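/- Let $p$ be a prime, let $S_1,S_2$ be finite $p$-groups, and let $\mathcal F_1,\mathcal F_2$ be saturated fusion systems over $S_1,S_2$. Let $\mathcal F_1\times\mathcal F_2$ be the product fusion system over $S_1\times S_2$: a homomorphism $P\to Q$ between subgroups of $S_1\times S_2$ is a morphism if it is the restriction of $\varphi_1\times\varphi_2$ for morphisms $\varphi_i\colon P_i\to S_i$ of $\mathcal F_i$, where $P_i$ is the image of $P$ in $S_i$. For a fusion system $\mathcal F$ over $S$, let $$H^*(\mathcal F)=\varprojlim_{\mathcal O^c(\mathcal F)}H^*(-;\mathbb F_p)$$ be the inverse limit over the orbit category of $\mathcal F$-centric subgroups, i.e. the graded $\mathbb F_p$-algebra of families $(x_P)$ with $x_P\in H^*(P;\mathbb F_p)$ for every $\mathcal F$-centric $P\le S$ and $\varphi^*x_Q=x_P$ for every morphism $\varphi\colon P\to Q$ of $\mathcal F$ between $\mathcal F$-centric subgroups, with the cup product. Then there is an isomorphism of graded $\mathbb F_p$-algebras $$e\colon H^*(\mathcal F_1)\otimes_{\mathbb F_p}H^*(\mathcal F_2)\;\xrightarrow{\ \cong\ }\;H^*(\mathcal F_1\times\mathcal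 F_2),$$ where the left side has the product $(x\otimes y)(x'\otimes y')=(-1)^{|y||x'|}xx'\otimes yy'$. It is given by the external product: whenever $P_1$, $P_2$ and $P\le P_1\times P_2$ are centric in $\mathcal F_1$, $\mathcal F_2$ and $\mathcal F_1\times\mathcal F_2$, the component of $e(x\otimes y)$ at $P$ is $(\mathrm{pr}_1|_P)^*x_{P_1}\cup(\mathrm{pr}_2|_P)^*y_{P_2}$. Moreover $e$ is compatible with the Steenrod operations. More generally, let $(\theta_a)$ be any family of linear operations $\theta_a\colon H^n(G;\mathbb F_p)\to H^{n+|a|}(G;\mathbb F_p)$, natural in the finite group $G$, which satisfies a Cartan formula $\theta_a(u\cup v)=\sum c^a_{b,b'}(-1)^{|b'||u|}\,\theta_b(u)\cup\theta_{b'}(v)$ with finitely many non-zero constants $c^a_{b,b'}\in\mathbb F_p$ for each $a$. Acting on each component, the operations $\theta_a$ act on $H^*(\mathcal F)$, and $$\theta_a(e(x\otimes y))=\sum c^a_{b,b'}(-1)^{|b'||x|}\,e(\theta_b x\otimes\theta_{b'}y)$$ for all homogeneous $x$ and all homogeneous $y$. -/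

import Mathlib

open scoped DirectSum TensorProduct
noncomputable section

namespace FusionKunneth

open CategoryTheory

abbrev trivRep (k : Type) [CommRing k] (G : Type) [Group G] : Rep.{0} k G :=
  Rep.trivial k G k

/-- `Hⁿ(G; k)`. -/
abbrev Coh (k : Type) [CommRing k] (G : Type) [Group G] (n : ℕ) : Type :=
  groupCohomology (trivRep k G) n

variable {k : Type} [CommRing k] {G K L : Type} [Group G] [Group K] [Group L]

/-- The coboundary of inhomogeneous cochains with trivial coefficients. -/
abbrev cobd (k : Type) [CommRing k] {G : Type} [Group G] (n : ℕ) (f : (Fin n → G) → k) :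
    (Fin (n + 1) → G) → k :=
  inhomogeneousCochains.d (trivRep k G) n f

theorem cobd_apply (n : ℕ) (f : (Fin n → G) → k) (x : Fin (n + 1) → G) :
    cobd k n f x = f (fun i => x i.succ) +
      ∑ j : Fin (n + 1), (-1 : k) ^ ((j : ℕ) + 1) * f (Fin.contractNth j (· * ·) x) := by
  rw [cobd, inhomogeneousCochains.d_hom_apply]
  simp

/-- The class of a cocycle. -/
def cls (k : Type) [CommRing k] {G : Type} [Group G] (n : ℕ) (f : (Fin n → G) → k)
    (hf : cobd k n f = 0) : Coh k G n :=
  groupCohomology.π (trivRep k G) n (groupCohomology.cocyclesMk f hf)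

theorem cls_surj (n : ℕ) (x : Coh k G n) : ∃ f hf, x = cls k n f hf := by
  induction x using groupCohomology_induction_on with | h z => ?_
  have hz : cobd k n (groupCohomology.iCocycles (trivRep k G) n z) = 0 := by
    have := (groupCohomology.inhomogeneousCochains (trivRep k G)).iCycles_d n (n + 1)
    rw [groupCohomology.inhomogeneousCochains.d_def] at this
    exact congr($this z)
  refine ⟨_, hz, ?_⟩
  unfold cls
  congr 1
  apply (ModuleCat.mono_iff_injective (groupCohomology.iCocycles (trivRep k G) n)).1 inferInstance
  rw [groupCohomology.iCocycles_mk]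

theorem cls_eq_zero_iff_aux (m n : ℕ) (h : (ComplexShape.up ℕ).prev n = m)
    (z : groupCohomology.cocycles (trivRep k G) n) :
    groupCohomology.π (trivRep k G) n z = 0 ↔
      ∃ y, groupCohomology.toCocycles (trivRep k G) m n y = z := by
  let S := ShortComplex.mk _ _
    ((groupCohomology.inhomogeneousCochains (trivRep k G)).toCycles_comp_homologyπ m n)
  have hS : S.Exact := S.exact_of_g_is_cokernel
    ((groupCohomology.inhomogeneousCochains (trivRep k G)).homologyIsCokernel m n h)
  constructor
  · exact (ShortComplex.moduleCat_exact_iff S).1 hS z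
  · rintro ⟨y, rfl⟩
    exact congr($(S.zero) y)

theorem cls_succ_eq_zero_iff (n : ℕ) (f : (Fin (n + 1) → G) → k) (hf : cobd k (n + 1) f = 0) :
    cls k (n + 1) f hf = 0 ↔ ∃ f', cobd k n f' = f := by
  unfold cls
  rw [cls_eq_zero_iff_aux n (n + 1) (by simp)]
  have key : ∀ y, groupCohomology.iCocycles (trivRep k G) (n + 1)
      (groupCohomology.toCocycles (trivRep k G) n (n + 1) y) = cobd k n y := by
    intro y
    have := (groupCohomology.inhomogeneousCochains (trivRep k G)).toCycles_i n (n + 1)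
    rw [groupCohomology.inhomogeneousCochains.d_def] at this
    exact congr($this y)
  refine exists_congr fun y => ?_
  rw [← key y]
  conv_rhs => rw [← groupCohomology.iCocycles_mk (A := trivRep k G) f hf]
  exact ((ModuleCat.mono_iff_injective
    (groupCohomology.iCocycles (trivRep k G) (n + 1))).1 inferInstance).eq_iff.symm

theorem cls_zero_eq_zero_iff (f : (Fin 0 → G) → k) (hf : cobd k 0 f = 0) :
    cls k 0 f hf = 0 ↔ f = 0 := by
  unfold cls
  rw [cls_eq_zero_iff_aux 0 0 (by simp)]
  have : groupCohomology.toCocycles (trivRep k G) 0 0 = 0 := by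
    rw [← cancel_mono (groupCohomology.iCocycles (trivRep k G) 0),
      HomologicalComplex.toCycles_i, HomologicalComplex.shape _ _ _ (by simp), Limits.zero_comp]
  rw [this]
  constructor
  · rintro ⟨y, hy⟩
    rw [← groupCohomology.iCocycles_mk (A := trivRep k G) f hf, ← hy]
    simp
  · intro h
    refine ⟨0, ?_⟩
    apply (ModuleCat.mono_iff_injective (groupCohomology.iCocycles (trivRep k G) 0)).1 inferInstance
    rw [groupCohomology.iCocycles_mk]
    simp [h]

/-- The cup product of inhomogeneous cochains. -/
def cupCochain {m n : ℕ} (f : (Fin m → G) → k) (g : (Fin n → G) → k) :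
    (Fin (m + n) → G) → k :=
  fun x => f (fun i => x (Fin.castAdd n i)) * g (fun j => x (Fin.natAdd m j))

theorem cobd_cupCochain {m n : ℕ} (f : (Fin m → G) → k) (g : (Fin n → G) → k)
    (x : Fin (m + n + 1) → G) :
    cobd k (m + n) (cupCochain f g) x =
      cobd k m f (fun i => x (Fin.cast (by omega) (Fin.castAdd n i))) *
        g (fun j => x (Fin.cast (by omega) (Fin.natAdd (m + 1) j))) +
      (-1) ^ m * (f (fun i => x (Fin.cast (by omega) (Fin.castAdd (n + 1) i))) *
        cobd k n g (fun j => x (Fin.natAdd m j))) := by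
  have key1 : ∀ j : Fin m, cupCochain f g
      (Fin.contractNth (Fin.castAdd (n + 1) j : Fin (m + (n + 1))) (· * ·) x) =
      f (Fin.contractNth j.castSucc (· * ·)
          (fun i => x (Fin.cast (by omega) (Fin.castAdd n i)))) *
        g (fun j => x (Fin.cast (by omega) (Fin.natAdd (m + 1) j))) := by
    intro j
    unfold cupCochain
    congr 2
    funext i
    unfold Fin.contractNth
    simp only [Fin.val_natAdd, Fin.val_castAdd]
    rw [if_neg (by omega), if_neg (by omega)]
    congr 1
    apply Fin.ext
    simp
    omega
  have key2 : ∀ j : Fin (n + 1), cupCochain f g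
      (Fin.contractNth (Fin.natAdd m j : Fin (m + (n + 1))) (· * ·) x) =
      f (fun i => x (Fin.cast (by omega) (Fin.castAdd (n + 1) i))) *
        g (Fin.contractNth j (· * ·) (fun j => x (Fin.natAdd m j))) := by
    intro j
    unfold cupCochain
    congr 2
    · funext i
      unfold Fin.contractNth
      simp only [Fin.val_natAdd, Fin.val_castAdd]
      rw [if_pos (by omega)]
      rfl
    · funext i
      unfold Fin.contractNth
      simp only [Fin.val_natAdd, Nat.add_lt_add_iff_left, Nat.add_left_cancel_iff]
      rfl
  rw [cobd_apply]
  rw [show (∑ j : Fin (m + n + 1), (-1 : k) ^ ((j : ℕ) + 1) *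
      cupCochain f g (Fin.contractNth j (· * ·) x)) = _ from
    Fin.sum_univ_add (a := m) (b := n + 1) (fun j : Fin (m + (n + 1)) =>
      (-1 : k) ^ ((j : ℕ) + 1) * cupCochain f g (Fin.contractNth j (· * ·) x))]
  simp only [key1, key2]
  rw [cobd_apply, cobd_apply]
  have h1 : (cupCochain f g fun i => x i.succ) =
      f (fun i => x (Fin.cast (by omega) (Fin.castAdd n i.succ))) *
        g (fun j => x (Fin.cast (by omega) (Fin.natAdd (m + 1) j))) := by
    unfold cupCochain
    congr 2
    funext j
    dsimp only
    congr 1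
    apply Fin.ext
    simp
    omega
  have h2 : Fin.contractNth (Fin.last m) (· * ·)
          (fun i => x (Fin.cast (by omega : m + 1 + n = m + n + 1) (Fin.castAdd n i))) =
      (fun i => x (Fin.cast (by omega) (Fin.castAdd (n + 1) i))) := by
    funext i
    unfold Fin.contractNth
    rw [if_pos (by simp)]
    rfl
  have h3 : (fun i : Fin n => x (Fin.natAdd m i.succ)) =
     (fun j => x (Fin.cast (by omega) (Fin.natAdd (m + 1) j))) := by
    funext j
    congr 1
    apply Fin.ext
    simp
    omega
  rw [h1, h3, Fin.sum_univ_castSucc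
    (f := fun j : Fin (m + 1) => (-1 : k) ^ ((j : ℕ) + 1) * f (Fin.contractNth j (· * ·)
      (fun i => x (Fin.cast (by omega : m + 1 + n = m + n + 1) (Fin.castAdd n i))))), h2]
  have e1 : ∀ i : ℕ, (-1 : k) ^ (m + i + 1) = (-1) ^ m * (-1) ^ (i + 1) := by
    intro i
    rw [← pow_add]
    rfl
  simp only [Fin.val_castAdd, Fin.val_natAdd, Fin.val_castSucc, Fin.val_last, e1, mul_add, add_mul,
    Finset.mul_sum, Finset.sum_mul, mul_assoc, mul_left_comm, pow_succ (-1 : k) m]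
  ring_nf


theorem cls_add {n : ℕ} (f g : (Fin n → G) → k) (hf : cobd k n f = 0) (hg : cobd k n g = 0)
    (hfg : cobd k n (f + g) = 0) : cls k n (f + g) hfg = cls k n f hf + cls k n g hg := by
  unfold cls
  rw [← map_add]
  congr 1
  apply (ModuleCat.mono_iff_injective (groupCohomology.iCocycles (trivRep k G) n)).1 inferInstance
  rw [map_add, groupCohomology.iCocycles_mk, groupCohomology.iCocycles_mk,
    groupCohomology.iCocycles_mk]

theorem cls_smul {n : ℕ} (r : k) (f : (Fin n → G) → k) (hf : cobd k n f = 0)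
    (hrf : cobd k n (r • f) = 0) : cls k n (r • f) hrf = r • cls k n f hf := by
  unfold cls
  rw [← map_smul]
  congr 1
  apply (ModuleCat.mono_iff_injective (groupCohomology.iCocycles (trivRep k G) n)).1 inferInstance
  rw [map_smul, groupCohomology.iCocycles_mk, groupCohomology.iCocycles_mk]

theorem cls_cast {m n : ℕ} (e : m = n) (f : (Fin m → G) → k) (g : (Fin n → G) → k)
    (hf : cobd k m f = 0) (hg : cobd k n g = 0) (h : ∀ x, g x = f (fun i => x (Fin.cast e i))) :
    (⟨m, cls k m f hf⟩ : GradedMonoid (Coh k G)) = ⟨n, cls k n g hg⟩ := by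
  subst e
  obtain rfl : g = f := funext h
  rfl

theorem cls_eq_zero_of_cobd {m n : ℕ} (e : m + 1 = n) (f : (Fin n → G) → k)
    (hf : cobd k n f = 0) (f' : (Fin m → G) → k)
    (h : ∀ x, f x = cobd k m f' (fun i => x (Fin.cast e i))) : cls k n f hf = 0 := by
  subst e
  exact (cls_succ_eq_zero_iff m f hf).2 ⟨f', (funext h).symm⟩

/-- The inhomogeneous cocycles. -/
def cocyc (k : Type) [CommRing k] (G : Type) [Group G] (n : ℕ) : Submodule k ((Fin n → G) → k) :=
  LinearMap.ker (inhomogeneousCochains.d (trivRep k G) n).hom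

theorem mem_cocyc {n : ℕ} {f : (Fin n → G) → k} : f ∈ cocyc k G n ↔ cobd k n f = 0 := Iff.rfl

/-- Sending a cocycle to its cohomology class. -/
def clsHom (k : Type) [CommRing k] (G : Type) [Group G] (n : ℕ) : cocyc k G n →ₗ[k] Coh k G n where
  toFun f := cls k n f.1 f.2
  map_add' _ _ := cls_add _ _ _ _ _
  map_smul' _ _ := cls_smul _ _ _ _

theorem clsHom_surjective (n : ℕ) : Function.Surjective (clsHom k G n) := fun x => by
  obtain ⟨f, hf, rfl⟩ := cls_surj n x
  exact ⟨⟨f, hf⟩, rfl⟩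

theorem cobd_cupCochain_eq_zero {m n : ℕ} {f : (Fin m → G) → k} {g : (Fin n → G) → k}
    (hf : cobd k m f = 0) (hg : cobd k n g = 0) : cobd k (m + n) (cupCochain f g) = 0 := by
  funext x
  rw [cobd_cupCochain, hf, hg]
  simp

/-- The cup product as a bilinear map on cocycles, with values in cohomology. -/
def cupCocyc (k : Type) [CommRing k] (G : Type) [Group G] (m n : ℕ) :
    cocyc k G m →ₗ[k] cocyc k G n →ₗ[k] Coh k G (m + n) :=
  LinearMap.mk₂ k
    (fun f g => clsHom k G (m + n) ⟨cupCochain f.1 g.1, cobd_cupCochain_eq_zero f.2 g.2⟩)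
    (fun _ _ _ => by
      rw [← map_add]; congr 1; ext x; exact add_mul _ _ _)
    (fun _ _ _ => by
      rw [← map_smul]; congr 1; ext x; exact mul_assoc _ _ _)
    (fun _ _ _ => by
      rw [← map_add]; congr 1; ext x; exact mul_add _ _ _)
    (fun _ _ _ => by
      rw [← map_smul]; congr 1; ext x; exact mul_left_comm _ _ _)

theorem cupCocyc_left {m n : ℕ} (f : cocyc k G m) (g : cocyc k G n) (hf : clsHom k G m f = 0) :
    cupCocyc k G m n f g = 0 := by
  obtain ⟨f, hf'⟩ := f
  cases m with
  | zero =>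
    obtain rfl : f = 0 := (cls_zero_eq_zero_iff f hf').1 hf
    exact LinearMap.map_zero₂ (cupCocyc k G 0 n) g
  | succ m =>
    obtain ⟨f', rfl⟩ := (cls_succ_eq_zero_iff m f hf').1 hf
    refine cls_eq_zero_of_cobd (m := m + n) (by omega) _ _ (cupCochain f' g.1) fun x => ?_
    rw [cobd_cupCochain, mem_cocyc.1 g.2]
    simp [cupCochain]

theorem cupCocyc_right {m n : ℕ} (f : cocyc k G m) (g : cocyc k G n) (hg : clsHom k G n g = 0) :
    cupCocyc k G m n f g = 0 := by
  obtain ⟨g, hg'⟩ := g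
  cases n with
  | zero =>
    obtain rfl : g = 0 := (cls_zero_eq_zero_iff g hg').1 hg
    exact map_zero (cupCocyc k G m 0 f)
  | succ n =>
    obtain ⟨g', rfl⟩ := (cls_succ_eq_zero_iff n g hg').1 hg
    refine cls_eq_zero_of_cobd (m := m + n) (by omega) _ _ ((-1 : k) ^ m • cupCochain f.1 g')
      fun x => ?_
    have : cobd k (m + n) ((-1 : k) ^ m • cupCochain f.1 g') =
        (-1 : k) ^ m • cobd k (m + n) (cupCochain f.1 g') := map_smul _ _ _
    rw [this, Pi.smul_apply, cobd_cupCochain, mem_cocyc.1 f.2]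
    simp [cupCochain, ← mul_assoc, ← mul_pow]

/-- Descent of a linear map along a surjection. -/
def descend {R M N P : Type*} [CommRing R] [AddCommGroup M] [AddCommGroup N] [AddCommGroup P]
    [Module R M] [Module R N] [Module R P] (q : M →ₗ[R] N) (hq : Function.Surjective q)
    (b : M →ₗ[R] P) (h : ∀ x, q x = 0 → b x = 0) : N →ₗ[R] P :=
  ((LinearMap.ker q).liftQ b h) ∘ₗ (q.quotKerEquivOfSurjective hq).symm.toLinearMap

theorem descend_apply {R M N P : Type*} [CommRing R] [AddCommGroup M] [AddCommGroup N]
    [AddCommGroup P] [Module R M] [Module R N] [Module R P] (q : M →ₗ[R] N)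
    (hq : Function.Surjective q) (b : M →ₗ[R] P) (h : ∀ x, q x = 0 → b x = 0) (x : M) :
    descend q hq b h (q x) = b x := by
  have : (q.quotKerEquivOfSurjective hq).symm (q x) = Submodule.Quotient.mk x := by
    rw [LinearEquiv.symm_apply_eq]
    rfl
  rw [descend, LinearMap.comp_apply, LinearEquiv.coe_coe, this]
  exact Submodule.liftQ_apply _ _ _

/-- The cup product `Hᵐ(G; k) × Hⁿ(G; k) → Hᵐ⁺ⁿ(G; k)`. -/
def cup (k : Type) [CommRing k] (G : Type) [Group G] (m n : ℕ) :
    Coh k G m →ₗ[k] Coh k G n →ₗ[k] Coh k G (m + n) :=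
  descend (clsHom k G m) (clsHom_surjective m)
    (LinearMap.flip (descend (clsHom k G n) (clsHom_surjective n) (cupCocyc k G m n).flip
      fun g hg => LinearMap.ext fun f => cupCocyc_right f g hg))
    fun f hf => LinearMap.ext fun y => by
      obtain ⟨g, rfl⟩ := clsHom_surjective n y
      rw [LinearMap.flip_apply, descend_apply]
      exact cupCocyc_left f g hf

theorem cup_cls {m n : ℕ} (f : (Fin m → G) → k) (g : (Fin n → G) → k)
    (hf : cobd k m f = 0) (hg : cobd k n g = 0) :
    cup k G m n (cls k m f hf) (cls k n g hg) =
      cls k (m + n) (cupCochain f g) (cobd_cupCochain_eq_zero hf hg) := by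
  change cup k G m n (clsHom k G m ⟨f, hf⟩) (clsHom k G n ⟨g, hg⟩) = _
  rw [cup, descend_apply, LinearMap.flip_apply, descend_apply]
  rfl

theorem cobd_one : cobd k 0 (1 : (Fin 0 → G) → k) = 0 := by
  funext x
  rw [cobd_apply]
  simp

/-- The unit of the cohomology ring. -/
def cohOne (k : Type) [CommRing k] (G : Type) [Group G] : Coh k G 0 := cls k 0 1 cobd_one

theorem one_cup {n : ℕ} (x : Coh k G n) :
    (⟨0 + n, cup k G 0 n (cohOne k G) x⟩ : GradedMonoid (Coh k G)) = ⟨n, x⟩ := by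
  obtain ⟨f, hf, rfl⟩ := cls_surj n x
  rw [cohOne, cup_cls]
  refine (cls_cast (by omega) _ _ _ _ fun y => ?_).symm
  simp [cupCochain]

theorem cup_one {n : ℕ} (x : Coh k G n) :
    (⟨n + 0, cup k G n 0 x (cohOne k G)⟩ : GradedMonoid (Coh k G)) = ⟨n, x⟩ := by
  obtain ⟨f, hf, rfl⟩ := cls_surj n x
  rw [cohOne, cup_cls]
  refine (cls_cast (by omega) _ _ _ _ fun y => ?_).symm
  simp [cupCochain]

theorem cup_assoc {l m n : ℕ} (x : Coh k G l) (y : Coh k G m) (z : Coh k G n) :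
    (⟨l + m + n, cup k G (l + m) n (cup k G l m x y) z⟩ : GradedMonoid (Coh k G)) =
      ⟨l + (m + n), cup k G l (m + n) x (cup k G m n y z)⟩ := by
  obtain ⟨f, hf, rfl⟩ := cls_surj l x
  obtain ⟨g, hg, rfl⟩ := cls_surj m y
  obtain ⟨h, hh, rfl⟩ := cls_surj n z
  rw [cup_cls, cup_cls, cup_cls, cup_cls]
  refine cls_cast (by omega) _ _ _ _ fun w => ?_
  simp only [cupCochain, mul_assoc]
  congr 3
  funext i
  congr 1
  ext
  simp [add_assoc]

/-- The map `φ^* : Hⁿ(K; k) → Hⁿ(G; k)` induced by a homomorphism `φ : G → K`. -/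
def pull (k : Type) [CommRing k] (φ : G →* K) (n : ℕ) : Coh k K n →ₗ[k] Coh k G n :=
  (groupCohomology.map (A := trivRep k K) (B := trivRep k G) φ
    (Rep.ofHom ⟨LinearMap.id, fun _ => rfl⟩) n).hom

theorem cobd_pull {n : ℕ} (φ : G →* K) (f : (Fin n → K) → k) (hf : cobd k n f = 0) :
    cobd k n (fun x : Fin n → G => f (fun i => φ (x i))) = 0 := by
  funext x
  rw [cobd_apply]
  have := congrFun hf (fun i => φ (x i))
  rw [cobd_apply] at this
  refine Eq.trans ?_ this
  congr! 4 with j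
  exact Fin.comp_contractNth (· * ·) (· * ·) (f := φ) (map_mul φ) j x

theorem pull_cls {n : ℕ} (φ : G →* K) (f : (Fin n → K) → k) (hf : cobd k n f = 0) :
    pull k φ n (cls k n f hf) = cls k n (fun x => f (fun i => φ (x i))) (cobd_pull φ f hf) := by
  unfold pull cls
  rw [groupCohomology.π_map_apply]
  congr 1
  apply (ModuleCat.mono_iff_injective (groupCohomology.iCocycles (trivRep k G) n)).1 inferInstance
  rw [groupCohomology.iCocycles_mk]
  have := HomologicalComplex.cyclesMap_i (groupCohomology.cochainsMap (A := trivRep k K)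
    (B := trivRep k G) φ (Rep.ofHom ⟨LinearMap.id, fun _ => rfl⟩)) n
  refine congr($this (groupCohomology.cocyclesMk f hf)).trans ?_
  rw [ModuleCat.comp_apply, groupCohomology.iCocycles_mk]
  rfl

theorem pull_cup (φ : G →* K) {m n : ℕ} (x : Coh k K m) (y : Coh k K n) :
    pull k φ (m + n) (cup k K m n x y) = cup k G m n (pull k φ m x) (pull k φ n y) := by
  obtain ⟨f, hf, rfl⟩ := cls_surj m x
  obtain ⟨g, hg, rfl⟩ := cls_surj n y
  rw [cup_cls, pull_cls, pull_cls, pull_cls, cup_cls]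
  rfl

theorem pull_one (φ : G →* K) : pull k φ 0 (cohOne k K) = cohOne k G := by
  rw [cohOne, pull_cls]
  rfl

theorem pull_pull (φ : G →* K) (ψ : K →* L) {n : ℕ} (x : Coh k L n) :
    pull k φ n (pull k ψ n x) = pull k (ψ.comp φ) n x := by
  obtain ⟨f, hf, rfl⟩ := cls_surj n x
  rw [pull_cls, pull_cls, pull_cls]
  rfl


/-- The homomorphism `P → Q`, `x ↦ s x s⁻¹`, for `s ∈ S` with `s P s⁻¹ ≤ Q`. -/
def conjHom {S : Type} [Group S] {P Q : Subgroup S} (s : S) (h : ∀ x ∈ P, s * x * s⁻¹ ∈ Q) :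
    P →* Q :=
  ((MulAut.conj s).toMonoidHom.comp P.subtype).codRestrict Q fun x => h x x.2

/-- A fusion system on `S`: a category whose objects are the subgroups of `S`, whose morphisms
`P → Q` are injective group homomorphisms including all those induced by conjugation by elements
of `S`, and in which every morphism is an isomorphism of the category followed by an inclusion. -/
structure FusionSystem (S : Type) [Group S] where
  Hom : ∀ P Q : Subgroup S, Set (P →* Q)
  injective : ∀ {P Q : Subgroup S} {φ : P →* Q}, φ ∈ Hom P Q → Function.Injective φ
  conj_mem : ∀ (P Q : Subgroup S) (s : S) (h : ∀ x ∈ P, s * x * s⁻¹ ∈ Q), conjHom s h ∈ Hom P Q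
  comp_mem : ∀ {P Q R : Subgroup S} {φ : P →* Q} {ψ : Q →* R},
    φ ∈ Hom P Q → ψ ∈ Hom Q R → ψ.comp φ ∈ Hom P R
  factor : ∀ {P Q : Subgroup S} {φ : P →* Q}, φ ∈ Hom P Q →
    ∃ (R : Subgroup S) (hR : R ≤ Q) (e : P ≃* R),
      e.toMonoidHom ∈ Hom P R ∧ e.symm.toMonoidHom ∈ Hom R P ∧
        φ = (Subgroup.inclusion hR).comp e.toMonoidHom

namespace FusionSystem

variable {S : Type} [Group S] (F : FusionSystem S)

theorem inclusion_mem {P Q : Subgroup S} (h : P ≤ Q) : Subgroup.inclusion h ∈ F.Hom P Q := by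
  convert F.conj_mem P Q 1 (by simpa using fun x hx => h hx) using 1
  ext x
  simp [conjHom]

theorem id_mem (P : Subgroup S) : MonoidHom.id P ∈ F.Hom P P :=
  F.inclusion_mem le_rfl

/-- `P` and `Q` are `F`-conjugate: they are isomorphic in `F`. -/
def Conj (P Q : Subgroup S) : Prop :=
  ∃ e : P ≃* Q, e.toMonoidHom ∈ F.Hom P Q ∧ e.symm.toMonoidHom ∈ F.Hom Q P

/-- `|C_S(P)| ≥ |C_S(P')|` for all `P'` that are `F`-conjugate to `P`. -/
def FullyCentralized (P : Subgroup S) : Prop :=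
  ∀ P', F.Conj P P' →
    Nat.card (Subgroup.centralizer (P' : Set S)) ≤ Nat.card (Subgroup.centralizer (P : Set S))

/-- `|N_S(P)| ≥ |N_S(P')|` for all `P'` that are `F`-conjugate to `P`. -/
def FullyNormalized (P : Subgroup S) : Prop :=
  ∀ P', F.Conj P P' →
    Nat.card (Subgroup.normalizer (P' : Set S)) ≤ Nat.card (Subgroup.normalizer (P : Set S))

/-- `C_S(P') ≤ P'` for all `P'` that are `F`-conjugate to `P`. -/
def Centric (P : Subgroup S) : Prop :=
  ∀ P', F.Conj P P' → Subgroup.centralizer (P' : Set S) ≤ P'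

/-- The group `Aut_F(P)`. -/
def aut (P : Subgroup S) : Subgroup (MulAut P) where
  carrier := {e | e.toMonoidHom ∈ F.Hom P P}
  mul_mem' {a b} ha hb := F.comp_mem (φ := b.toMonoidHom) (ψ := a.toMonoidHom) hb ha
  one_mem' := F.id_mem P
  inv_mem' {a} ha := by
    obtain ⟨R, hR, e, -, he', h⟩ := F.factor ha
    have hRP : R = P := le_antisymm hR fun x hx => by
      have hx' := congr($h (a.symm ⟨x, hx⟩))
      simp only [MulEquiv.toMonoidHom_eq_coe, MonoidHom.coe_coe, MulEquiv.apply_symm_apply,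
        MonoidHom.coe_comp, Function.comp_apply] at hx'
      have := congr(($hx' : S))
      simp only [Subgroup.coe_inclusion] at this
      rw [this]
      exact (e _).2
    subst hRP
    have : a = e := MulEquiv.ext fun x => congr($h x)
    subst this
    exact he'

/-- The group `Aut_S(P)` of automorphisms of `P` induced by conjugation in `S`. -/
def autS (P : Subgroup S) : Subgroup (MulAut P) := P.normalizerMonoidHom.range

/-- The image of `φ : P → Q`, as a subgroup of `S`. -/
def image {P Q : Subgroup S} (φ : P →* Q) : Subgroup S := (Q.subtype.comp φ).range

/-- `N_φ`: the `g ∈ N_S(P)` such that `φ c_g φ⁻¹ ∈ Aut_S(φ(P))`. -/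
def extGroup {P Q : Subgroup S} (φ : P →* Q) : Subgroup S where
  carrier := {g | ∃ hg : g ∈ Subgroup.normalizer (P : Set S),
    ∃ h ∈ Subgroup.normalizer (image φ : Set S),
    ∀ x : P, (φ (P.normalizerMonoidHom ⟨g, hg⟩ x) : S) = h * φ x * h⁻¹}
  mul_mem' := by
    rintro a b ⟨ha, k, hk, h⟩ ⟨hb, l, hl, h'⟩
    refine ⟨mul_mem ha hb, k * l, mul_mem hk hl, fun x => ?_⟩
    have : P.normalizerMonoidHom ⟨a * b, mul_mem ha hb⟩ =
      P.normalizerMonoidHom ⟨a, ha⟩ * P.normalizerMonoidHom ⟨b, hb⟩ := by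
      rw [← map_mul]; rfl
    rw [this, MulAut.mul_apply, h, h']
    group
  one_mem' := by
    refine ⟨one_mem _, 1, one_mem _, fun x => ?_⟩
    have : P.normalizerMonoidHom ⟨1, one_mem _⟩ = 1 := map_one P.normalizerMonoidHom
    rw [this]
    simp
  inv_mem' := by
    rintro a ⟨ha, k, hk, h⟩
    refine ⟨inv_mem ha, k⁻¹, inv_mem hk, fun x => ?_⟩
    have : P.normalizerMonoidHom ⟨a⁻¹, inv_mem ha⟩ = (P.normalizerMonoidHom ⟨a, ha⟩)⁻¹ := by
      rw [← map_inv]; rfl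
    rw [this]
    have h2 := h ((P.normalizerMonoidHom ⟨a, ha⟩)⁻¹ x)
    rw [MulAut.apply_inv_self] at h2
    rw [h2]
    group

theorem le_extGroup {P Q : Subgroup S} (φ : P →* Q) : P ≤ extGroup φ := by
  intro g hg
  refine ⟨Subgroup.le_normalizer hg, φ ⟨g, hg⟩, Subgroup.le_normalizer ⟨⟨g, hg⟩, rfl⟩, fun x => ?_⟩
  rw [← Subgroup.coe_inv, ← Subgroup.coe_mul, ← Subgroup.coe_mul, ← map_inv, ← map_mul, ← map_mul]
  rfl

/-- Saturation of a fusion system on a finite `p`-group. -/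
structure IsSaturated (p : ℕ) : Prop where
  fullyCentralized : ∀ P, F.FullyNormalized P → F.FullyCentralized P
  sylow : ∀ P, F.FullyNormalized P →
    ∃ T : Sylow p (F.aut P), (T : Subgroup (F.aut P)).map (F.aut P).subtype = autS P
  extend : ∀ (P : Subgroup S) (φ : P →* (⊤ : Subgroup S)), φ ∈ F.Hom P ⊤ →
    F.FullyCentralized (image φ) →
      ∃ ψ ∈ F.Hom (extGroup φ) ⊤, ψ.comp (Subgroup.inclusion (le_extGroup φ)) = φ

theorem corestrict_mem {P Q R : Subgroup S} {φ : P →* Q} (hφ : φ ∈ F.Hom P Q) (ψ : P →* R)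
    (h : ∀ x, (ψ x : S) = φ x) : ψ ∈ F.Hom P R := by
  obtain ⟨T, hT, e, he, he', rfl⟩ := F.factor hφ
  have hTR : T ≤ R := fun x hx => by
    have := h (e.symm ⟨x, hx⟩)
    simp at this
    rw [← this]
    exact (ψ _).2
  convert F.comp_mem he (F.inclusion_mem hTR)
  ext x
  exact h x

variable {S₁ S₂ : Type} [Group S₁] [Group S₂]

/-- The projection `P → P₁` for `P ≤ S₁ × S₂` whose first projection lies in `P₁`. -/
def projFst (P : Subgroup (S₁ × S₂)) (P₁ : Subgroup S₁) (h : ∀ x ∈ P, x.1 ∈ P₁) : P →* P₁ :=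
  ((MonoidHom.fst S₁ S₂).comp P.subtype).codRestrict P₁ fun x => h x x.2

/-- The projection `P → P₂` for `P ≤ S₁ × S₂` whose second projection lies in `P₂`. -/
def projSnd (P : Subgroup (S₁ × S₂)) (P₂ : Subgroup S₂) (h : ∀ x ∈ P, x.2 ∈ P₂) : P →* P₂ :=
  ((MonoidHom.snd S₁ S₂).comp P.subtype).codRestrict P₂ fun x => h x x.2

/-- The morphisms `P → Q` of `F₁ × F₂`: the homomorphisms that are restrictions of `φ₁ × φ₂`, where
`φ₁ : P₁ → S₁` and `φ₂ : P₂ → S₂` are morphisms of `F₁` and `F₂` on the projections of `P`. -/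
def prodHom (F₁ : FusionSystem S₁) (F₂ : FusionSystem S₂) (P Q : Subgroup (S₁ × S₂)) :
    Set (P →* Q) :=
  {φ | ∃ φ₁ ∈ F₁.Hom (P.map (MonoidHom.fst S₁ S₂)) ⊤,
    ∃ φ₂ ∈ F₂.Hom (P.map (MonoidHom.snd S₁ S₂)) ⊤,
    ∀ x : P, (φ x : S₁ × S₂) =
      ((φ₁ ⟨x.1.1, Subgroup.mem_map_of_mem (MonoidHom.fst S₁ S₂) x.2⟩ : S₁),
       (φ₂ ⟨x.1.2, Subgroup.mem_map_of_mem (MonoidHom.snd S₁ S₂) x.2⟩ : S₂))}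

/-- The product fusion system `F₁ × F₂` on `S₁ × S₂`. -/
def prod (F₁ : FusionSystem S₁) (F₂ : FusionSystem S₂) : FusionSystem (S₁ × S₂) where
  Hom := prodHom F₁ F₂
  injective := by
    rintro P Q φ ⟨φ₁, h₁, φ₂, h₂, h⟩ x y hxy
    have := congr(($hxy : S₁ × S₂))
    rw [h, h, Prod.mk.injEq] at this
    have h1 := congr(($(F₁.injective h₁ (Subtype.ext this.1)) : S₁))
    have h2 := congr(($(F₂.injective h₂ (Subtype.ext this.2)) : S₂))
    exact Subtype.ext (Prod.ext h1 h2)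
  conj_mem P Q s h :=
    ⟨conjHom s.1 fun _ _ => trivial, F₁.conj_mem _ _ _ _,
      conjHom s.2 fun _ _ => trivial, F₂.conj_mem _ _ _ _, fun _ => rfl⟩
  comp_mem := by
    rintro P Q R φ ψ ⟨φ₁, h₁, φ₂, h₂, h⟩ ⟨ψ₁, k₁, ψ₂, k₂, k⟩
    have a₁ : ∀ x, (φ₁ x : S₁) ∈ Q.map (MonoidHom.fst S₁ S₂) := by
      rintro ⟨_, x, hx, rfl⟩
      exact ⟨φ ⟨x, hx⟩, (φ ⟨x, hx⟩).2, congr(($(h ⟨x, hx⟩)).1)⟩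
    have a₂ : ∀ x, (φ₂ x : S₂) ∈ Q.map (MonoidHom.snd S₁ S₂) := by
      rintro ⟨_, x, hx, rfl⟩
      exact ⟨φ ⟨x, hx⟩, (φ ⟨x, hx⟩).2, congr(($(h ⟨x, hx⟩)).2)⟩
    refine ⟨_, F₁.comp_mem (F₁.corestrict_mem h₁
        (((Subgroup.subtype ⊤).comp φ₁).codRestrict _ a₁) fun _ => rfl) k₁,
      _, F₂.comp_mem (F₂.corestrict_mem h₂
        (((Subgroup.subtype ⊤).comp φ₂).codRestrict _ a₂) fun _ => rfl) k₂, fun x => ?_⟩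
    rw [MonoidHom.comp_apply, k]
    have h1 : (φ x : S₁ × S₂).1 = _ := congr(($(h x)).1)
    have h2 : (φ x : S₁ × S₂).2 = _ := congr(($(h x)).2)
    simp only [h1, h2]
    rfl
  factor := by
    rintro P Q φ ⟨φ₁, h₁, φ₂, h₂, h⟩
    have hinj : Function.Injective φ := by
      intro x y hxy
      have := congr(($hxy : S₁ × S₂))
      rw [h, h, Prod.mk.injEq] at this
      have h1 := congr(($(F₁.injective h₁ (Subtype.ext this.1)) : S₁))
      have h2 := congr(($(F₂.injective h₂ (Subtype.ext this.2)) : S₂))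
      exact Subtype.ext (Prod.ext h1 h2)
    have hinj' : Function.Injective (Q.subtype.comp φ) := Subtype.val_injective.comp hinj
    have hR : image φ ≤ Q := by
      rintro _ ⟨x, rfl⟩
      exact (φ x).2
    let e : P ≃* image φ := MonoidHom.ofInjective hinj'
    have he : ∀ x, (e x : S₁ × S₂) = φ x := fun x => rfl
    refine ⟨image φ, hR, e, ⟨φ₁, h₁, φ₂, h₂, fun x => (he x).trans (h x)⟩, ?_, ?_⟩
    · obtain ⟨T₁, hT₁, e₁, -, he₁, rfl⟩ := F₁.factor h₁
      obtain ⟨T₂, hT₂, e₂, -, he₂, rfl⟩ := F₂.factor h₂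
      have b₁ : (image φ).map (MonoidHom.fst S₁ S₂) ≤ T₁ := by
        rintro _ ⟨_, ⟨x, rfl⟩, rfl⟩
        change (φ x : S₁ × S₂).1 ∈ _
        rw [h]
        exact (e₁ _).2
      have b₂ : (image φ).map (MonoidHom.snd S₁ S₂) ≤ T₂ := by
        rintro _ ⟨_, ⟨x, rfl⟩, rfl⟩
        change (φ x : S₁ × S₂).2 ∈ _
        rw [h]
        exact (e₂ _).2
      refine ⟨_, F₁.comp_mem (F₁.comp_mem (F₁.inclusion_mem b₁) he₁) (F₁.inclusion_mem le_top),
        _, F₂.comp_mem (F₂.comp_mem (F₂.inclusion_mem b₂) he₂) (F₂.inclusion_mem le_top),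
        fun y => ?_⟩
      obtain ⟨x, rfl⟩ := e.surjective y
      have hx : (e x : S₁ × S₂) = _ := (he x).trans (h x)
      simp only [MulEquiv.toMonoidHom_eq_coe, MonoidHom.coe_coe, MulEquiv.symm_apply_apply]
      refine Prod.ext ?_ ?_
      · have : Subgroup.inclusion b₁ ⟨(e x : S₁ × S₂).1, Subgroup.mem_map_of_mem _ (e x).2⟩ =
            e₁ ⟨x.1.1, Subgroup.mem_map_of_mem (MonoidHom.fst S₁ S₂) x.2⟩ :=
          Subtype.ext congr(($hx).1)
        have := congr(e₁.symm $this)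
        rw [MulEquiv.symm_apply_apply] at this
        exact congr(($this : S₁)).symm
      · have : Subgroup.inclusion b₂ ⟨(e x : S₁ × S₂).2, Subgroup.mem_map_of_mem _ (e x).2⟩ =
            e₂ ⟨x.1.2, Subgroup.mem_map_of_mem (MonoidHom.snd S₁ S₂) x.2⟩ :=
          Subtype.ext congr(($hx).2)
        have := congr(e₂.symm $this)
        rw [MulEquiv.symm_apply_apply] at this
        exact congr(($this : S₂)).symm
    · ext x <;> rfl

end FusionSystem

open FusionSystem

variable {S : Type} [Group S]

/-- The degree `n` part of `H^*(F)`, the inverse limit of `Hⁿ(-; k)` over the `F`-centric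
subgroups: families of classes `x_P ∈ Hⁿ(P; k)`, one for each `F`-centric `P`, with
`φ^* x_Q = x_P` for all morphisms `φ : P → Q` of `F` between `F`-centric subgroups. As inner
automorphisms of `Q` act trivially on `Hⁿ(Q; k)`, it makes no difference whether one runs
over the morphisms `φ` or over their classes modulo `Inn(Q)` in the orbit category. -/
def HF (k : Type) [CommRing k] (F : FusionSystem S) (n : ℕ) :
    Submodule k (∀ P : {P : Subgroup S // F.Centric P}, Coh k P.1 n) where
  carrier := {x | ∀ (P Q : {P : Subgroup S // F.Centric P}), ∀ φ ∈ F.Hom P.1 Q.1,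
    pull k φ n (x Q) = x P}
  add_mem' hx hy P Q φ hφ := by
    rw [Pi.add_apply, map_add, hx P Q φ hφ, hy P Q φ hφ]
    rfl
  zero_mem' P Q φ _ := map_zero _
  smul_mem' r x hx P Q φ hφ := by
    rw [Pi.smul_apply, map_smul, hx P Q φ hφ]
    rfl

namespace HF

variable {F : FusionSystem S}

theorem ext_sigma {m n : ℕ} (e : m = n) (x : HF k F m) (y : HF k F n)
    (h : ∀ P, (⟨m, x.1 P⟩ : GradedMonoid (Coh k P.1)) = ⟨n, y.1 P⟩) :
    (⟨m, x⟩ : GradedMonoid fun n => HF k F n) = ⟨n, y⟩ := by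
  subst e
  obtain rfl : x = y := Subtype.ext (funext fun P => eq_of_heq (Sigma.mk.inj (h P)).2)
  rfl

/-- The product of compatible families, formed by taking cup products. -/
def mul {m n : ℕ} (x : HF k F m) (y : HF k F n) : HF k F (m + n) :=
  ⟨fun P => cup k P.1 m n (x.1 P) (y.1 P), fun P Q φ hφ => by
    rw [pull_cup, x.2 P Q φ hφ, y.2 P Q φ hφ]⟩

/-- The unit family. -/
def one : HF k F 0 :=
  ⟨fun P => cohOne k P.1, fun _ _ φ _ => pull_one φ⟩

instance : GradedMonoid.GOne fun n => HF k F n := ⟨one⟩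

instance : GradedMonoid.GMul fun n => HF k F n := ⟨mul⟩

instance : GradedMonoid.GMonoid fun n => HF k F n where
  one_mul := fun ⟨_, x⟩ => ext_sigma (zero_add _) _ _ fun P => one_cup (x.1 P)
  mul_one := fun ⟨_, x⟩ => ext_sigma (add_zero _) _ _ fun P => cup_one (x.1 P)
  mul_assoc := fun ⟨_, x⟩ ⟨_, y⟩ ⟨_, z⟩ => ext_sigma (add_assoc _ _ _) _ _
    fun P => cup_assoc (x.1 P) (y.1 P) (z.1 P)

instance : DirectSum.GRing fun n => HF k F n where
  mul_zero a := Subtype.ext (funext fun P => map_zero (cup k P.1 _ _ (a.1 P)))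
  zero_mul b := Subtype.ext (funext fun P => LinearMap.map_zero₂ (cup k P.1 _ _) (b.1 P))
  mul_add a b c := Subtype.ext (funext fun P => map_add (cup k P.1 _ _ (a.1 P)) (b.1 P) (c.1 P))
  add_mul a b c := Subtype.ext
    (funext fun P => LinearMap.map_add₂ (cup k P.1 _ _) (a.1 P) (b.1 P) (c.1 P))
  natCast j := (j : k) • one
  natCast_zero := by simp
  natCast_succ j := by
    push_cast
    exact (add_smul _ _ _).trans (congrArg _ (one_smul _ _))
  intCast j := (j : k) • one
  intCast_ofNat j := by simp
  intCast_negSucc_ofNat j := by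
    rw [Int.cast_negSucc]
    exact neg_smul ((j + 1 : ℕ) : k) (one : HF k F 0)

theorem smul_one_mul (r : k) {n : ℕ} (x : HF k F n) :
    (⟨0 + n, mul (r • one) x⟩ : GradedMonoid fun n => HF k F n) = ⟨n, r • x⟩ := by
  have h : mul (r • one) x = mul one (r • x) := Subtype.ext (funext fun P => by
    exact (LinearMap.map_smul₂ (cup k P.1 _ _) r (cohOne k P.1) (x.1 P)).trans
      (map_smul (cup k P.1 _ _ (cohOne k P.1)) r (x.1 P)).symm)
  rw [h]
  exact ext_sigma (by simp) _ _ fun P => one_cup _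

theorem mul_smul_one (r : k) {n : ℕ} (x : HF k F n) :
    (⟨n + 0, mul x (r • one)⟩ : GradedMonoid fun n => HF k F n) = ⟨n, r • x⟩ := by
  have h : mul x (r • one) = mul (r • x) one := Subtype.ext (funext fun P => by
    exact (map_smul (cup k P.1 _ _ (x.1 P)) r (cohOne k P.1)).trans
      (LinearMap.map_smul₂ (cup k P.1 _ _) r (x.1 P) (cohOne k P.1)).symm)
  rw [h]
  exact ext_sigma (by simp) _ _ fun P => cup_one _

instance : DirectSum.GAlgebra k fun n => HF k F n where
  toFun := ((LinearMap.id : k →ₗ[k] k).smulRight (one : HF k F 0)).toAddMonoidHom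
  map_one := one_smul k (one : HF k F 0)
  map_mul r s := by
    refine (?_ : (⟨0, (r * s) • one⟩ : GradedMonoid fun n => HF k F n) = _).trans
      (smul_one_mul r (s • one)).symm
    rw [mul_smul]
  commutes := fun r ⟨_, x⟩ => (smul_one_mul r x).trans (mul_smul_one r x).symm
  smul_def := fun r ⟨_, x⟩ => (smul_one_mul r x).symm

end HF

/-- The graded `k`-algebra `H^*(F) = ⨁ₙ Hⁿ(F)`. -/
def FusionCoh (k : Type) [CommRing k] (F : FusionSystem S) : Type := ⨁ n, HF k F n

instance (k : Type) [CommRing k] (F : FusionSystem S) : Ring (FusionCoh k F) :=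
  inferInstanceAs (Ring (⨁ n, HF k F n))

instance (k : Type) [CommRing k] (F : FusionSystem S) : Algebra k (FusionCoh k F) :=
  inferInstanceAs (Algebra k (⨁ n, HF k F n))

/-- The inclusion of the degree `n` part in `H^*(F)`. -/
def inDeg (k : Type) [CommRing k] (F : FusionSystem S) (n : ℕ) : HF k F n →ₗ[k] FusionCoh k F :=
  DirectSum.lof k ℕ (fun n => HF k F n) n

theorem inDeg_mul {F : FusionSystem S} {m n : ℕ} (x : HF k F m) (y : HF k F n) :
    inDeg k F m x * inDeg k F n y = inDeg k F (m + n) (HF.mul x y) :=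
  DirectSum.of_mul_of (A := fun n => HF k F n) x y

theorem inDeg_injective (F : FusionSystem S) (n : ℕ) : Function.Injective (inDeg k F n) :=
  DirectSum.of_injective (β := fun n => HF k F n) n

/-- The linear map out of `H^*(F)` given by linear maps on the homogeneous parts. -/
def FusionCoh.lift {F : FusionSystem S} {M : Type*} [AddCommMonoid M] [Module k M]
    (f : ∀ n, HF k F n →ₗ[k] M) : FusionCoh k F →ₗ[k] M :=
  DirectSum.toModule k ℕ M f

theorem FusionCoh.lift_inDeg {F : FusionSystem S} {M : Type*} [AddCommMonoid M]
    [Module k M] (f : ∀ n, HF k F n →ₗ[k] M) (n : ℕ) (x : HF k F n) :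
    FusionCoh.lift f (inDeg k F n x) = f n x :=
  DirectSum.toModule_lof (M := fun n => HF k F n) k n x

theorem FusionCoh.hom_ext {F : FusionSystem S} {M : Type*} [AddCommMonoid M] [Module k M]
    {f g : FusionCoh k F →ₗ[k] M} (h : ∀ n x, f (inDeg k F n x) = g (inDeg k F n x)) : f = g :=
  DirectSum.linearMap_ext k fun n => LinearMap.ext (h n)

/-- The grading of `H^*(F)` by its submodules of homogeneous elements. -/
def cohGrading (k : Type) [CommRing k] (F : FusionSystem S) (n : ℕ) : Submodule k (FusionCoh k F) :=
  LinearMap.range (inDeg k F n)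

/-- `inDeg`, with values in the homogeneous elements of degree `n`. -/
def toGrading (k : Type) [CommRing k] (F : FusionSystem S) (n : ℕ) :
    HF k F n →ₗ[k] cohGrading k F n :=
  (inDeg k F n).codRestrict (cohGrading k F n) fun x => ⟨x, rfl⟩

instance (k : Type) [CommRing k] (F : FusionSystem S) : GradedAlgebra (cohGrading k F) where
  one_mem := ⟨HF.one, rfl⟩
  mul_mem := by
    rintro i j _ _ ⟨x, rfl⟩ ⟨y, rfl⟩
    exact ⟨HF.mul x y, (inDeg_mul x y).symm⟩
  toDecomposition := DirectSum.Decomposition.ofLinearMap (cohGrading k F)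
    (FusionCoh.lift fun n =>
      DirectSum.lof k ℕ (fun n => cohGrading k F n) n ∘ₗ toGrading k F n)
    (FusionCoh.hom_ext fun n x => by
      rw [LinearMap.comp_apply, FusionCoh.lift_inDeg, LinearMap.comp_apply,
        DirectSum.coeLinearMap_lof]
      rfl)
    (by
      ext n ⟨_, x, rfl⟩ : 2
      rw [LinearMap.comp_apply, LinearMap.comp_apply, DirectSum.coeLinearMap_lof,
        FusionCoh.lift_inDeg]
      rfl)

/-- The total cohomology `⨁ₙ Hⁿ(G; k)`, as a graded vector space. -/
abbrev TotalCoh (k : Type) [CommRing k] (G : Type) [Group G] : Type := ⨁ n, Coh k G n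

/-- A family of operations `θ_a : Hⁿ(G; k) → H^{n + deg a}(G; k)` on the cohomology of all finite
groups, natural in `G` and satisfying the Cartan formula
`θ_a(x ∪ y) = ∑ c_{b,b'} (-1)^{deg b' · deg x} θ_b(x) ∪ θ_{b'}(y)` for the coproduct
`a ↦ ∑ c_{b,b'} b ⊗ b'`. For `k = 𝔽_p`, the index set may be a homogeneous basis of the
Steenrod algebra, with its coproduct and its action on cohomology. -/
structure CartanFamily (k : Type) [CommRing k] where
  Index : Type
  deg : Index → ℕ
  coprod : Index → (Index × Index →₀ k)
  op : ∀ (a : Index) (G : Type) [Group G] [Finite G] (n : ℕ),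
    Coh k G n →ₗ[k] Coh k G (n + deg a)
  natural : ∀ (a : Index) (G K : Type) [Group G] [Finite G] [Group K] [Finite K] (φ : G →* K)
    (n : ℕ) (x : Coh k K n), pull k φ (n + deg a) (op a K n x) = op a G n (pull k φ n x)
  cartan : ∀ (a : Index) (G : Type) [Group G] [Finite G] (m n : ℕ) (x : Coh k G m)
    (y : Coh k G n),
    (DirectSum.lof k ℕ (Coh k G) _ (op a G (m + n) (cup k G m n x y)) : TotalCoh k G) =
      (coprod a).sum fun b c => (c * (-1) ^ (deg b.2 * m)) •
        (DirectSum.lof k ℕ (Coh k G) _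
          (cup k G _ _ (op b.1 G m x) (op b.2 G n y)) : TotalCoh k G)

/-- The operation `θ_a` on `H^*(F)`, applied to each member of a compatible family. -/
def CartanFamily.onFusion [Finite S] (Θ : CartanFamily k) (F : FusionSystem S) (a : Θ.Index) :
    FusionCoh k F →ₗ[k] FusionCoh k F :=
  FusionCoh.lift fun n => inDeg k F (n + Θ.deg a) ∘ₗ
    { toFun := fun x => ⟨fun P => Θ.op a P.1 n (x.1 P), fun P Q φ hφ => by
        rw [Θ.natural, x.2 P Q φ hφ]⟩
      map_add' := fun x y => Subtype.ext (funext fun P => map_add (Θ.op a P.1 n) (x.1 P) (y.1 P))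
      map_smul' := fun r x => Subtype.ext (funext fun P => map_smul (Θ.op a P.1 n) r (x.1 P)) }

/-- `z` is the external product of `x` and `y`: `z_P = pr₁^* x_{P₁} ∪ pr₂^* y_{P₂}` for all centric
`P ≤ P₁ × P₂`. In particular `z = pr₁^* x ∪ pr₂^* y` in the cohomology of `S₁ × S₂`. -/
def IsExternalProduct {S₁ S₂ : Type} [Group S₁] [Group S₂] {F₁ : FusionSystem S₁}
    {F₂ : FusionSystem S₂} {m n : ℕ} (x : HF k F₁ m) (y : HF k F₂ n)
    (z : HF k (F₁.prod F₂) (m + n)) : Prop :=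
  ∀ (P : {P : Subgroup (S₁ × S₂) // (F₁.prod F₂).Centric P})
    (P₁ : {P : Subgroup S₁ // F₁.Centric P}) (P₂ : {P : Subgroup S₂ // F₂.Centric P})
    (h₁ : ∀ s ∈ P.1, s.1 ∈ P₁.1) (h₂ : ∀ s ∈ P.1, s.2 ∈ P₂.1),
    z.1 P = cup k P.1 m n (pull k (projFst P.1 P₁.1 h₁) m (x.1 P₁))
      (pull k (projSnd P.1 P₂.1 h₂) n (y.1 P₂))

end FusionKunneth

end

/-! Restriction to the full group `S` embeds `H^*(F)` in `H^*(S)`. Its image consists of the stable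
classes `v`: those with `φ^* v = incl^* v` for every morphism `φ : P → S` from a centric subgroup
(`evalAt_top_injective`, `mem_range_evalAt`). So `H^*(F)` is a common kernel of linear maps on
`H^*(S)`, and the theorem combines the Künneth theorem for finite groups with the fact that over a
field the tensor product of two common kernels is cut out of `V ⊗ W` by the conditions on each side
(`mem_range_map`).

Injectivity of the external product follows at once from Künneth for `S₁ × S₂`. For surjectivity,
Künneth gives a tensor `u` representing the value of `z` at `S₁ × S₂`. If `P₁` and `P₂` are centric,
so is `P₁ × P₂` (`Centric.prod`), and `z` is stable under `φ₁ × φ₂`. Comparing `φ × id` with `incl ×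
id` on `P₁ × S₂`, and applying Künneth to `P₁ × S₂`, shows that `u` is killed by `(φ^* - incl^*) ⊗
1`; the other side is symmetric. Hence `u` comes from `H^*(F₁) ⊗ H^*(F₂)`
(`FusionCoh.extProd_bijective`). That the external product is defined on all centric `P` uses that
both projections of `P` are centric (`Centric.map_fst`, `Centric.map_snd`).

Künneth for `G × K` is proved by dimension shifting in the `G`-variable, with coefficients in a
representation `A` of `G`. For the coinduced representation `G → A` it reduces, by a Shapiro
argument with an explicit prism homotopy, to the cohomology of `K` with trivial coefficients. The
exact sequence `A → (G → A) → quotient` and the two four lemmas then raise the degree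
(`kunneth_module`). The same shifting proves that classes pulled back from `G` and from `K` commute
up to the Koszul sign (`cross_comm`), which makes the map multiplicative. Compatibility with the
operations is the Cartan formula on each `P` together with naturality under the two projections. -/

noncomputable section

namespace FusionKunneth

/-! ### Inhomogeneous cochains as functions on lists: coboundary, cup products, degrees. -/

section ListCochains

set_option linter.unusedSectionVars false

variable {k : Type} [Field k] {H L A B : Type} [Group H] [Group L]
  [AddCommGroup A] [Module k A] [AddCommGroup B] [Module k B]

/-- The faces of a cochain on lists other than the first one, with signs. -/
def faceSum : (List H → A) → List H → A
  | _, [] => 0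
  | Y, [_] => -Y []
  | Y, x :: y :: l => -Y (x * y :: l) - faceSum (fun m => Y (x :: m)) (y :: l)

@[simp] theorem faceSum_nil (Y : List H → A) : faceSum Y [] = 0 := rfl

@[simp] theorem faceSum_single (Y : List H → A) (x : H) : faceSum Y [x] = -Y [] := rfl

theorem faceSum_cons_cons (Y : List H → A) (x y : H) (l : List H) :
    faceSum Y (x :: y :: l) = -Y (x * y :: l) - faceSum (fun m => Y (x :: m)) (y :: l) := rfl

theorem faceSum_add (Y Z : List H → A) (l : List H) :
    faceSum (fun m => Y m + Z m) l = faceSum Y l + faceSum Z l := by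
  induction l generalizing Y Z with
  | nil => simp
  | cons x l ih =>
    cases l with
    | nil => simp only [faceSum_single]; abel
    | cons y l =>
      simp only [faceSum_cons_cons, ih]
      abel

theorem faceSum_addHom (q : A →+ B) (Y : List H → A) (l : List H) :
    faceSum (fun m => q (Y m)) l = q (faceSum Y l) := by
  induction l generalizing Y with
  | nil => simp
  | cons x l ih =>
    cases l with
    | nil => simp
    | cons y l => simp only [faceSum_cons_cons, ih (fun m => Y (x :: m)), map_sub, map_neg]

theorem faceSum_map (q : A →ₗ[k] B) (Y : List H → A) (l : List H) :
    faceSum (fun m => q (Y m)) l = q (faceSum Y l) :=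
  faceSum_addHom q.toAddMonoidHom Y l

theorem faceSum_comp (φ : L →* H) (Y : List H → A) (l : List L) :
    faceSum (fun m => Y (m.map φ)) l = faceSum Y (l.map φ) := by
  induction l generalizing Y with
  | nil => simp
  | cons x l ih =>
    cases l with
    | nil => simp
    | cons y l =>
      simp only [List.map_cons, faceSum_cons_cons, map_mul] at ih ⊢
      rw [← ih (fun m => Y (φ x :: m))]

theorem faceSum_neg (Y : List H → A) (l : List H) :
    faceSum (fun m => -Y m) l = -faceSum Y l :=
  faceSum_addHom (-AddMonoidHom.id A) Y l

theorem faceSum_sub (Y Z : List H → A) (l : List H) :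
    faceSum (fun m => Y m - Z m) l = faceSum Y l - faceSum Z l := by
  simp only [sub_eq_add_neg, faceSum_add, faceSum_neg]

theorem faceSum_smul (c : k) (Y : List H → A) (l : List H) :
    faceSum (fun m => c • Y m) l = c • faceSum Y l :=
  faceSum_map (LinearMap.lsmul k A c) Y l

theorem faceSum_smul_const (g : List H → k) (a : A) (l : List H) :
    faceSum (fun m => g m • a) l = faceSum g l • a :=
  faceSum_map (LinearMap.toSpanSingleton k A a) g l

/-- The cochain `(x, m) ↦ Y (h * x, m)`. -/
def shift (h : H) (Y : List H → A) : List H → A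
  | [] => Y []
  | x :: m => Y (h * x :: m)

@[simp] theorem shift_nil (h : H) (Y : List H → A) : shift h Y [] = Y [] := rfl

@[simp] theorem shift_cons (h : H) (Y : List H → A) (x : H) (m : List H) :
    shift h Y (x :: m) = Y (h * x :: m) := rfl

/-- Contracting `x` with the letter after it is `shift x`, whose value on the empty list supplies
the last face; all other faces leave `x` alone. The inductions below run on this recursion. -/
theorem faceSum_head (x : H) (Y : List H → A) : (fun m => faceSum Y (x :: m)) = fun m =>
    -shift x Y m - faceSum (fun m => Y (x :: m)) m := by
  funext m
  cases m <;> simp [faceSum_cons_cons]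

theorem faceSum_shift (h : H) (Y : List H → A) (y : H) (l : List H) :
    faceSum (shift h Y) (y :: l) = faceSum Y (h * y :: l) := by
  cases l with
  | nil => simp
  | cons z l => simp only [faceSum_cons_cons, mul_assoc, shift_cons]

/-- The contraction of the first two letters followed by the remaining faces occurs twice with
opposite signs, by `faceSum_shift`; what is left is the same sum for `Y (x :: ·)`. -/
theorem faceSum_faceSum (Y : List H → A) (l : List H) : faceSum (faceSum Y) l = 0 := by
  induction l generalizing Y with
  | nil => simp
  | cons x l ih =>
    cases l with
    | nil => simp
    | cons y l =>
      rw [faceSum_cons_cons]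
      rw [faceSum_head, faceSum_sub, faceSum_neg, faceSum_shift, ih]
      abel

/-- The coboundary of a cochain on lists, with coefficients in a representation. -/
def dl (ρ : Representation k H A) : (List H → A) →ₗ[k] (List H → A) where
  toFun Y l := (l.casesOn 0 fun x m => ρ x (Y m)) + faceSum Y l
  map_add' Y Z := by
    funext l
    cases l <;> simp [Pi.add_def, faceSum_add]
    abel
  map_smul' c Y := by
    funext l
    cases l <;> simp [Pi.smul_def, faceSum_smul]

variable (ρ : Representation k H A) (σ : Representation k H B)

@[simp] theorem dl_nil (Y : List H → A) : dl ρ Y [] = 0 := by simp [dl]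

theorem dl_cons (Y : List H → A) (x : H) (l : List H) :
    dl ρ Y (x :: l) = ρ x (Y l) + faceSum Y (x :: l) := rfl

theorem dl_dl (Y : List H → A) : dl ρ (dl ρ Y) = 0 := by
  funext l
  cases l with
  | nil => simp
  | cons x l =>
    have : dl ρ Y = fun l => (l.casesOn 0 fun x m => ρ x (Y m) : A) + faceSum Y l := rfl
    rw [dl_cons]
    nth_rw 2 [this]
    rw [faceSum_add, faceSum_faceSum]
    cases l with
    | nil => simp
    | cons y l =>
      simp only [faceSum_cons_cons, dl_cons, faceSum_map, map_mul, map_add]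
      simp

theorem dl_map (q : A →ₗ[k] B) (hq : ∀ h a, q (ρ h a) = σ h (q a)) (Y : List H → A) :
    dl σ (fun l => q (Y l)) = fun l => q (dl ρ Y l) := by
  funext l
  cases l <;> simp [dl_cons, faceSum_map, hq]

theorem dl_comp (φ : L →* H) (Y : List H → A) :
    dl (ρ.comp φ) (fun l => Y (l.map φ)) = fun l => dl ρ Y (l.map φ) := by
  funext l
  cases l <;> simp [dl_cons, faceSum_comp]

/-- The cup product of a cochain with one with trivial coefficients. -/
def cupL : (List H → A) → (List H → k) → List H → A
  | f, g, [] => g [] • f []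
  | f, g, h :: t => g (h :: t) • f [] + cupL (fun m => f (h :: m)) g t

theorem cupL_nil (f : List H → A) (g : List H → k) : cupL f g [] = g [] • f [] := rfl

theorem cupL_cons (f : List H → A) (g : List H → k) (h : H) (t : List H) :
    cupL f g (h :: t) = g (h :: t) • f [] + cupL (fun m => f (h :: m)) g t := rfl

theorem cupL_map (q : A →ₗ[k] B) (f : List H → A) (g : List H → k) (l : List H) :
    cupL (fun m => q (f m)) g l = q (cupL f g l) := by
  induction l generalizing f with
  | nil => simp [cupL_nil]
  | cons h t ih => simp [cupL_cons, ih fun m => f (h :: m)]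

theorem cupL_add (f f' : List H → A) (g : List H → k) (l : List H) :
    cupL (fun m => f m + f' m) g l = cupL f g l + cupL f' g l := by
  induction l generalizing f f' with
  | nil => simp [cupL_nil]
  | cons h t ih => simp only [cupL_cons, ih, smul_add]; abel

/-- `cupL` as a linear map in the first variable. -/
def cupLeft (A : Type) [AddCommGroup A] [Module k A] (g : List H → k) :
    (List H → A) →ₗ[k] (List H → A) where
  toFun f := cupL f g
  map_add' f f' := funext fun l => cupL_add f f' g l
  map_smul' c f := funext fun l => cupL_map (LinearMap.lsmul k A c) f g l

theorem cupLeft_apply (f : List H → A) (g : List H → k) : cupLeft A g f = cupL f g := rfl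

/-- `cupL` sums over all splittings of the list into a head for `f` and a tail for `g`. Since `g` is
a cocycle, the faces inside the tail add up to minus the omitted first face of `g`, and this is the
term that the last face of `f` contributes. As `dg = 0`, no sign and no homogeneity of `f` enter. -/
theorem faceSum_cupL {g : List H → k} (hg : dl (1 : Representation k H k) g = 0)
    (f : List H → A) (l : List H) : faceSum (cupL f g) l = cupL (faceSum f) g l := by
  induction l generalizing f with
  | nil => simp [cupL_nil]
  | cons h t ih =>
    cases t with
    | nil => simp [cupL_nil, cupL_cons]
    | cons y t =>
      have e : (fun m => cupL f g (h :: m)) =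
        fun m => g (h :: m) • f [] + cupL (fun m => f (h :: m)) g m := rfl
      have hg' := congrFun hg (h :: y :: t)
      rw [dl_cons, faceSum_cons_cons] at hg'
      have hg'' : faceSum (fun m => g (h :: m)) (y :: t) = g (y :: t) - g (h * y :: t) := by
        simp only [MonoidHom.one_apply, Module.End.one_apply, Pi.zero_apply] at hg'
        linear_combination -hg'
      rw [faceSum_cons_cons, e, faceSum_add, ih, faceSum_smul_const,
        cupL_cons (faceSum f), faceSum_head]
      have h1 := cupL_add (fun m => -shift h f m) (fun m => -faceSum (fun m => f (h :: m)) m) g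
        (y :: t)
      have h2 := cupL_map (-LinearMap.id : A →ₗ[k] A) (shift h f) g (y :: t)
      have h3 := cupL_map (-LinearMap.id : A →ₗ[k] A) (faceSum fun m => f (h :: m)) g (y :: t)
      simp only [LinearMap.neg_apply, LinearMap.id_apply] at h2 h3
      simp only [sub_eq_add_neg]
      rw [h1, h2, h3, hg'']
      simp only [cupL_cons, faceSum_nil, shift_nil, shift_cons]
      module

theorem dl_cupL {g : List H → k} (hg : dl (1 : Representation k H k) g = 0)
    (f : List H → A) : dl ρ (cupL f g) = cupL (dl ρ f) g := by
  funext l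
  cases l with
  | nil => simp [cupL_nil]
  | cons h t =>
    rw [dl_cons, faceSum_cupL hg, cupL_cons, cupL_cons]
    have e : (fun m => dl ρ f (h :: m)) = fun m => ρ h (f m) + faceSum f (h :: m) := rfl
    rw [e, cupL_add, cupL_map]
    simp only [faceSum_nil, dl_nil]
    abel

/-- The cup product of a cochain with trivial coefficients with one with coefficients in a
representation. -/
def cupR : (List H → k) → (List H → A) → List H → A
  | a, f, [] => a [] • f []
  | a, f, h :: t => a [] • f (h :: t) + ρ h (cupR (fun m => a (h :: m)) f t)

theorem cupR_nil (a : List H → k) (f : List H → A) : cupR ρ a f [] = a [] • f [] := rfl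

theorem cupR_cons (a : List H → k) (f : List H → A) (h : H) (t : List H) :
    cupR ρ a f (h :: t) = a [] • f (h :: t) + ρ h (cupR ρ (fun m => a (h :: m)) f t) := rfl

theorem cupR_add_left (a a' : List H → k) (f : List H → A) (l : List H) :
    cupR ρ (fun m => a m + a' m) f l = cupR ρ a f l + cupR ρ a' f l := by
  induction l generalizing a a' with
  | nil => simp [cupR_nil, add_smul]
  | cons h t ih => simp only [cupR_cons, ih, add_smul, map_add]; abel

theorem cupR_smul_left (c : k) (a : List H → k) (f : List H → A) (l : List H) :
    cupR ρ (fun m => c * a m) f l = c • cupR ρ a f l := by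
  induction l generalizing a with
  | nil => simp [cupR_nil, mul_smul]
  | cons h t ih => simp [cupR_cons, ih fun m => a (h :: m), mul_smul]

/-- `cupR` as a linear map in the second variable. -/
def cupRight (a : List H → k) : (List H → A) →ₗ[k] (List H → A) where
  toFun f := cupR ρ a f
  map_add' f f' := funext fun l => by
    change _ = cupR ρ a f l + cupR ρ a f' l
    induction l generalizing a with
    | nil => simp [cupR_nil]
    | cons h t ih => simp only [cupR_cons, ih, Pi.add_apply, smul_add, map_add]; abel
  map_smul' c f := funext fun l => by
    change _ = c • cupR ρ a f l
    induction l generalizing a with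
    | nil => exact smul_comm (a []) c (f [])
    | cons h t ih =>
      rw [cupR_cons, cupR_cons, ih, Pi.smul_apply, smul_add, map_smul, smul_comm]

theorem cupRight_apply (a : List H → k) (f : List H → A) : cupRight ρ a f = cupR ρ a f := rfl

theorem cupR_map (q : A →ₗ[k] B) (hq : ∀ h a, q (ρ h a) = σ h (q a)) (a : List H → k)
    (f : List H → A) (l : List H) :
    cupR σ a (fun m => q (f m)) l = q (cupR ρ a f l) := by
  induction l generalizing a with
  | nil => simp [cupR_nil]
  | cons h t ih => simp [cupR_cons, ih fun m => a (h :: m), hq]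

theorem cupR_one_eq_cupL (a f : List H → k) (l : List H) :
    cupR (1 : Representation k H k) a f l = cupL a f l := by
  induction l generalizing a with
  | nil => simp [cupR_nil, cupL_nil, mul_comm]
  | cons h t ih => simp [cupR_cons, cupL_cons, ih, mul_comm]

/-- The tail now carries the twist, so the first face of `f` belongs to `dl ρ f`; it cancels the
last face of `a`, and no cocycle condition is needed. Moving the coboundary past the head costs one
sign per letter; this is expressed by the length because `a` need not be homogeneous. -/
theorem faceSum_cupR (a : List H → k) (f : List H → A) (l : List H) :
    faceSum (cupR ρ a f) l = cupR ρ (faceSum a) f l +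
      cupR ρ (fun m => (-1) ^ m.length * a m) (dl ρ f) l := by
  induction l generalizing a with
  | nil => simp [cupR_nil]
  | cons h t ih =>
    cases t with
    | nil => simp [cupR_nil, cupR_cons, dl_cons]
    | cons y t =>
      have e : (fun m => cupR ρ a f (h :: m)) =
        fun m => a [] • f (h :: m) + ρ h (cupR ρ (fun m => a (h :: m)) f m) := rfl
      have e' : (fun m => faceSum a (h :: m)) = fun m =>
          (-1) * shift h a m + (-1) * faceSum (fun m => a (h :: m)) m := by
        rw [faceSum_head]
        funext m
        ring
      have e'' : (fun m => (-1) ^ (h :: m).length * a (h :: m)) = fun m =>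
          (-1) * ((-1) ^ m.length * a (h :: m)) := by
        funext m
        simp [pow_succ]
      rw [faceSum_cons_cons, e, faceSum_add, faceSum_smul, faceSum_map,
        ih, cupR_cons ρ (faceSum a), e', cupR_add_left, cupR_smul_left, cupR_smul_left,
        cupR_cons ρ (fun m => (-1) ^ m.length * a m), e'', cupR_smul_left,
        dl_cons, faceSum_cons_cons]
      simp only [cupR_cons, faceSum_nil, shift_nil, shift_cons, map_add, map_smul, map_mul, Module.End.mul_apply, List.length_nil,
        pow_zero, one_mul]
      module

/-- The first face of the product is exactly the face of `a` missing from `faceSum a`; together they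
form `da ∪ f = 0`. -/
theorem dl_cupR {a : List H → k} (ha : dl (1 : Representation k H k) a = 0)
    (f : List H → A) : dl ρ (cupR ρ a f) =
      cupR ρ (fun m => (-1) ^ m.length * a m) (dl ρ f) := by
  funext l
  cases l with
  | nil => simp [cupR_nil]
  | cons h t =>
    rw [dl_cons, faceSum_cupR]
    have : ρ h (cupR ρ a f t) + cupR ρ (faceSum a) f (h :: t) = 0 := by
      have e : (fun m => faceSum a (h :: m)) = fun m => (-1) * a m := by
        funext m
        have := congrFun ha (h :: m)
        rw [dl_cons] at this
        simp only [MonoidHom.one_apply, Module.End.one_apply, Pi.zero_apply] at this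
        linear_combination this
      rw [cupR_cons, e, cupR_smul_left]
      simp
    rw [← add_assoc, this, zero_add]

/-- `Y` is supported on the lists of length `n`. -/
def Deg (n : ℤ) (Y : List H → A) : Prop := ∀ l : List H, (l.length : ℤ) ≠ n → Y l = 0

variable {ρ}

theorem Deg.add {n : ℤ} {Y Z : List H → A} (hY : Deg n Y) (hZ : Deg n Z) : Deg n (Y + Z) :=
  fun l hl => by simp [hY l hl, hZ l hl]

theorem Deg.sub {n : ℤ} {Y Z : List H → A} (hY : Deg n Y) (hZ : Deg n Z) : Deg n (Y - Z) :=
  fun l hl => by simp [hY l hl, hZ l hl]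

theorem Deg.neg {n : ℤ} {Y : List H → A} (hY : Deg n Y) : Deg n (-Y) :=
  fun l hl => by simp [hY l hl]

theorem Deg.smul {n : ℤ} {Y : List H → A} (c : k) (hY : Deg n Y) : Deg n (c • Y) :=
  fun l hl => by simp [hY l hl]

theorem Deg.zero {n : ℤ} : Deg n (0 : List H → A) := fun _ _ => rfl

theorem Deg.sum {n : ℤ} {ι : Type*} (s : Finset ι) {Y : ι → List H → A}
    (hY : ∀ i ∈ s, Deg n (Y i)) : Deg n (∑ i ∈ s, Y i) := fun l hl => by
  rw [Finset.sum_apply]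
  exact Finset.sum_eq_zero fun i hi => hY i hi l hl

theorem Deg.map {n : ℤ} {Y : List H → A} (hY : Deg n Y) (q : A →ₗ[k] B) :
    Deg n fun l => q (Y l) := fun l hl => by simp [hY l hl]

theorem Deg.comp {n : ℤ} {Y : List H → A} (hY : Deg n Y) (φ : L →* H) :
    Deg n fun l : List L => Y (l.map φ) := fun l hl => hY _ (by simpa using hl)

/-- Degrees are integers so that a primitive of a `0`-cochain has degree `-1` and is forced to
vanish. Degree zero then needs no separate definition of coboundaries, and inductions can start in
degree `-1`. -/
theorem Deg.of_neg {n : ℤ} (hn : n < 0) {Y : List H → A} (hY : Deg n Y) : Y = 0 :=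
  funext fun l => hY l (by omega)

theorem Deg.faceSum {n : ℤ} {Y : List H → A} (hY : Deg n Y) : Deg (n + 1) (faceSum Y) := by
  intro l
  induction l generalizing n Y with
  | nil => simp
  | cons x l ih =>
    intro hl
    cases l with
    | nil => simpa using hY _ (by simp at hl ⊢; omega)
    | cons y l =>
      rw [faceSum_cons_cons, hY _ (by simp at hl ⊢; omega),
        ih (n := n - 1) (Y := fun m => Y (x :: m)) (fun m hm => hY _ (by simp; omega))
          (by simp at hl ⊢; omega)]
      simp

theorem Deg.dl {n : ℤ} {Y : List H → A} (hY : Deg n Y) : Deg (n + 1) (dl ρ Y) := by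
  intro l hl
  cases l with
  | nil => simp
  | cons x l => rw [dl_cons, hY l (by simp at hl; omega), hY.faceSum _ hl]; simp

theorem Deg.cupL {m n : ℤ} {f : List H → A} {g : List H → k} (hf : Deg m f) (hg : Deg n g) :
    Deg (m + n) (cupL f g) := by
  intro l
  induction l generalizing m f with
  | nil =>
    intro hl
    rw [cupL_nil]
    by_cases h : m = 0
    · rw [hg _ (by simp at hl ⊢; omega), zero_smul]
    · rw [hf _ (by simp; omega), smul_zero]
  | cons x l ih =>
    intro hl
    rw [cupL_cons, ih (m := m - 1) (f := fun m => f (x :: m))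
      (fun m hm => hf _ (by simp; omega)) (by simp at hl ⊢; omega)]
    by_cases h : m = 0
    · rw [hg _ (by simp at hl ⊢; omega), zero_smul, zero_add]
    · rw [hf _ (by simp; omega), smul_zero, zero_add]

theorem Deg.cupR {m n : ℤ} {a : List H → k} {f : List H → A} (ha : Deg m a) (hf : Deg n f) :
    Deg (m + n) (cupR ρ a f) := by
  intro l
  induction l generalizing m a with
  | nil =>
    intro hl
    rw [cupR_nil]
    by_cases h : m = 0
    · rw [hf _ (by simp at hl ⊢; omega), smul_zero]
    · rw [ha _ (by simp; omega), zero_smul]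
  | cons x l ih =>
    intro hl
    rw [cupR_cons, ih (m := m - 1) (a := fun m => a (x :: m))
      (fun m hm => ha _ (by simp; omega)) (by simp at hl ⊢; omega)]
    by_cases h : m = 0
    · rw [hf _ (by simp at hl ⊢; omega), smul_zero, map_zero, zero_add]
    · rw [ha _ (by simp; omega), zero_smul, map_zero, zero_add]

theorem Deg.sign_mul {n : ℕ} {a : List H → k} (ha : Deg n a) :
    (fun m => (-1) ^ m.length * a m) = fun m => (-1) ^ n * a m := by
  funext m
  by_cases h : m.length = n
  · rw [h]
  · rw [ha m (by exact_mod_cast h), mul_zero, mul_zero]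

/-- For homogeneous `f` a single splitting survives, so `cupL` is the usual cup product of cochains.
-/
theorem cupL_append {m : ℕ} {f : List H → A} {g : List H → k} (hf : Deg m f)
    (l₁ l₂ : List H) (h₁ : l₁.length = m) :
    cupL f g (l₁ ++ l₂) = g l₂ • f l₁ := by
  induction l₁ generalizing m f with
  | nil =>
    obtain rfl : m = 0 := by simpa using h₁.symm
    cases l₂ with
    | nil => rfl
    | cons x l =>
      have : (fun m => f (x :: m)) = 0 := funext fun m => hf _ (by simp; omega)
      rw [List.nil_append, cupL_cons, this, ← cupLeft_apply, map_zero, Pi.zero_apply, add_zero]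
  | cons x l ih =>
    obtain ⟨m, rfl⟩ : ∃ m', m = m' + 1 := ⟨l.length, by simpa using h₁.symm⟩
    rw [List.cons_append, cupL_cons, hf [] (by simp; omega), smul_zero, zero_add]
    exact ih (fun m hm => hf _ (by simpa using hm)) (by simpa using h₁)

end ListCochains

/-! ### Coinduced representations: acyclicity and the Shapiro argument. -/

section DimensionShifting

set_option linter.unusedSectionVars false

variable {k : Type} [Field k] {G K A B C : Type} [Group G] [Group K]
  [AddCommGroup A] [Module k A] [AddCommGroup B] [Module k B] [AddCommGroup C] [Module k C]

/-- The representation of `G` on the functions `G → A` by right translation. -/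
def coindRep (k G A : Type) [Field k] [Group G] [AddCommGroup A] [Module k A] :
    Representation k G (G → A) where
  toFun g :=
    { toFun := fun F x => F (x * g)
      map_add' := fun _ _ => rfl
      map_smul' := fun _ _ => rfl }
  map_one' := by ext; simp
  map_mul' g h := by ext; simp [mul_assoc]

@[simp] theorem coindRep_apply (g x : G) (F : G → A) : coindRep k G A g F x = F (x * g) := rfl

theorem faceSum_apply {H : Type} [Group H] (Y : List H → G → A) (l : List H) (x : G) :
    faceSum Y l x = faceSum (fun m => Y m x) l :=
  (faceSum_addHom (Pi.evalAddMonoidHom (fun _ : G => A) x) Y l).symm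

/-- The contracting homotopy turns the argument `x ∈ G` into a new first letter and evaluates at
`1`; the identity is the cocycle condition on `x :: l` at `1`. It cannot reach the value at the
empty list, whence `n ≠ 0`. -/
theorem coindRep_acyclic {n : ℤ} (hn : n ≠ 0) {f : List G → G → A} (hf : Deg n f)
    (hd : dl (coindRep k G A) f = 0) : ∃ u, Deg (n - 1) u ∧ f = dl (coindRep k G A) u := by
  refine ⟨fun l x => f (x :: l) 1, fun l hl => ?_, ?_⟩
  · funext x
    exact congrFun (hf (x :: l) (by simp; omega)) 1
  · funext l x
    cases l with
    | nil => rw [hf _ (by simp; omega), dl_nil]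
    | cons h t =>
      have := congrFun (congrFun hd (x :: h :: t)) 1
      simp only [dl_cons, Pi.add_apply, coindRep_apply, faceSum_cons_cons, Pi.sub_apply,
        Pi.neg_apply, faceSum_apply, Pi.zero_apply, one_mul] at this ⊢
      rw [← sub_eq_zero, ← this]
      abel

/-- The prism operator between the identity of `G × K` acting on `G` and the retraction
onto `K`. -/
def prism : (List (G × K) → A) → G → List (G × K) → A
  | Y, x, [] => Y [(x, 1)]
  | Y, x, h :: t => Y ((x, 1) :: h :: t) - prism (fun m => Y ((1, h.2) :: m)) (x * h.1) t

theorem prism_nil (Y : List (G × K) → A) (x : G) : prism Y x [] = Y [(x, 1)] := rfl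

theorem prism_cons (Y : List (G × K) → A) (x : G) (h : G × K) (t : List (G × K)) :
    prism Y x (h :: t) =
      Y ((x, 1) :: h :: t) - prism (fun m => Y ((1, h.2) :: m)) (x * h.1) t := rfl

theorem prism_add (Y Z : List (G × K) → A) (x : G) (l : List (G × K)) :
    prism (fun m => Y m + Z m) x l = prism Y x l + prism Z x l := by
  induction l generalizing Y Z x with
  | nil => rfl
  | cons h t ih => simp only [prism_cons, ih]; abel

theorem prism_neg (Y : List (G × K) → A) (x : G) (l : List (G × K)) :
    prism (fun m => -Y m) x l = -prism Y x l := by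
  induction l generalizing Y x with
  | nil => rfl
  | cons h t ih => simp only [prism_cons, ih]; abel

theorem prism_zero (x : G) (l : List (G × K)) : prism (fun _ => (0 : A)) x l = 0 := by
  induction l generalizing x with
  | nil => rfl
  | cons h t ih => simp only [prism_cons, ih, sub_zero]

/-- On a list of pairs `hᵢ = (gᵢ, kᵢ)`, `prism` is the alternating sum of `Y` over the lists that
follow `(1, k₁), …, (1, kᵢ)`, jump by `(x g₁⋯gᵢ, 1)`, and continue with `hᵢ₊₁, …`. The faces cancel
in pairs except the one that deletes the jump at the very end. -/
theorem faceSum_prism (Y : List (G × K) → A) (x : G) (l : List (G × K)) :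
    faceSum (prism Y x) l + prism (faceSum Y) x l =
      -Y (l.map ((MonoidHom.inr G K).comp (MonoidHom.snd G K))) := by
  induction l generalizing Y x with
  | nil => simp [prism_nil]
  | cons h t ih =>
    have ih' := ih (fun m => Y ((1, h.2) :: m)) (x * h.1)
    have e : prism (fun m => faceSum Y ((1, h.2) :: m)) (x * h.1) t =
        -prism (shift (1, h.2) Y) (x * h.1) t -
          prism (faceSum fun m => Y ((1, h.2) :: m)) (x * h.1) t := by
      rw [faceSum_head]
      simp only [sub_eq_add_neg, prism_add, prism_neg]
    have hx : (x, 1) * h = (x * h.1, h.2) := by ext <;> simp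
    rw [prism_cons, e]
    cases t with
    | nil =>
      simp [prism_nil, faceSum_cons_cons, hx]
      abel
    | cons y t =>
      have e2 : (fun m => prism Y x (h :: m)) = fun m => Y ((x, 1) :: h :: m) -
        prism (fun m => Y ((1, h.2) :: m)) (x * h.1) m := rfl
      rw [faceSum_cons_cons, e2, faceSum_sub, faceSum_cons_cons Y, faceSum_cons_cons]
      rw [eq_sub_of_add_eq' ih']
      simp [prism_cons, mul_assoc, hx]
      abel

/-- The cocycle condition evaluated at `1` is fed into the prism. Its front-face terms give `Z`
itself minus the front face of the prism, its other terms are governed by `faceSum_prism`, and the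
surviving term there vanishes by `h1`. -/
theorem prism_homotopy {Z : List (G × K) → G → A}
    (hZ : dl ((coindRep k G A).comp (MonoidHom.fst G K)) Z = 0)
    (h1 : ∀ l : List K, Z (l.map (MonoidHom.inr G K)) 1 = 0) :
    Z = dl ((coindRep k G A).comp (MonoidHom.fst G K)) fun l x => prism (fun m => Z m 1) x l := by
  have e : (fun l => dl ((coindRep k G A).comp (MonoidHom.fst G K)) Z l 1) = fun l =>
      (l.casesOn 0 fun h m => Z m h.1 : A) + faceSum (fun m => Z m 1) l := by
    funext l
    cases l <;> simp [dl_cons, faceSum_apply]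
  funext l x
  cases l with
  | nil =>
    have e1 := congrFun e [(x, 1)]
    have e2 : Z [] 1 = 0 := h1 []
    simpa [hZ, e2] using e1.symm
  | cons h t =>
    have e1 := congr(prism $e x (h :: t))
    rw [prism_add] at e1
    simp only [hZ, Pi.zero_apply, prism_zero] at e1
    rw [prism_cons] at e1
    have e2 := faceSum_prism (fun m => Z m 1) x (h :: t)
    have e3 := h1 ((h :: t).map Prod.snd)
    rw [List.map_map] at e3
    have e4 : Z (List.map ((MonoidHom.inr G K).comp (MonoidHom.snd G K)) (h :: t)) 1 = 0 :=
      e3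
    rw [e4] at e2
    rw [dl_cons, Pi.add_apply, faceSum_apply]
    simp only [MonoidHom.comp_apply, MonoidHom.coe_fst, coindRep_apply] at e1 ⊢
    rw [eq_sub_of_add_eq e2]
    rw [← sub_eq_zero]
    refine Eq.trans ?_ e1.symm
    abel

theorem Deg.prism {n : ℤ} {Y : List (G × K) → A} (hY : Deg n Y) (x : G) :
    Deg (n - 1) (prism Y x) := by
  intro l
  induction l generalizing n Y x with
  | nil => exact fun hl => hY _ (by simp at hl ⊢; omega)
  | cons h t ih =>
    intro hl
    rw [prism_cons, hY _ (by simp at hl ⊢; omega), ih (n := n - 1)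
      (Y := fun m => Y ((1, h.2) :: m)) (fun m hm => hY _ (by simp; omega)) _
      (by simp at hl ⊢; omega), sub_zero]

/-- Restriction to `K` and evaluation at `1` is injective on cohomology with coefficients in a
coinduced representation. -/
theorem shapiro_injective {n : ℤ} {Z : List (G × K) → G → A} (hn : Deg n Z)
    (hZ : dl ((coindRep k G A).comp (MonoidHom.fst G K)) Z = 0) {w : List K → A}
    (hw : Deg (n - 1) w)
    (h : ∀ l, Z (l.map (MonoidHom.inr G K)) 1 = dl (1 : Representation k K A) w l) :
    ∃ v, Deg (n - 1) v ∧ Z = dl ((coindRep k G A).comp (MonoidHom.fst G K)) v := by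
  -- `W` is `w` transported along the projection to `K`, constant in `G`. Subtracting its coboundary
  -- makes the restriction of `Z` to `K` at `1` vanish as a cochain, as the prism requires.
  let W : List (G × K) → G → A := fun l _ => w (l.map (MonoidHom.snd G K))
  have hW : Deg (n - 1) W := fun l hl => funext fun _ => hw _ (by simpa using hl)
  have hdW : dl ((coindRep k G A).comp (MonoidHom.fst G K)) W =
      fun l _ => dl (1 : Representation k K A) w (l.map (MonoidHom.snd G K)) := by
    funext l x
    cases l with
    | nil => simp
    | cons h t =>
      rw [dl_cons, Pi.add_apply, faceSum_apply]
      have := faceSum_comp (MonoidHom.snd G K) w (h :: t)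
      simp only [List.map_cons, dl_cons] at this ⊢
      rw [← this]
      rfl
  have h0 := prism_homotopy (Z := Z - dl ((coindRep k G A).comp (MonoidHom.fst G K)) W)
    (by rw [map_sub, hZ, dl_dl, sub_zero]) fun l => by
      simp only [Pi.sub_apply, hdW, h, List.map_map]
      have : (MonoidHom.snd G K : G × K → K) ∘ (MonoidHom.inr G K : K → G × K) = id := rfl
      rw [this, List.map_id, sub_self]
  have hdeg : Deg n (Z - dl ((coindRep k G A).comp (MonoidHom.fst G K)) W) :=
    hn.sub (by simpa using hW.dl)
  refine ⟨_, hW.add (Z := fun l x => prism (fun m => (Z - dl ((coindRep k G A).comp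
    (MonoidHom.fst G K)) W) m 1) x l) fun l hl => funext fun x => ?_, ?_⟩
  · exact Deg.prism (n := n) (fun m hm => congrFun (hdeg m hm) 1) x l hl
  · rw [map_add, ← h0]
    abel

end DimensionShifting

/-! ### The Künneth theorem for `G × K` with coefficients in a representation of `G`. -/

section Kunneth

set_option linter.unusedSectionVars false

variable {k : Type} [Field k] {G K A B C : Type} [Group G] [Group K]
  [AddCommGroup A] [Module k A] [AddCommGroup B] [Module k B] [AddCommGroup C] [Module k C]

/-- A finite family of cocycles representing bases of `Hⁿ(K; k)` for `n ≤ N`. -/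
structure CocycleBasis (k K : Type) [Field k] [Group K] (N : ℤ) where
  T : Type
  [fin : Fintype T]
  deg : T → ℕ
  g : T → List K → k
  deg_g : ∀ t, Deg (deg t) (g t)
  dl_g : ∀ t, dl (1 : Representation k K k) (g t) = 0
  span : ∀ n ≤ N, ∀ z : List K → k, Deg n z → dl (1 : Representation k K k) z = 0 →
    ∃ c : T → k, (∀ t, (deg t : ℤ) ≠ n → c t = 0) ∧
      ∃ w, Deg (n - 1) w ∧ z = ∑ t, c t • g t + dl (1 : Representation k K k) w
  indep : ∀ n : ℤ, ∀ c : T → k, (∀ t, (deg t : ℤ) ≠ n → c t = 0) → ∀ w : List K → k,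
    Deg (n - 1) w → ∑ t, c t • g t = dl (1 : Representation k K k) w → c = 0

attribute [instance] CocycleBasis.fin

/-- The cross product of cochains. -/
def cross (g : List K → k) : (List G → A) →ₗ[k] (List (G × K) → A) :=
  cupLeft A (fun m => g (m.map (MonoidHom.snd G K))) ∘ₗ
    LinearMap.funLeft k A (List.map (MonoidHom.fst G K))

theorem cross_apply (g : List K → k) (f : List G → A) (l : List (G × K)) : cross g f l =
    cupL (fun m => f (m.map (MonoidHom.fst G K))) (fun m => g (m.map (MonoidHom.snd G K))) l :=
  rfl

theorem dl_one_comp_snd {g : List K → k} (hg : dl (1 : Representation k K k) g = 0) :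
    dl (1 : Representation k (G × K) k) (fun m => g (m.map (MonoidHom.snd G K))) = 0 := by
  have := dl_comp (1 : Representation k K k) (MonoidHom.snd G K) g
  rw [hg] at this
  exact this

theorem dl_cross (ρ : Representation k G A) {g : List K → k}
    (hg : dl (1 : Representation k K k) g = 0) (f : List G → A) :
    dl (ρ.comp (MonoidHom.fst G K)) (cross g f) = cross g (dl ρ f) := by
  have h1 := dl_cupL (ρ.comp (MonoidHom.fst G K)) (dl_one_comp_snd (G := G) hg)
    (fun m => f (m.map (MonoidHom.fst G K)))
  rw [dl_comp] at h1
  exact h1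

theorem Deg.cross {m n : ℤ} {f : List G → A} {g : List K → k} (hf : Deg m f) (hg : Deg n g) :
    Deg (m + n) (cross g f) :=
  (hf.comp (MonoidHom.fst G K)).cupL (hg.comp (MonoidHom.snd G K))

theorem cross_map (q : A →ₗ[k] B) (g : List K → k) (f : List G → A) :
    cross g (fun m => q (f m)) = fun l => q (cross g f l) :=
  funext fun _ => cupL_map q _ _ _

/-- The cochain of degree `0` with value `a`. -/
def constCochain (a : A) : List G → A
  | [] => a
  | _ :: _ => 0

theorem dl_constCochain {a : G → A} (ha : ∀ x y, a (x * y) = a x) :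
    dl (coindRep k G A) (constCochain a) = 0 := by
  funext l x
  cases l with
  | nil => simp
  | cons h l =>
    cases l with
    | nil => simp [dl_cons, ha, constCochain]
    | cons y l =>
      rw [dl_cons, faceSum_cons_cons]
      have := faceSum_addHom (0 : (G → A) →+ (G → A)) (fun m : List G => 0) (y :: l)
      simp at this
      simp [this, constCochain]

variable {N : ℤ} (b : CocycleBasis k K N)

namespace CocycleBasis

/-- For trivial coefficients of finite dimension, `Hⁿ(K; A) = Hⁿ(K; k) ⊗ A`: the scalar case is
applied to each coordinate with respect to a basis of `A`. -/
theorem span_module [Module.Finite k A] {n : ℤ} (hn : n ≤ N) {z : List K → A} (hz : Deg n z)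
    (hd : dl (1 : Representation k K A) z = 0) :
    ∃ a : b.T → A, (∀ t, (b.deg t : ℤ) ≠ n → a t = 0) ∧
      ∃ w, Deg (n - 1) w ∧ z = ∑ t, (fun l => b.g t l • a t) + dl (1 : Representation k K A) w := by
  let β := Module.finBasis k A
  have key := fun i => b.span n hn (fun l => β.coord i (z l)) (hz.map (β.coord i)) (by
    rw [dl_map (1 : Representation k K A) 1 (β.coord i) fun _ _ => rfl, hd]
    simp only [Pi.zero_apply, map_zero]
    rfl)
  choose c hc w hw h using key
  refine ⟨fun t => ∑ i, c i t • β i, fun t ht => ?_, ∑ i, fun l => w i l • β i, ?_, ?_⟩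
  · exact Finset.sum_eq_zero fun i _ => by rw [hc i t ht, zero_smul]
  · exact Deg.sum _ fun i _ => (hw i).map (LinearMap.toSpanSingleton k A (β i))
  · funext l
    have h2 : ∀ i, dl (1 : Representation k K A) (fun l => w i l • β i) = fun l =>
        dl (1 : Representation k K k) (w i) l • β i := fun i =>
      dl_map (1 : Representation k K k) 1 (LinearMap.toSpanSingleton k A (β i))
        (fun _ _ => rfl) (w i)
    have h3 := fun i => congrFun (h i) l
    simp only [Pi.add_apply, Finset.sum_apply, Pi.smul_apply, smul_eq_mul] at h3
    rw [map_sum]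
    simp only [h2, Pi.add_apply, Finset.sum_apply]
    conv_lhs => rw [← β.sum_repr (z l)]
    simp only [Module.Basis.coord_apply] at h3
    simp only [h3, add_smul, Finset.sum_add_distrib, Finset.smul_sum, Finset.sum_smul, smul_smul]
    rw [Finset.sum_comm]
    simp only [mul_comm]

/-- Linear functionals separate the points of `A` and carry the relation to one with scalar
coefficients. -/
theorem indep_module {n : ℤ} {a : b.T → A} (ha : ∀ t, (b.deg t : ℤ) ≠ n → a t = 0)
    {w : List K → A} (hw : Deg (n - 1) w)
    (h : ∑ t, (fun l => b.g t l • a t) = dl (1 : Representation k K A) w) : a = 0 := by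
  funext t
  refine (Module.forall_dual_apply_eq_zero_iff k (a t)).1 fun φ => ?_
  refine congrFun (b.indep n (fun t => φ (a t)) (fun t ht => by rw [ha t ht, map_zero])
    (fun l => φ (w l)) (hw.map φ) ?_) t
  rw [dl_map (1 : Representation k K A) 1 φ fun _ _ => rfl, ← h]
  funext l
  simp [Finset.sum_apply, mul_comm]

/-- The sum of the cross products of the members of a family with those of a cocycle basis. -/
def crossSum : (b.T → List G → A) →ₗ[k] (List (G × K) → A) :=
  ∑ t, cross (b.g t) ∘ₗ LinearMap.proj t

theorem crossSum_apply (f : b.T → List G → A) : b.crossSum f = ∑ t, cross (b.g t) (f t) := by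
  simp [crossSum]

theorem dl_crossSum (ρ : Representation k G A) (f : b.T → List G → A) :
    dl (ρ.comp (MonoidHom.fst G K)) (b.crossSum f) = b.crossSum fun t => dl ρ (f t) := by
  simp only [crossSum_apply, map_sum, dl_cross ρ (b.dl_g _)]

theorem deg_crossSum {n : ℤ} {f : b.T → List G → A} (hf : ∀ t, Deg (n - b.deg t) (f t)) :
    Deg n (b.crossSum f) := by
  rw [crossSum_apply]
  exact Deg.sum _ fun t _ => by simpa using (hf t).cross (b.deg_g t)

theorem crossSum_map (q : A →ₗ[k] B) (f : b.T → List G → A) :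
    b.crossSum (fun t l => q (f t l)) = fun l => q (b.crossSum f l) := by
  funext l
  simp only [crossSum_apply, cross_map, Finset.sum_apply, map_sum]

/-- Every degree `n` cocycle of `G × K` with coefficients in `A` is cohomologous to a sum of cross
products. -/
def Spans (n : ℤ) (ρ : Representation k G A) : Prop :=
  ∀ z : List (G × K) → A, Deg n z → dl (ρ.comp (MonoidHom.fst G K)) z = 0 →
    ∃ f : b.T → List G → A, (∀ t, Deg (n - b.deg t) (f t)) ∧ (∀ t, dl ρ (f t) = 0) ∧
      ∃ w, Deg (n - 1) w ∧ z = b.crossSum f + dl (ρ.comp (MonoidHom.fst G K)) w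

/-- The representation of degree `n` classes as sums of cross products is unique. -/
def Indep (n : ℤ) (ρ : Representation k G A) : Prop :=
  ∀ f : b.T → List G → A, (∀ t, Deg (n - b.deg t) (f t)) → (∀ t, dl ρ (f t) = 0) →
    ∀ w : List (G × K) → A, Deg (n - 1) w →
      b.crossSum f = dl (ρ.comp (MonoidHom.fst G K)) w →
      ∃ u : b.T → List G → A, (∀ t, Deg (n - b.deg t - 1) (u t)) ∧ ∀ t, f t = dl ρ (u t)

theorem crossSum_constCochain (a : b.T → G → A) (l : List K) :
    b.crossSum (fun t => constCochain (a t)) (l.map (MonoidHom.inr G K)) 1 =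
      ∑ t, b.g t l • a t 1 := by
  rw [crossSum_apply, Finset.sum_apply, Finset.sum_apply]
  refine Finset.sum_congr rfl fun t _ => ?_
  cases l with
  | nil => rfl
  | cons h l =>
    rw [cross_apply, List.map_cons, cupL_cons]
    have : (fun m : List (G × K) => constCochain (a t)
        (List.map (MonoidHom.fst G K) (MonoidHom.inr G K h :: m))) = 0 := rfl
    rw [this, ← cupLeft_apply, map_zero, Pi.zero_apply, add_zero, ← List.map_cons, List.map_map]
    have : (MonoidHom.snd G K : G × K → K) ∘ (MonoidHom.inr G K : K → G × K) = id := rfl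
    rw [this, List.map_id]
    rfl

/-- Restricted to `K` and evaluated at `1`, the cocycle becomes a combination of the basis with
coefficients in `A`. These coefficients, as constant functions on `G`, are invariant degree `0`
cocycles whose cross products have the same restriction; `shapiro_injective` finishes. -/
theorem spans_coindRep [Module.Finite k A] {n : ℤ} (hn : n ≤ N) : b.Spans n (coindRep k G A) := by
  intro z hz hd
  obtain ⟨a, ha, w, hw, h⟩ := b.span_module hn
    (z := fun l => z (l.map (MonoidHom.inr G K)) 1)
    (fun l hl => congrFun (hz _ (by simpa using hl)) 1) (by
      have := dl_comp ((coindRep k G A).comp (MonoidHom.fst G K)) (MonoidHom.inr G K) z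
      rw [hd] at this
      have h1 := dl_map (((coindRep k G A).comp (MonoidHom.fst G K)).comp (MonoidHom.inr G K))
        (1 : Representation k K A) (LinearMap.proj 1) (fun h F => by simp)
        (fun l => z (l.map (MonoidHom.inr G K)))
      rw [this] at h1
      exact h1)
  have hinv : ∀ t, dl (coindRep k G A) (constCochain fun _ => a t) = 0 :=
    fun t => dl_constCochain fun _ _ => rfl
  have hf : ∀ t, Deg (n - b.deg t)
      (constCochain fun _ => a t : List G → G → A) := by
    intro t l hl
    cases l with
    | nil => exact funext fun _ => ha t (by simp at hl; omega)
    | cons => rfl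
  refine ⟨fun t => constCochain fun _ => a t, hf,
    hinv, ?_⟩
  obtain ⟨v, hv, h'⟩ := shapiro_injective (n := n) (hz.sub (b.deg_crossSum hf)) (by
    rw [map_sub, hd, dl_crossSum]
    simp only [hinv]
    rw [zero_sub, neg_eq_zero]
    exact map_zero b.crossSum) hw fun l => by
      rw [Pi.sub_apply, Pi.sub_apply, crossSum_constCochain]
      have := congrFun h l
      simp only [Pi.add_apply, Finset.sum_apply] at this
      rw [this]
      abel
  exact ⟨v, hv, by rw [← h']; abel⟩

/-- The `f t` with `deg t ≠ n` have non-zero degree and are coboundaries by `coindRep_acyclic`. The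
others are `0`-cocycles, that is, constant functions on `G`, and they vanish by independence after
restriction to `K` at `1`. -/
theorem indep_coindRep {n : ℤ} : b.Indep n (coindRep k G A) := by
  intro f hf hd w hw h
  have key : ∀ t, ∃ u, Deg (n - b.deg t - 1) u ∧
      ((b.deg t : ℤ) ≠ n → f t = dl (coindRep k G A) u) ∧ ((b.deg t : ℤ) = n → u = 0) := by
    intro t
    by_cases ht : (b.deg t : ℤ) = n
    · exact ⟨0, Deg.zero, fun h => absurd ht h, fun _ => rfl⟩
    · obtain ⟨u, hu, h⟩ := coindRep_acyclic (n := n - b.deg t) (by omega) (hf t) (hd t)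
      exact ⟨u, hu, fun _ => h, fun h => absurd h ht⟩
  choose u hu hfu hu0 using key
  have hinv : ∀ t, ∀ x y : G, (f t - dl (coindRep k G A) (u t)) [] (x * y) =
      (f t - dl (coindRep k G A) (u t)) [] x := by
    intro t x y
    have := congrFun (congrFun (hd t) [y]) x
    simp only [dl_cons, Pi.add_apply, coindRep_apply, faceSum_single, Pi.neg_apply,
      Pi.zero_apply] at this
    simpa using add_neg_eq_zero.1 this
  have hcase : ∀ t, f t - dl (coindRep k G A) (u t) =
      constCochain ((f t - dl (coindRep k G A) (u t)) []) := by
    intro t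
    by_cases ht : (b.deg t : ℤ) = n
    · funext m
      cases m with
      | nil => rfl
      | cons x m =>
        rw [hu0 t ht, map_zero, sub_zero]
        exact hf t _ (by simp; omega)
    · rw [← hfu t ht, sub_self]
      funext m
      cases m <;> rfl
  have h1 : b.crossSum (fun t => f t - dl (coindRep k G A) (u t)) =
      dl ((coindRep k G A).comp (MonoidHom.fst G K)) (w - b.crossSum u) := by
    rw [map_sub, dl_crossSum, ← h]
    exact map_sub _ _ _
  rw [funext hcase] at h1
  have h2 : ∀ t, (f t - dl (coindRep k G A) (u t)) [] 1 = 0 := by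
    refine congrFun (b.indep_module (n := n) (fun t ht => ?_)
      (w := fun l => (w - b.crossSum u) (l.map (MonoidHom.inr G K)) 1) (fun l hl => ?_) ?_)
    · rw [← hfu t ht, sub_self]; rfl
    · exact congrFun ((hw.sub (b.deg_crossSum (n := n - 1) fun t => by
        convert hu t using 1; ring)) _ (by simpa using hl)) 1
    · have h3 := dl_map (((coindRep k G A).comp (MonoidHom.fst G K)).comp (MonoidHom.inr G K))
        (1 : Representation k K A) (LinearMap.proj 1) (fun h F => by simp)
        (fun l => (w - b.crossSum u) (l.map (MonoidHom.inr G K)))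
      rw [dl_comp, ← h1] at h3
      refine Eq.trans ?_ h3.symm
      funext l
      exact (Finset.sum_apply _ _ _).trans (b.crossSum_constCochain _ l).symm
  refine ⟨u, hu, fun t => sub_eq_zero.1 ?_⟩
  rw [hcase t]
  have : (f t - dl (coindRep k G A) (u t)) [] = 0 := by
    funext x
    have := hinv t 1 x
    rw [one_mul, h2] at this
    exact this
  rw [this]
  funext m
  cases m <;> rfl

end CocycleBasis

/-- A short exact sequence of representations, with linear sections. -/
structure RepSES (ρ : Representation k G A) (γ : Representation k G C)
    (β : Representation k G B) where
  ι : A →ₗ[k] C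
  q : C →ₗ[k] B
  sec : B →ₗ[k] C
  ret : C →ₗ[k] A
  ι_ρ : ∀ g a, ι (ρ g a) = γ g (ι a)
  q_γ : ∀ g c, q (γ g c) = β g (q c)
  ret_ι : ∀ a, ret (ι a) = a
  q_sec : ∀ x, q (sec x) = x
  q_ι : ∀ a, q (ι a) = 0
  ι_ret : ∀ c, q c = 0 → ι (ret c) = c

namespace RepSES

variable {ρ : Representation k G A} {γ : Representation k G C} {β : Representation k G B}
  (S : RepSES ρ γ β)

theorem dl_sec {L : Type} [Group L] (φ : L →* G) (y : List L → B) :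
    (fun l => S.q (dl (γ.comp φ) (fun l => S.sec (y l)) l)) = dl (β.comp φ) y := by
  rw [← dl_map (γ.comp φ) (β.comp φ) S.q fun _ _ => S.q_γ _ _]
  simp only [S.q_sec]

theorem dl_q {L : Type} [Group L] (φ : L →* G) (y : List L → C) :
    dl (β.comp φ) (fun l => S.q (y l)) = fun l => S.q (dl (γ.comp φ) y l) :=
  dl_map (γ.comp φ) (β.comp φ) S.q (fun _ _ => S.q_γ _ _) y

theorem dl_ι {L : Type} [Group L] (φ : L →* G) (y : List L → A) :
    dl (γ.comp φ) (fun l => S.ι (y l)) = fun l => S.ι (dl (ρ.comp φ) y l) :=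
  dl_map (ρ.comp φ) (γ.comp φ) S.ι (fun _ _ => S.ι_ρ _ _) y

theorem ι_injective {X : Type*} {y y' : X → A} (h : (fun l => S.ι (y l)) = fun l => S.ι (y' l)) :
    y = y' := by
  funext l
  have := congr(S.ret ($h l))
  simpa [S.ret_ι] using this

theorem exists_lift {X : Type*} {y : X → C} (h : ∀ l, S.q (y l) = 0) :
    ∃ y' : X → A, (y' = fun l => S.ret (y l)) ∧ y = fun l => S.ι (y' l) :=
  ⟨_, rfl, funext fun l => (S.ι_ret _ (h l)).symm⟩

/-- The injectivity half of the five lemma, for the map from sums of cross products to the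
cohomology of `G × K`, along `Hⁿ⁻¹(γ) → Hⁿ⁻¹(β) → Hⁿ(ρ) → Hⁿ(γ)`. -/
theorem indep (S : RepSES ρ γ β) {n : ℤ} (h₁ : b.Spans (n - 1) γ) (h₂ : b.Indep n γ) (h₃ : b.Indep (n - 1) β) :
    b.Indep n ρ := by
  intro f hf hd w hw h
  obtain ⟨c, hc, hfc⟩ := h₂ (fun t l => S.ι (f t l)) (fun t => (hf t).map S.ι)
    (fun t => by
      have := S.dl_ι (MonoidHom.id G) (f t)
      simp only [MonoidHom.comp_id, hd t, Pi.zero_apply, map_zero] at this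
      exact this)
    (fun l => S.ι (w l)) (hw.map S.ι) (by rw [b.crossSum_map, h, S.dl_ι])
  have hqc : ∀ t, dl β (fun l => S.q (c t l)) = 0 := fun t => by
    have := S.dl_q (MonoidHom.id G) (c t)
    simp only [MonoidHom.comp_id, ← hfc, S.q_ι] at this
    exact this
  have hw' : Deg (n - 1) ((fun l => S.ι (w l)) - b.crossSum c) :=
    (hw.map S.ι).sub (b.deg_crossSum fun t => by convert hc t using 1; ring)
  -- The primitives `c` found in `γ` need not lie in `A`. They are corrected by cocycles `e` so that
  -- the cross sum of `q (c + e)` is a coboundary; independence over `β` then gives `q (c + e) =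
  -- dy`, and `c + e - d (sec y)` lies in `A`.
  obtain ⟨e, he, hed, v, hv, hev⟩ := h₁ _ hw' (by
    rw [map_sub, b.dl_crossSum, S.dl_ι, ← h, ← b.crossSum_map, funext hfc, sub_self])
  obtain ⟨y, hy, hye⟩ := h₃ (fun t l => S.q ((c t + e t) l))
    (fun t => ((by convert hc t using 1; ring : Deg (n - 1 - b.deg t) (c t)).add (he t)).map S.q)
    (fun t => by
      have h1 := S.dl_q (MonoidHom.id G) (e t)
      simp only [MonoidHom.comp_id, hed t] at h1
      have h2 : (fun l => S.q ((c t + e t) l)) =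
        (fun l => S.q (c t l)) + fun l => S.q (e t l) := by funext l; simp
      rw [h2, map_add, hqc, h1]
      funext l
      simp)
    (fun l => S.q ((-v) l)) (hv.neg.map S.q) (by
      rw [S.dl_q, map_neg, b.crossSum_map]
      funext l
      have h1 := congr(S.q ($hev l))
      have h2 : b.crossSum (fun t => c t + e t) = b.crossSum c + b.crossSum e := map_add _ _ _
      rw [h2]
      simp only [Pi.sub_apply, Pi.add_apply, map_sub, map_add, S.q_ι, Pi.neg_apply, map_neg]
        at h1 ⊢
      rw [← sub_eq_zero] at h1 ⊢
      rw [← neg_eq_zero, ← h1]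
      abel)
  refine ⟨fun t l => S.ret ((c t + e t - dl γ fun l => S.sec (y t l)) l), fun t => ?_, fun t => ?_⟩
  · refine ((((by convert hc t using 1 : Deg (n - b.deg t - 1) (c t)).add
      (by convert he t using 1; ring)).sub ?_)).map S.ret
    convert ((hy t).map S.sec).dl (ρ := γ) using 1
    ring
  · have hq : ∀ l, S.q ((c t + e t - dl γ fun l => S.sec (y t l)) l) = 0 := by
      intro l
      have h1 := congrFun (S.dl_sec (MonoidHom.id G) (y t)) l
      have h2 := congrFun (hye t) l
      simp only [MonoidHom.comp_id] at h1
      rw [Pi.sub_apply, map_sub, h1, ← h2, sub_self]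
    apply S.ι_injective
    have h1 := S.dl_ι (MonoidHom.id G)
      (fun l => S.ret ((c t + e t - dl γ fun l => S.sec (y t l)) l))
    simp only [MonoidHom.comp_id] at h1
    rw [← h1, hfc]
    simp only [S.ι_ret _ (hq _)]
    have h2 : (fun l => (c t + e t - dl γ fun l => S.sec (y t l)) l) =
      c t + e t - dl γ fun l => S.sec (y t l) := rfl
    rw [h2, map_sub, map_add, dl_dl, hed, add_zero, sub_zero]

/-- The surjectivity half of the five lemma, along `Hⁿ⁻¹(β) → Hⁿ(ρ) → Hⁿ(γ) → Hⁿ(β)`. -/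
theorem spans (S : RepSES ρ γ β) {n : ℤ} (h₁ : b.Spans n γ) (h₂ : b.Indep n β) (h₃ : b.Spans (n - 1) β) :
    b.Spans n ρ := by
  intro z hz hd
  obtain ⟨e, he, hed, v, hv, hev⟩ := h₁ (fun l => S.ι (z l)) (hz.map S.ι) (by
    rw [S.dl_ι, hd]
    funext l
    simp)
  have hqe : ∀ t, dl β (fun l => S.q (e t l)) = 0 := fun t => by
    have := S.dl_q (MonoidHom.id G) (e t)
    simp only [MonoidHom.comp_id, hed t, Pi.zero_apply, map_zero] at this
    exact this
  obtain ⟨y, hy, hye⟩ := h₂ (fun t l => S.q (e t l)) (fun t => (he t).map S.q) hqe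
    (fun l => S.q ((-v) l)) (hv.neg.map S.q) (by
      rw [S.dl_q, map_neg, b.crossSum_map]
      funext l
      have h1 := congr(S.q ($hev l))
      simp only [Pi.add_apply, map_add, S.q_ι, Pi.neg_apply, map_neg] at h1 ⊢
      exact eq_neg_of_add_eq_zero_left h1.symm)
  have hy' : ∀ t, Deg (n - b.deg t) (dl γ fun l => S.sec (y t l)) := fun t => by
    convert ((hy t).map S.sec).dl (ρ := γ) using 1
    ring
  have hq : ∀ t l, S.q ((e t - dl γ fun l => S.sec (y t l)) l) = 0 := by
    intro t l
    have h1 := congrFun (S.dl_sec (MonoidHom.id G) (y t)) l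
    have h2 := congrFun (hye t) l
    simp only [MonoidHom.comp_id] at h1
    rw [Pi.sub_apply, map_sub, h1, ← h2, sub_self]
  choose a ha ha' using fun t => S.exists_lift (hq t)
  have hdega : ∀ t, Deg (n - b.deg t) (a t) := fun t => by
    rw [ha t]
    exact ((he t).sub (hy' t)).map S.ret
  have hda : ∀ t, dl ρ (a t) = 0 := fun t => by
    apply S.ι_injective
    have h1 := S.dl_ι (MonoidHom.id G) (a t)
    simp only [MonoidHom.comp_id, ← ha' t, map_sub, hed, dl_dl] at h1
    rw [← h1]
    funext l
    simp
  let v' := b.crossSum (fun t l => S.sec (y t l)) + v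
  have hv' : Deg (n - 1) v' := (b.deg_crossSum fun t => by
    convert (hy t).map S.sec using 1; ring).add hv
  have hdv' : dl (γ.comp (MonoidHom.fst G K)) v' = fun l => S.ι ((z - b.crossSum a) l) := by
    have h1 : (fun l => S.ι ((z - b.crossSum a) l)) =
        (fun l => S.ι (z l)) - b.crossSum fun t l => S.ι (a t l) := by
      rw [b.crossSum_map]
      funext l
      simp
    have h2 : b.crossSum (fun t => e t - dl γ fun l => S.sec (y t l)) =
      b.crossSum e - b.crossSum fun t => dl γ fun l => S.sec (y t l) := map_sub _ _ _
    rw [h1, ← funext ha', h2, hev, map_add, b.dl_crossSum]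
    abel
  -- The class of `z - b.crossSum a` dies in `γ`, so it is the connecting image of the class of `q
  -- v'`. Writing that class with coefficients `f`, the family `a'` below consists of the connecting
  -- images of the `f t`.
  obtain ⟨f, hf, hfd, x, hx, hfx⟩ := h₃ (fun l => S.q (v' l)) (hv'.map S.q) (by
    rw [S.dl_q, hdv']
    funext l
    simp [S.q_ι])
  have hq2 : ∀ t l, S.q (dl γ (fun l => S.sec (f t l)) l) = 0 := by
    intro t l
    have h1 := congrFun (S.dl_sec (MonoidHom.id G) (f t)) l
    simp only [MonoidHom.comp_id, hfd] at h1
    exact h1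
  choose a' haret haι using fun t => S.exists_lift (hq2 t)
  have hdega' : ∀ t, Deg (n - b.deg t) (a' t) := fun t => by
    rw [haret t]
    refine Deg.map ?_ S.ret
    convert ((hf t).map S.sec).dl (ρ := γ) using 1
    ring
  have hda' : ∀ t, dl ρ (a' t) = 0 := fun t => by
    apply S.ι_injective
    have h1 := S.dl_ι (MonoidHom.id G) (a' t)
    simp only [MonoidHom.comp_id, ← haι t, dl_dl] at h1
    rw [← h1]
    funext l
    simp
  -- `v'` is corrected to lie in the kernel of `q`; its preimage `w` in `A` is the primitive sought.
  let u := v' - b.crossSum (fun t l => S.sec (f t l)) -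
    dl (γ.comp (MonoidHom.fst G K)) fun l => S.sec (x l)
  have hu : Deg (n - 1) u := (hv'.sub (b.deg_crossSum fun t => (hf t).map S.sec)).sub (by
    convert (hx.map S.sec).dl (ρ := γ.comp (MonoidHom.fst G K)) using 1
    ring)
  have hqu : ∀ l, S.q (u l) = 0 := fun l => by
    have h1 := congrFun (S.dl_sec (MonoidHom.fst G K) x) l
    have h2 := congrFun hfx l
    have h3 := congrFun (b.crossSum_map S.q fun t l => S.sec (f t l)) l
    simp only [S.q_sec] at h3
    simp only [u, Pi.sub_apply, map_sub]
    rw [h1, h2, ← h3, Pi.add_apply]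
    abel
  obtain ⟨w, hwret, hwι⟩ := S.exists_lift hqu
  refine ⟨fun t => a t + a' t, fun t => (hdega t).add (hdega' t),
    fun t => by rw [map_add, hda, hda', add_zero], w, ?_, ?_⟩
  · rw [hwret]
    exact hu.map S.ret
  · apply S.ι_injective
    have h1 := S.dl_ι (MonoidHom.fst G K) w
    have h2 : b.crossSum (fun t => a t + a' t) = b.crossSum a + b.crossSum a' := map_add _ _ _
    have h3 := b.crossSum_map S.ι a'
    rw [← funext haι] at h3
    have h4 : dl (γ.comp (MonoidHom.fst G K)) u =
        (fun l => S.ι ((z - b.crossSum a) l)) - fun l => S.ι (b.crossSum a' l) := by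
      simp only [u, map_sub, dl_dl, sub_zero]
      rw [hdv', b.dl_crossSum, h3]
    rw [← hwι, h4] at h1
    funext l
    have h5 := congrFun h1 l
    simp only [Pi.sub_apply, map_sub, Pi.add_apply, map_add, h2] at h5 ⊢
    rw [← h5]
    abel

end RepSES

/-- The quotient of the coinduced representation `G → A` by `A`. -/
def coindQuot (ρ : Representation k G A) : Submodule k (G → A) :=
  LinearMap.range (LinearMap.pi fun x => ρ x : A →ₗ[k] G → A)

theorem coindQuot_le (ρ : Representation k G A) (g : G) :
    coindQuot ρ ≤ (coindQuot ρ).comap (coindRep k G A g) := by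
  rintro _ ⟨a, rfl⟩
  exact ⟨ρ g a, by funext x; simp⟩

/-- The action of `G` on the quotient of `G → A` by `A`. -/
def coindQuotRep (ρ : Representation k G A) : Representation k G ((G → A) ⧸ coindQuot ρ) where
  toFun g := (coindQuot ρ).mapQ (coindQuot ρ) (coindRep k G A g) (coindQuot_le ρ g)
  map_one' := by
    ext x
    simp
  map_mul' g h := by
    ext x
    simp

/-- The embedding `a ↦ (x ↦ ρ x a)` is equivariant for right translation and is retracted by
evaluation at `1`. The section exists because `k` is a field. -/
theorem exists_repSES (ρ : Representation k G A) :
    Nonempty (RepSES ρ (coindRep k G A) (coindQuotRep ρ)) := by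
  obtain ⟨s, hs⟩ := (coindQuot ρ).mkQ.exists_rightInverse_of_surjective
    (LinearMap.range_eq_top.2 (Submodule.mkQ_surjective _))
  exact ⟨{
    ι := LinearMap.pi fun x => ρ x
    q := (coindQuot ρ).mkQ
    sec := s
    ret := LinearMap.proj 1
    ι_ρ := fun g a => by funext x; simp
    q_γ := fun g c => rfl
    ret_ι := fun a => by simp
    q_sec := fun x => LinearMap.congr_fun hs x
    q_ι := fun a => (Submodule.Quotient.mk_eq_zero _).2 ⟨a, rfl⟩
    ι_ret := fun c hc => by
      obtain ⟨a, rfl⟩ := (Submodule.Quotient.mk_eq_zero _).1 hc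
      simp }⟩

/-- The Künneth theorem for `G × K`, with coefficients in a representation of `G`. -/
theorem kunneth_module [Finite G] (n : ℕ) (hn : (n : ℤ) - 1 ≤ N) (A : Type) [AddCommGroup A]
    [Module k A] [Module.Finite k A] (ρ : Representation k G A) :
    b.Indep ((n : ℤ) - 1) ρ ∧ b.Spans ((n : ℤ) - 1) ρ := by
  induction n generalizing A with
  -- The index is the degree plus one: the induction starts in degree `-1`, where every cochain is
  -- zero.
  | zero =>
    refine ⟨fun f hf _ w _ _ => ⟨0, fun t => Deg.zero, fun t => ?_⟩, fun z hz _ =>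
      ⟨0, fun t => Deg.zero, fun t => map_zero _, 0, Deg.zero, ?_⟩⟩
    · rw [(hf t).of_neg (by simp; omega)]
      exact (map_zero _).symm
    · rw [hz.of_neg (by simp), map_zero, map_zero, add_zero]
  | succ n ih =>
    -- Independence in the new degree comes first and for all representations, because the spanning
    -- argument applies it to the quotient representation in that same degree.
    have ind : ∀ (A : Type) [AddCommGroup A] [Module k A] [Module.Finite k A]
        (ρ : Representation k G A), b.Indep (((n + 1 : ℕ) : ℤ) - 1) ρ := by
      intro A _ _ _ ρ
      obtain ⟨S⟩ := exists_repSES ρ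
      have e : ((n + 1 : ℕ) : ℤ) - 1 - 1 = (n : ℤ) - 1 := by push_cast; ring
      refine S.indep (b := b) (b.spans_coindRep (by omega)) b.indep_coindRep ?_
      rw [e]
      exact (ih (by omega) _ _).1
    refine ⟨ind A ρ, ?_⟩
    obtain ⟨S⟩ := exists_repSES ρ
    have e : ((n + 1 : ℕ) : ℤ) - 1 - 1 = (n : ℤ) - 1 := by push_cast; ring
    refine S.spans (b := b) (b.spans_coindRep hn) (ind _ _) ?_
    rw [e]
    exact (ih (by omega) _ _).2

theorem cupR_of_deg_zero {H : Type} [Group H] (ρ : Representation k H A) (a : List H → k)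
    {f : List H → A} (hf : Deg 0 f) (hinv : ∀ h, ρ h (f []) = f []) (l : List H) :
    cupR ρ a f l = a l • f [] := by
  induction l generalizing a with
  | nil => rfl
  | cons h t ih => rw [cupR_cons, ih, hf _ (by simp; omega), map_smul, hinv, smul_zero, zero_add]

/-- The cross products in the two orders agree up to sign and coboundaries. -/
theorem cross_comm (n m : ℕ) (A : Type) [AddCommGroup A] [Module k A] (ρ : Representation k G A)
    {f : List G → A} {g : List K → k} (hf : Deg n f) (hg : Deg m g) (hdf : dl ρ f = 0)
    (hdg : dl (1 : Representation k K k) g = 0) :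
    ∃ w, Deg ((n : ℤ) + m - 1) w ∧ cross g f = (-1 : k) ^ (m * n) •
      cupRight (ρ.comp (MonoidHom.fst G K)) (fun l => g (l.map (MonoidHom.snd G K)))
        (fun l => f (l.map (MonoidHom.fst G K))) + dl (ρ.comp (MonoidHom.fst G K)) w := by
  induction n generalizing A with
  -- A `0`-cocycle is an invariant vector, so both products are multiplication by it and agree as
  -- cochains.
  | zero =>
    refine ⟨0, Deg.zero, ?_⟩
    have hinv : ∀ h, ρ h (f []) = f [] := fun h => by
      simpa [dl_cons, add_neg_eq_zero] using congrFun hdf [h]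
    funext l
    have h1 := cupL_append (hf.comp (MonoidHom.fst G K))
      (g := fun l => g (l.map (MonoidHom.snd G K))) [] l rfl
    have h2 := cupR_of_deg_zero (ρ.comp (MonoidHom.fst G K))
      (fun l => g (l.map (MonoidHom.snd G K))) (hf.comp (MonoidHom.fst G K))
      (fun h => hinv h.1) l
    rw [mul_zero, pow_zero, one_smul, map_zero, add_zero]
    exact h1.trans h2.symm
  | succ n ih =>
    obtain ⟨S⟩ := exists_repSES ρ
    have hιf := S.dl_ι (MonoidHom.id G) f
    simp only [MonoidHom.comp_id, hdf, Pi.zero_apply, map_zero] at hιf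
    -- Dimension shifting: `ι f = dc`, and the image of `c` in the quotient is a cocycle of degree
    -- `n`, to which the induction hypothesis applies.
    obtain ⟨c, hc, hfc⟩ := coindRep_acyclic (n := ((n + 1 : ℕ) : ℤ)) (by omega) (hf.map S.ι) hιf
    replace hc : Deg (n : ℤ) c := by simpa using hc
    have hqc := S.dl_q (MonoidHom.id G) c
    simp only [MonoidHom.comp_id, ← hfc, S.q_ι] at hqc
    obtain ⟨y, hy, hyc⟩ := ih _ (coindQuotRep ρ) (hc.map S.q) hqc
    have hg' : Deg (m : ℤ) (fun l : List (G × K) => g (l.map (MonoidHom.snd G K))) :=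
      hg.comp (MonoidHom.snd G K)
    -- `u` comes from a cochain in `A`, and its coboundary is the difference of the two products for
    -- `f`. Moving the coboundary past `g` gives the additional factor `(-1) ^ m`, so the exponent
    -- grows from `m * n` to `m * (n + 1)`.
    let u := cross g c - (-1 : k) ^ (m * n) •
      cupRight ((coindRep k G A).comp (MonoidHom.fst G K))
        (fun l => g (l.map (MonoidHom.snd G K))) (fun l => c (l.map (MonoidHom.fst G K))) -
      dl ((coindRep k G A).comp (MonoidHom.fst G K)) fun l => S.sec (y l)
    have hu : Deg ((n : ℤ) + m) u := by
      refine ((hc.cross hg).sub (Deg.smul _ ?_)).sub ?_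
      · rw [add_comm]
        exact hg'.cupR (hc.comp (MonoidHom.fst G K))
      · convert (hy.map S.sec).dl (ρ := (coindRep k G A).comp (MonoidHom.fst G K)) using 1
        ring
    have hqu : ∀ l, S.q (u l) = 0 := fun l => by
      have h1 := congrFun (S.dl_sec (MonoidHom.fst G K) y) l
      have h2 := congrFun hyc l
      rw [cross_map] at h2
      have h3 := cupR_map ((coindRep k G A).comp (MonoidHom.fst G K))
        ((coindQuotRep ρ).comp (MonoidHom.fst G K)) S.q (fun h c => S.q_γ h.1 c)
        (fun l => g (l.map (MonoidHom.snd G K))) (fun l => c (l.map (MonoidHom.fst G K))) l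
      simp only [u, Pi.sub_apply, map_sub, Pi.smul_apply, map_smul, Pi.add_apply,
        cupRight_apply] at h1 h2 ⊢
      rw [h1, h2, h3]
      abel
    obtain ⟨w, hwret, hwι⟩ := S.exists_lift hqu
    refine ⟨w, ?_, S.ι_injective ?_⟩
    · rw [hwret]
      convert hu.map S.ret using 1
      push_cast
      ring
    · have h1 := S.dl_ι (MonoidHom.fst G K) w
      rw [← hwι] at h1
      have h2 := dl_cupR ((coindRep k G A).comp (MonoidHom.fst G K))
        (dl_one_comp_snd (G := G) hdg) (fun l => c (l.map (MonoidHom.fst G K)))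
      rw [dl_comp, ← hfc] at h2
      funext l
      have h3 := congrFun h1 l
      have h4 := congrFun h2 l
      rw [hg'.sign_mul, cupR_smul_left, cupR_map (ρ.comp (MonoidHom.fst G K))
        ((coindRep k G A).comp (MonoidHom.fst G K)) S.ι (fun h c => S.ι_ρ h.1 c)
        (fun l => g (l.map (MonoidHom.snd G K)))
        (fun l => f (l.map (MonoidHom.fst G K))) l] at h4
      simp only [u, map_sub, map_smul, dl_dl, Pi.zero_apply, sub_zero, Pi.sub_apply, Pi.smul_apply,
        cupRight_apply, h4, dl_cross _ hdg, ← hfc, cross_map] at h3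
      rw [Pi.add_apply, map_add, ← h3, Pi.smul_apply, map_smul, cupRight_apply, smul_smul,
        ← pow_add, mul_add, mul_one]
      abel

end Kunneth

/-! ### Comparison of list cochains with group cohomology. -/

section Bridge

set_option linter.unusedSectionVars false

variable {k : Type} [Field k] {G K H : Type} [Group G] [Group K] [Group H]

theorem faceSum_ofFn {n : ℕ} (Y : List G → k) (x : Fin (n + 1) → G) :
    faceSum Y (List.ofFn x) = ∑ j : Fin (n + 1), (-1 : k) ^ ((j : ℕ) + 1) *
      Y (List.ofFn (Fin.contractNth j (· * ·) x)) := by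
  induction n generalizing Y with
  | zero => simp
  | succ n ih =>
    have e0 : List.ofFn (Fin.contractNth 0 (· * ·) x) =
        x 0 * x 1 :: List.ofFn fun i : Fin n => x i.succ.succ := by
      rw [List.ofFn_succ]
      congr 1
    have e1 : ∀ j : Fin (n + 1), List.ofFn (Fin.contractNth j.succ (· * ·) x) =
        x 0 :: List.ofFn (Fin.contractNth j (· * ·) fun i => x i.succ) := by
      intro j
      rw [List.ofFn_succ]
      congr 1
      congr 1
      funext i
      simp [Fin.contractNth]
    have ih' := ih (fun m => Y (x 0 :: m)) fun i => x i.succ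
    rw [List.ofFn_succ] at ih'
    rw [Fin.sum_univ_succ, List.ofFn_succ, List.ofFn_succ, faceSum_cons_cons, ih', e0]
    simp only [e1, Fin.val_zero, Fin.val_succ, pow_succ, ← Finset.sum_neg_distrib, sub_eq_add_neg]
    congr 1
    · simp
    · exact Finset.sum_congr rfl fun j _ => by ring

theorem cobd_ofFn {n : ℕ} (Y : List G → k) (x : Fin (n + 1) → G) :
    cobd k n (fun x => Y (List.ofFn x)) x = dl (1 : Representation k G k) Y (List.ofFn x) := by
  rw [cobd_apply, ← faceSum_ofFn Y x, List.ofFn_succ, dl_cons]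
  rfl

/-- The cocycles of degree `n` on lists. -/
def listCocyc (k G : Type) [Field k] [Group G] (n : ℕ) : Submodule k (List G → k) where
  carrier := {Y | Deg n Y ∧ dl (1 : Representation k G k) Y = 0}
  add_mem' hY hZ := ⟨hY.1.add hZ.1, by rw [map_add, hY.2, hZ.2, add_zero]⟩
  zero_mem' := ⟨Deg.zero, map_zero _⟩
  smul_mem' c Y hY := ⟨hY.1.smul c, by rw [map_smul, hY.2, smul_zero]⟩

theorem cobd_listCocyc {n : ℕ} (Y : listCocyc k G n) :
    cobd k n (fun x => Y.1 (List.ofFn x)) = 0 := by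
  funext x
  rw [cobd_ofFn, Y.2.2]
  rfl

/-- The cohomology class of a cocycle on lists. -/
def listCls (k G : Type) [Field k] [Group G] (n : ℕ) : listCocyc k G n →ₗ[k] Coh k G n :=
  clsHom k G n ∘ₗ
    { toFun := fun Y => ⟨fun x => Y.1 (List.ofFn x), cobd_listCocyc Y⟩
      map_add' := fun _ _ => rfl
      map_smul' := fun _ _ => rfl }

theorem listCls_apply {n : ℕ} (Y : listCocyc k G n) : listCls k G n Y =
    cls k n (fun x => Y.1 (List.ofFn x)) (cobd_listCocyc Y) := rfl

/-- The extension by zero of an inhomogeneous cochain to all lists. -/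
def toList {n : ℕ} (f : (Fin n → G) → k) (l : List G) : k :=
  if h : l.length = n then f fun i => l.get (Fin.cast h.symm i) else 0

theorem toList_ofFn {n : ℕ} (f : (Fin n → G) → k) (x : Fin n → G) :
    toList f (List.ofFn x) = f x := by
  rw [toList, dif_pos (List.length_ofFn)]
  congr 1
  funext i
  simp

theorem deg_toList {n : ℕ} (f : (Fin n → G) → k) : Deg n (toList f) := fun l hl =>
  dif_neg (by exact_mod_cast hl)

theorem Deg.ext {n : ℕ} {Y Z : List G → k} (hY : Deg n Y) (hZ : Deg n Z)
    (h : ∀ x : Fin n → G, Y (List.ofFn x) = Z (List.ofFn x)) : Y = Z := by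
  funext l
  by_cases hl : l.length = n
  · subst hl
    simpa using h l.get
  · rw [hY l (by exact_mod_cast hl), hZ l (by exact_mod_cast hl)]

theorem dl_toList {n : ℕ} (f : (Fin n → G) → k) :
    dl (1 : Representation k G k) (toList f) = toList (cobd k n f) :=
  Deg.ext (n := n + 1) (deg_toList f).dl (deg_toList _) fun x => by
    rw [← cobd_ofFn, toList_ofFn]
    simp only [toList_ofFn]

theorem listCls_surjective (n : ℕ) : Function.Surjective (listCls k G n) := fun x => by
  obtain ⟨f, hf, rfl⟩ := cls_surj n x
  refine ⟨⟨toList f, deg_toList f, ?_⟩, ?_⟩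
  · rw [dl_toList, hf]
    funext l
    simp [toList]
  · rw [listCls_apply]
    simp only [toList_ofFn]

theorem listCls_eq_zero_iff {n : ℕ} (Y : listCocyc k G n) : listCls k G n Y = 0 ↔
    ∃ w, Deg ((n : ℤ) - 1) w ∧ Y.1 = dl (1 : Representation k G k) w := by
  rw [listCls_apply]
  cases n with
  | zero =>
    rw [cls_zero_eq_zero_iff]
    constructor
    · intro h
      refine ⟨0, Deg.zero, ?_⟩
      rw [map_zero]
      exact Deg.ext Y.2.1 Deg.zero fun x => congrFun h x
    · rintro ⟨w, hw, h⟩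
      rw [h, hw.of_neg (by simp), map_zero]
      rfl
  | succ n =>
    rw [cls_succ_eq_zero_iff]
    constructor
    · rintro ⟨f, hf⟩
      refine ⟨toList f, by simpa using deg_toList f, Deg.ext Y.2.1 (deg_toList f).dl fun x => ?_⟩
      rw [dl_toList, hf, toList_ofFn]
    · rintro ⟨w, hw, h⟩
      refine ⟨fun x => w (List.ofFn x), funext fun x => ?_⟩
      rw [cobd_ofFn, h]

theorem pull_listCls {n : ℕ} (φ : G →* K) (Y : listCocyc k K n) :
    pull k φ n (listCls k K n Y) = listCls k G n ⟨fun l => Y.1 (l.map φ), Y.2.1.comp φ, by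
      have := dl_comp (1 : Representation k K k) φ Y.1
      rw [Y.2.2] at this
      exact this⟩ := by
  rw [listCls_apply, pull_cls, listCls_apply]
  simp only [List.map_ofFn]
  rfl

theorem cup_listCls {m n : ℕ} (Y : listCocyc k G m) (Z : listCocyc k G n) :
    cup k G m n (listCls k G m Y) (listCls k G n Z) =
      listCls k G (m + n) ⟨cupL Y.1 Z.1, by simpa using Y.2.1.cupL Z.2.1, by
        rw [dl_cupL _ Z.2.2, Y.2.2]
        exact map_zero (cupLeft k Z.1)⟩ := by
  rw [listCls_apply, listCls_apply, cup_cls, listCls_apply]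
  congr 1
  funext x
  have : List.ofFn x = List.ofFn (fun i => x (Fin.castAdd n i)) ++
      List.ofFn (fun i => x (Fin.natAdd m i)) := by
    rw [← List.ofFn_fin_append]
    congr 1
    exact (Fin.append_castAdd_natAdd).symm
  exact ((congrArg (cupL Y.1 Z.1) this).trans ((cupL_append Y.2.1 _ _ List.length_ofFn).trans
    (mul_comm _ _))).symm

theorem listCls_congr {n : ℕ} {Y Z : List G → k} (hY : Y ∈ listCocyc k G n)
    (hZ : Z ∈ listCocyc k G n) {w : List G → k} (hw : Deg ((n : ℤ) - 1) w)
    (h : Y = Z + dl (1 : Representation k G k) w) :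
    listCls k G n ⟨Y, hY⟩ = listCls k G n ⟨Z, hZ⟩ := by
  rw [← sub_eq_zero, ← map_sub, listCls_eq_zero_iff]
  exact ⟨w, hw, by simp [h]⟩

/-- Pulled back classes from the two factors commute up to sign. -/
theorem cup_pull_comm {m n : ℕ} (x : Coh k G m) (y : Coh k K n) :
    (⟨m + n, cup k (G × K) m n (pull k (MonoidHom.fst G K) m x)
      (pull k (MonoidHom.snd G K) n y)⟩ : GradedMonoid (Coh k (G × K))) =
    ⟨n + m, (-1 : k) ^ (n * m) • cup k (G × K) n m (pull k (MonoidHom.snd G K) n y)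
      (pull k (MonoidHom.fst G K) m x)⟩ := by
  obtain ⟨Y, rfl⟩ := listCls_surjective m x
  obtain ⟨Z, rfl⟩ := listCls_surjective n y
  obtain ⟨w, hw, h⟩ := cross_comm m n k (1 : Representation k G k) Y.2.1 Z.2.1 Y.2.2 Z.2.2
  rw [pull_listCls, pull_listCls, cup_listCls, cup_listCls, ← map_smul]
  -- The two sides live in degrees `m + n` and `n + m`. A cochain on lists does not record its
  -- degree in its type, so one function represents classes in both groups.
  have cast : ∀ (a b : ℕ) (e : a = b) (U : List (G × K) → k) (hU : U ∈ listCocyc k (G × K) a)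
      (hU' : U ∈ listCocyc k (G × K) b), (⟨a, listCls k (G × K) a ⟨U, hU⟩⟩ :
        GradedMonoid (Coh k (G × K))) = ⟨b, listCls k (G × K) b ⟨U, hU'⟩⟩ := by
    rintro a _ rfl U hU hU'
    rfl
  have hcomm : n + m = m + n := add_comm n m
  refine Eq.trans ?_ (cast (m + n) (n + m) hcomm.symm _ ?_ _)
  · congr 1
    refine listCls_congr _ _ (w := w) (by push_cast; exact hw) ?_
    rw [MonoidHom.one_comp] at h
    refine Eq.trans h ?_
    congr 1
    funext l
    exact congrArg _ (cupR_one_eq_cupL _ _ l)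
  · have mem : ∀ b, n + m = b → ∀ U, U ∈ listCocyc k (G × K) (n + m) →
        U ∈ listCocyc k (G × K) b := by
      rintro _ rfl U hU
      exact hU
    exact mem _ hcomm _ ((-1 : k) ^ (n * m) • (⟨_, _⟩ : listCocyc k (G × K) (n + m))).2

instance (n : ℕ) [Finite G] : Module.Finite k (Coh k G n) := by
  have : Finite (Fin n → G) := inferInstance
  exact Module.Finite.of_surjective _ (clsHom_surjective (k := k) (G := G) n)

/-- Representatives of a basis of `Hʲ(K; k)`. -/
def basisRep (k K : Type) [Field k] [Group K] [Finite K] (j : ℕ)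
    (s : Fin (Module.finrank k (Coh k K j))) : listCocyc k K j :=
  Function.surjInv (listCls_surjective j) (Module.finBasis k (Coh k K j) s)

theorem listCls_basisRep [Finite K] (j : ℕ) (s : Fin (Module.finrank k (Coh k K j))) :
    listCls k K j (basisRep k K j s) = Module.finBasis k (Coh k K j) s :=
  Function.surjInv_eq _ _

end Bridge

/-! ### The Künneth isomorphism on total cohomology. -/

section TotalKunneth

set_option linter.unusedSectionVars false

variable {k : Type} [Field k] {G K H : Type} [Group G] [Group K] [Group H]

/-- The inclusion of `Hⁿ(G; k)` in the total cohomology. -/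
abbrev inTot (k G : Type) [Field k] [Group G] (n : ℕ) : Coh k G n →ₗ[k] TotalCoh k G :=
  DirectSum.lof k ℕ (Coh k G) n

theorem inTot_congr {m n : ℕ} {x : Coh k G m} {y : Coh k G n}
    (h : (⟨m, x⟩ : GradedMonoid (Coh k G)) = ⟨n, y⟩) : inTot k G m x = inTot k G n y := by
  cases h
  rfl

/-- The external product on total cohomology along `p₁ : H → G` and `p₂ : H → K`. -/
def extBilin (k : Type) [Field k] (p₁ : H →* G) (p₂ : H →* K) :
    TotalCoh k G →ₗ[k] TotalCoh k K →ₗ[k] TotalCoh k H :=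
  DirectSum.toModule k ℕ _ fun m => LinearMap.flip (DirectSum.toModule k ℕ _ fun n =>
    LinearMap.flip (((cup k H m n).compl₁₂ (pull k p₁ m) (pull k p₂ n)).compr₂
      (inTot k H (m + n))))

theorem extBilin_apply (p₁ : H →* G) (p₂ : H →* K) {m n : ℕ} (x : Coh k G m) (y : Coh k K n) :
    extBilin k p₁ p₂ (inTot k G m x) (inTot k K n y) =
      inTot k H (m + n) (cup k H m n (pull k p₁ m x) (pull k p₂ n y)) := by
  simp [extBilin, inTot]

theorem extBilin_component (p₁ : H →* G) (p₂ : H →* K) (v : TotalCoh k G) (i : ℕ) {j : ℕ}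
    (y : Coh k K j) : extBilin k p₁ p₂ v (inTot k K j y) (i + j) =
      cup k H i j (pull k p₁ i (v i)) (pull k p₂ j y) := by
  induction v using DirectSum.induction_on with
  | zero => simp
  | add v w hv hw => simp [hv, hw]
  | of m x =>
    rw [← DirectSum.lof_eq_of k, extBilin_apply]
    by_cases h : m = i
    · subst h
      simp [inTot, DirectSum.lof_eq_of]
    · rw [DirectSum.lof_eq_of, DirectSum.of_eq_of_ne _ _ _ (by omega), DirectSum.lof_eq_of,
        DirectSum.of_eq_of_ne _ _ _ (Ne.symm h)]
      simp

theorem extBilin_component_of_lt (p₁ : H →* G) (p₂ : H →* K) (v : TotalCoh k G) {N j : ℕ}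
    (h : N < j) (y : Coh k K j) : extBilin k p₁ p₂ v (inTot k K j y) N = 0 := by
  induction v using DirectSum.induction_on with
  | zero => simp
  | add v w hv hw => simp [hv, hw]
  | of m x =>
    rw [← DirectSum.lof_eq_of k, extBilin_apply, DirectSum.lof_eq_of,
      DirectSum.of_eq_of_ne _ _ _ (by omega)]

/-- The external product on total cohomology. -/
def ext (k : Type) [Field k] (p₁ : H →* G) (p₂ : H →* K) :
    TotalCoh k G ⊗[k] TotalCoh k K →ₗ[k] TotalCoh k H :=
  TensorProduct.lift (extBilin k p₁ p₂)

theorem ext_tmul (p₁ : H →* G) (p₂ : H →* K) (v : TotalCoh k G) (w : TotalCoh k K) :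
    ext k p₁ p₂ (v ⊗ₜ w) = extBilin k p₁ p₂ v w := TensorProduct.lift.tmul _ _

theorem cross_mem {i j N : ℕ} (e : i + j = N) (Y : listCocyc k G i) (Z : listCocyc k K j) :
    cross Z.1 Y.1 ∈ listCocyc k (G × K) N := by
  subst e
  refine ⟨by simpa using Y.2.1.cross Z.2.1, ?_⟩
  have := dl_cross (1 : Representation k G k) Z.2.2 Y.1
  rw [Y.2.2, map_zero] at this
  exact this

theorem listCls_cross {i j : ℕ} (Y : listCocyc k G i) (Z : listCocyc k K j) :
    listCls k (G × K) (i + j) ⟨cross Z.1 Y.1, cross_mem rfl Y Z⟩ =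
      cup k (G × K) i j (pull k (MonoidHom.fst G K) i (listCls k G i Y))
        (pull k (MonoidHom.snd G K) j (listCls k K j Z)) := by
  rw [pull_listCls, pull_listCls, cup_listCls]
  rfl

theorem ext_listCls {i j N : ℕ} (e : i + j = N) (Y : listCocyc k G i) (Z : listCocyc k K j) :
    ext k (MonoidHom.fst G K) (MonoidHom.snd G K)
      (inTot k G i (listCls k G i Y) ⊗ₜ inTot k K j (listCls k K j Z)) =
      inTot k (G × K) N (listCls k (G × K) N ⟨cross Z.1 Y.1, cross_mem e Y Z⟩) := by
  subst e
  rw [ext_tmul, extBilin_apply, listCls_cross]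

/-- A homogeneous basis of the total cohomology. -/
def totBasis (k K : Type) [Field k] [Group K] [Finite K] :
    Module.Basis (Σ j, Fin (Module.finrank k (Coh k K j))) k (TotalCoh k K) :=
  .ofRepr (DFinsupp.mapRange.linearEquiv (fun j => (Module.finBasis k (Coh k K j)).repr) ≪≫ₗ
    (sigmaFinsuppLequivDFinsupp k).symm)

theorem totBasis_repr [Finite K] (x : TotalCoh k K)
    (t : Σ j, Fin (Module.finrank k (Coh k K j))) :
    (totBasis k K).repr x t = (Module.finBasis k (Coh k K t.1)).repr (x t.1) t.2 := rfl

theorem totBasis_apply [Finite K] (t : Σ j, Fin (Module.finrank k (Coh k K j))) :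
    totBasis k K t = inTot k K t.1 (listCls k K t.1 (basisRep k K t.1 t.2)) := by
  rw [listCls_basisRep]
  apply (totBasis k K).repr.injective
  ext ⟨i, s⟩
  rw [Module.Basis.repr_self, totBasis_repr]
  obtain ⟨j, r⟩ := t
  by_cases h : j = i
  · subst h
    simp [inTot, DirectSum.lof_eq_of, Finsupp.single_apply]
  · rw [DirectSum.lof_eq_of, DirectSum.of_eq_of_ne _ _ _ (Ne.symm h)]
    simp [h]

/-- The indices of basis elements of degree at most `N`. -/
def basisLE (k K : Type) [Field k] [Group K] [Finite K] (N : ℕ) :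
    Finset (Σ j, Fin (Module.finrank k (Coh k K j))) :=
  (Finset.range (N + 1)).sigma fun _ => Finset.univ

theorem mem_basisLE [Finite K] {N : ℕ} {t : Σ j, Fin (Module.finrank k (Coh k K j))} :
    t ∈ basisLE k K N ↔ t.1 ≤ N := by
  simp [basisLE]

theorem smul_basisRep_mem [Finite K] {n : ℕ} (c : k)
    (t : Σ j, Fin (Module.finrank k (Coh k K j))) (h : t.1 ≠ n → c = 0) :
    c • (basisRep k K t.1 t.2).1 ∈ listCocyc k K n := by
  by_cases e : t.1 = n
  · subst e
    exact (c • basisRep k K t.1 t.2).2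
  · rw [h e, zero_smul]
    exact zero_mem _

theorem listCls_smul_basisRep [Finite K] {n : ℕ} (c : k)
    (t : Σ j, Fin (Module.finrank k (Coh k K j))) (h : t.1 ≠ n → c = 0) :
    listCls k K n ⟨_, smul_basisRep_mem c t h⟩ = (c • totBasis k K t) n := by
  by_cases e : t.1 = n
  · subst e
    rw [totBasis_apply, ← map_smul, DirectSum.lof_eq_of, DirectSum.of_eq_same, ← map_smul]
    rfl
  · have := h e
    subst this
    have h0 : (⟨_, smul_basisRep_mem 0 t h⟩ : listCocyc k K n) = 0 :=
      Subtype.ext (zero_smul _ _)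
    rw [h0, map_zero, zero_smul]
    rfl

/-- Representatives of bases of the cohomology groups of degree at most `N`. -/
def cocycleBasis (k K : Type) [Field k] [Group K] [Finite K] (N : ℕ) : CocycleBasis k K N where
  T := basisLE k K N
  deg t := t.1.1
  g t := (basisRep k K t.1.1 t.1.2).1
  deg_g t := (basisRep k K t.1.1 t.1.2).2.1
  dl_g t := (basisRep k K t.1.1 t.1.2).2.2
  span n hn z hz hd := by
    rcases lt_or_ge n 0 with h | h
    · exact ⟨0, fun _ _ => rfl, 0, Deg.zero, by simp [hz.of_neg h]⟩
    lift n to ℕ using h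
    let x := listCls k K n ⟨z, hz, hd⟩
    -- The coordinates are taken in a basis of the total cohomology, so all degrees are treated
    -- together; those outside degree `n` vanish because `x` is homogeneous.
    let c := (totBasis k K).repr (inTot k K n x)
    have hc : ∀ t, t.1 ≠ n → c t = 0 := fun t ht => by
      simp only [c]
      rw [totBasis_repr, DirectSum.lof_eq_of, DirectSum.of_eq_of_ne _ _ _ ht]
      simp
    have hsum : ∑ t : basisLE k K N, c t • totBasis k K t = inTot k K n x := by
      rw [← (totBasis k K).linearCombination_repr (inTot k K n x),
        Finset.sum_coe_sort (basisLE k K N) fun t => c t • totBasis k K t]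
      refine (Finsupp.sum_of_support_subset _ (fun t ht => ?_) (fun t a => a • totBasis k K t)
        fun t _ => zero_smul k (totBasis k K t)).symm
      rw [mem_basisLE]
      by_contra h
      exact Finsupp.mem_support_iff.1 ht (hc t (by omega))
    refine ⟨fun t => c t, fun t ht => hc t (by exact_mod_cast ht), ?_⟩
    have hcls : listCls k K n (⟨z, hz, hd⟩ -
        ∑ t : basisLE k K N, ⟨_, smul_basisRep_mem (c t) t.1 (hc t)⟩) = 0 := by
      rw [map_sub, map_sum, sub_eq_zero, Finset.sum_congr rfl
        fun (t : basisLE k K N) _ => listCls_smul_basisRep (c t) t.1 (hc t)]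
      have := congr($hsum n)
      rw [DirectSum.lof_eq_of, DirectSum.of_eq_same, DirectSum.sum_apply] at this
      exact this.symm
    obtain ⟨w, hw, h⟩ := (listCls_eq_zero_iff _).1 hcls
    refine ⟨w, hw, ?_⟩
    rw [← h]
    simp
  indep n c hc w hw h := by
    rcases lt_or_ge n 0 with h0 | h0
    · exact funext fun t => hc t (by omega)
    lift n to ℕ using h0
    have hc' : ∀ t : basisLE k K N, t.1.1 ≠ n → c t = 0 := fun t ht =>
      hc t (by exact_mod_cast ht)
    have hcls : listCls k K n
        (∑ t : basisLE k K N, ⟨_, smul_basisRep_mem (c t) t.1 (hc' t)⟩) = 0 :=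
      (listCls_eq_zero_iff _).2 ⟨w, hw, by rw [← h]; simp⟩
    rw [map_sum, Finset.sum_congr rfl fun t _ =>
      listCls_smul_basisRep (c t) t.1 (hc' t)] at hcls
    have hsum : ∑ t : basisLE k K N, c t • totBasis k K t = 0 := by
      refine DFinsupp.ext fun m => ?_
      refine (DirectSum.sum_apply _ _ _).trans ?_
      by_cases hm : m = n
      · subst hm
        exact hcls
      · refine Finset.sum_eq_zero fun t _ => ?_
        by_cases ht : t.1.1 = n
        · rw [totBasis_apply, ← map_smul, DirectSum.lof_eq_of,
            DirectSum.of_eq_of_ne _ _ _ (by omega)]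
        · rw [hc' t ht, zero_smul]
          rfl
    exact funext (Fintype.linearIndependent_iff.1
      ((totBasis k K).linearIndependent.comp (Subtype.val : basisLE k K N → _)
        Subtype.val_injective) c hsum)

theorem ext_surjective [Finite G] [Finite K] :
    Function.Surjective (ext k (MonoidHom.fst G K) (MonoidHom.snd G K)) := by
  rw [← LinearMap.range_eq_top, eq_top_iff]
  intro z _
  induction z using DirectSum.induction_on with
  | zero => exact zero_mem _
  | add v w hv hw => exact add_mem (hv trivial) (hw trivial)
  | of N z =>
    obtain ⟨Z, rfl⟩ := listCls_surjective N z
    let b := cocycleBasis k K N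
    -- The argument `N + 1` selects degree `N`, the index of `kunneth_module` being one more than
    -- the degree.
    obtain ⟨f, hf, hd, w, hw, h⟩ := (kunneth_module b (N + 1) (by simp) k
      (1 : Representation k G k)).2 Z.1 (by simpa using Z.2.1)
      (by rw [MonoidHom.one_comp]; exact Z.2.2)
    have ht : ∀ t : b.T, b.deg t ≤ N := fun t => mem_basisLE.1 t.2
    let Y : ∀ t : b.T, listCocyc k G (N - b.deg t) := fun t => ⟨f t, by
      have := hf t
      rwa [show ((N + 1 : ℕ) : ℤ) - 1 - b.deg t = (N - b.deg t : ℕ) by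
        have := ht t; push_cast [this]; ring] at this, hd t⟩
    have e : ∀ t : b.T, N - b.deg t + b.deg t = N := fun t => Nat.sub_add_cancel (ht t)
    have hZ : listCls k (G × K) N Z = ∑ t : b.T, listCls k (G × K) N
        ⟨_, cross_mem (e t) (Y t) (basisRep k K t.1.1 t.1.2)⟩ := by
      rw [← map_sum, ← sub_eq_zero, ← map_sub, listCls_eq_zero_iff]
      refine ⟨w, by simpa using hw, ?_⟩
      rw [MonoidHom.one_comp, b.crossSum_apply] at h
      simp only [Submodule.coe_sub, h, AddSubmonoidClass.coe_finsetSum]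
      exact add_sub_cancel_left _ _
    rw [← DirectSum.lof_eq_of k, hZ, map_sum]
    refine sum_mem fun t _ => ⟨_, ext_listCls (e t) (Y t) (basisRep k K t.1.1 t.1.2)⟩

theorem ext_injective [Finite G] [Finite K] :
    Function.Injective (ext k (MonoidHom.fst G K) (MonoidHom.snd G K)) := by
  classical
  rw [← LinearMap.ker_eq_bot, LinearMap.ker_eq_bot']
  intro u hu
  let v := TensorProduct.equivFinsuppOfBasisRight (M := TotalCoh k G) (totBasis k K) u
  have huv : u = v.sum fun t a => a ⊗ₜ totBasis k K t := by
    rw [← TensorProduct.equivFinsuppOfBasisRight_symm_apply, LinearEquiv.symm_apply_apply]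
  suffices hv : ∀ (t₀ : Σ j, Fin (Module.finrank k (Coh k K j))) (i : ℕ), v t₀ i = 0 by
    have : v = 0 := Finsupp.ext fun t => DFinsupp.ext fun i => hv t i
    rw [huv, this, Finsupp.sum_zero_index]
  intro t₀ i
  -- The coefficient `v t₀ i` contributes to `ext u` in degree `N` only. There only basis elements
  -- of degree at most `N` occur, so the relation is a finite one to which `kunneth_module` applies.
  let N := i + t₀.1
  let b := cocycleBasis k K N
  have ht : ∀ t : b.T, b.deg t ≤ N := fun t => mem_basisLE.1 t.2
  have e : ∀ t : b.T, N - b.deg t + b.deg t = N := fun t => Nat.sub_add_cancel (ht t)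
  let F := fun t : Σ j, Fin (Module.finrank k (Coh k K j)) =>
    ext k (MonoidHom.fst G K) (MonoidHom.snd G K) (v t ⊗ₜ totBasis k K t) N
  have hF0 : ∀ t ∉ basisLE k K N, F t = 0 := fun t h => by
    simp only [F]
    rw [ext_tmul, totBasis_apply]
    exact extBilin_component_of_lt _ _ _ (by rw [mem_basisLE] at h; omega) _
  have hF : ∑ t ∈ basisLE k K N, F t = 0 := by
    have h1 : ∑ t ∈ v.support ∪ basisLE k K N, F t = 0 := by
      rw [huv, Finsupp.sum_of_support_subset v (Finset.subset_union_left (s₂ := basisLE k K N))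
        (fun t a => a ⊗ₜ totBasis k K t) fun t _ => TensorProduct.zero_tmul _ (totBasis k K t),
        map_sum] at hu
      have := congr($hu N)
      rwa [DirectSum.sum_apply] at this
    rw [← h1]
    exact Finset.sum_subset Finset.subset_union_right fun t _ h => hF0 t h
  choose Y hY using fun t : b.T => listCls_surjective (k := k) (G := G) (N - b.deg t)
    (v t.1 (N - b.deg t))
  have hFt : ∀ t : b.T, F t.1 = listCls k (G × K) N
      ⟨_, cross_mem (e t) (Y t) (basisRep k K t.1.1 t.1.2)⟩ := by
    intro t
    have key : ∀ (i N : ℕ) (h : i + t.1.1 = N) (Y : listCocyc k G i)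
        (_ : listCls k G i Y = v t.1 i),
        ext k (MonoidHom.fst G K) (MonoidHom.snd G K) (v t.1 ⊗ₜ totBasis k K t.1) N =
          listCls k (G × K) N ⟨_, cross_mem h Y (basisRep k K t.1.1 t.1.2)⟩ := by
      rintro i _ rfl Y hY
      rw [listCls_cross, hY, ext_tmul, totBasis_apply, extBilin_component]
    exact key _ _ (e t) (Y t) (hY t)
  have hcls : listCls k (G × K) N (∑ t : b.T,
      ⟨_, cross_mem (e t) (Y t) (basisRep k K t.1.1 t.1.2)⟩) = 0 := by
    rw [map_sum, ← hF]
    exact (Finset.sum_congr rfl fun t _ => (hFt t).symm).trans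
      (Finset.sum_coe_sort (basisLE k K N) F)
  obtain ⟨w, hw, h⟩ := (listCls_eq_zero_iff _).1 hcls
  obtain ⟨y, hy, hYy⟩ := (kunneth_module b (N + 1) (by simp) k
    (1 : Representation k G k)).1 (fun t => (Y t).1) (fun t => by
      have h1 := (Y t).2.1
      rwa [show ((N - b.deg t : ℕ) : ℤ) = ((N + 1 : ℕ) : ℤ) - 1 - b.deg t by
        have := ht t; push_cast [this]; ring] at h1) (fun t => (Y t).2.2) w
    (by simpa using hw) (by
      rw [MonoidHom.one_comp, ← h, b.crossSum_apply]
      simp only [AddSubmonoidClass.coe_finsetSum]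
      rfl)
  have hmem : t₀ ∈ basisLE k K N := mem_basisLE.2 (Nat.le_add_left _ _)
  have h0 := (listCls_eq_zero_iff (Y ⟨t₀, hmem⟩)).2 ⟨y ⟨t₀, hmem⟩, by
    have h1 := hy ⟨t₀, hmem⟩
    rwa [show ((N + 1 : ℕ) : ℤ) - 1 - b.deg ⟨t₀, hmem⟩ = (N - b.deg ⟨t₀, hmem⟩ : ℕ) by
      have := ht ⟨t₀, hmem⟩; push_cast [this]; ring] at h1, hYy _⟩
  replace h0 := (hY ⟨t₀, hmem⟩).symm.trans h0
  have hi : N - b.deg ⟨t₀, hmem⟩ = i := Nat.add_sub_cancel _ _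
  rwa [hi] at h0

end TotalKunneth

/-! ### Naturality of the external product and sign commutation. -/

section Naturality

set_option linter.unusedSectionVars false

variable {k : Type} [Field k] {G K H G' K' H' L : Type} [Group G] [Group K] [Group H]
  [Group G'] [Group K'] [Group H'] [Group L]

/-- The map induced by a homomorphism on total cohomology. -/
def totPull (k : Type) [Field k] (φ : G →* K) : TotalCoh k K →ₗ[k] TotalCoh k G :=
  DirectSum.lmap fun n => pull k φ n

theorem totPull_inTot (φ : G →* K) {n : ℕ} (x : Coh k K n) :
    totPull k φ (inTot k K n x) = inTot k G n (pull k φ n x) :=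
  DirectSum.lmap_lof _ _ _

theorem pull_id {n : ℕ} (x : Coh k G n) : pull k (MonoidHom.id G) n x = x := by
  obtain ⟨f, hf, rfl⟩ := cls_surj n x
  rw [pull_cls]
  rfl

theorem totPull_id : totPull k (MonoidHom.id G) = LinearMap.id :=
  DirectSum.linearMap_ext k fun n => LinearMap.ext fun x => by
    rw [LinearMap.comp_apply, totPull_inTot, pull_id]
    rfl

theorem totPull_comp (φ : G →* K) (ψ : K →* L) :
    totPull k φ ∘ₗ totPull k ψ = totPull k (ψ.comp φ) :=
  DirectSum.linearMap_ext k fun n => LinearMap.ext fun x => by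
    simp only [LinearMap.comp_apply]
    rw [totPull_inTot, totPull_inTot, totPull_inTot, pull_pull]

theorem totPull_bijective {φ : G →* K} (hφ : Function.Bijective φ) :
    Function.Bijective (totPull k φ) := by
  let e := MulEquiv.ofBijective φ hφ
  have h1 : e.symm.toMonoidHom.comp φ = MonoidHom.id G :=
    MonoidHom.ext fun x => e.symm_apply_apply x
  have h2 : φ.comp e.symm.toMonoidHom = MonoidHom.id K :=
    MonoidHom.ext fun x => e.apply_symm_apply x
  refine Function.bijective_iff_has_inverse.2 ⟨totPull k e.symm.toMonoidHom, fun x => ?_,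
    fun x => ?_⟩
  · have := LinearMap.congr_fun (totPull_comp (k := k) e.symm.toMonoidHom φ) x
    rwa [h2, totPull_id] at this
  · have := LinearMap.congr_fun (totPull_comp (k := k) φ e.symm.toMonoidHom) x
    rwa [h1, totPull_id] at this

theorem ext_natural {p₁ : H →* G} {p₂ : H →* K} {q₁ : H' →* G'} {q₂ : H' →* K'} {ψ : H' →* H}
    {α : G' →* G} {β : K' →* K} (h₁ : p₁.comp ψ = α.comp q₁) (h₂ : p₂.comp ψ = β.comp q₂)
    (u : TotalCoh k G ⊗[k] TotalCoh k K) : totPull k ψ (ext k p₁ p₂ u) =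
      ext k q₁ q₂ (TensorProduct.map (totPull k α) (totPull k β) u) := by
  induction u with
  | zero => simp only [map_zero]
  | add u v hu hv => simp only [map_add, hu, hv]
  | tmul v w =>
    induction v using DirectSum.induction_on with
    | zero => simp only [TensorProduct.zero_tmul, map_zero]
    | add v v' hv hv' => simp only [TensorProduct.add_tmul, map_add, hv, hv']
    | of m x =>
      induction w using DirectSum.induction_on with
      | zero => simp only [TensorProduct.tmul_zero, map_zero]
      | add v v' hv hv' => simp only [TensorProduct.tmul_add, map_add, hv, hv']
      | of n y =>
        rw [← DirectSum.lof_eq_of k, ← DirectSum.lof_eq_of k, TensorProduct.map_tmul, ext_tmul,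
          ext_tmul, extBilin_apply, totPull_inTot, totPull_inTot, totPull_inTot, extBilin_apply,
          pull_cup, pull_pull, pull_pull, pull_pull, pull_pull, h₁, h₂]

/-- The Künneth theorem over a field. -/
theorem ext_bijective [Finite G] [Finite K] {p₁ : H →* G} {p₂ : H →* K}
    (h : Function.Bijective (p₁.prod p₂)) : Function.Bijective (ext k p₁ p₂) := by
  have : (ext k p₁ p₂ : _ → _) = totPull k (p₁.prod p₂) ∘
      ext k (MonoidHom.fst G K) (MonoidHom.snd G K) := by
    funext u
    have h₁ : (MonoidHom.fst G K).comp (p₁.prod p₂) = (MonoidHom.id G).comp p₁ := rfl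
    have h₂ : (MonoidHom.snd G K).comp (p₁.prod p₂) = (MonoidHom.id K).comp p₂ := rfl
    rw [Function.comp_apply, ext_natural h₁ h₂, totPull_id, totPull_id, TensorProduct.map_id,
      LinearMap.id_apply]
  rw [this]
  exact (totPull_bijective h).comp ⟨ext_injective, ext_surjective⟩

/-- The universal case is `G × K` with its projections; the relation is pulled back along `(p₁,
p₂)`. -/
theorem inTot_cup_comm (p₁ : H →* G) (p₂ : H →* K) {m n : ℕ} (x : Coh k G m) (y : Coh k K n) :
    inTot k H (m + n) (cup k H m n (pull k p₁ m x) (pull k p₂ n y)) =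
      (-1 : k) ^ (n * m) •
        inTot k H (n + m) (cup k H n m (pull k p₂ n y) (pull k p₁ m x)) := by
  have := congr(totPull k (p₁.prod p₂) $(inTot_congr (cup_pull_comm x y)))
  rw [map_smul, map_smul, totPull_inTot, totPull_inTot, pull_cup, pull_cup, pull_pull,
    pull_pull] at this
  exact this

end Naturality

/-! ### Tensor products of common kernels over a field. -/

section LinearAlgebra

variable {k : Type*} [Field k] {M N V W : Type*} [AddCommGroup M] [Module k M]
  [AddCommGroup N] [Module k N] [AddCommGroup V] [Module k V] [AddCommGroup W] [Module k W]

/-- With `u` expanded in a basis of `W`, the maps `f i ⊗ 1` act on its coefficients in `V` one by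
one. Each coefficient is therefore killed by every `f i`, and the family `f` may be infinite. -/
theorem mem_range_rTensor {I : Type*} {U : I → Type*} [∀ i, AddCommGroup (U i)]
    [∀ i, Module k (U i)] (j : M →ₗ[k] V) (f : ∀ i, V →ₗ[k] U i)
    (h : ∀ v, (∀ i, f i v = 0) → v ∈ LinearMap.range j) (u : V ⊗[k] W)
    (hu : ∀ i, (f i).rTensor W u = 0) : u ∈ LinearMap.range (j.rTensor W) := by
  classical
  let b := Module.Basis.ofVectorSpace k W
  have key : ∀ i (u : V ⊗[k] W) t, TensorProduct.equivFinsuppOfBasisRight b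
      ((f i).rTensor W u) t = f i (TensorProduct.equivFinsuppOfBasisRight b u t) := by
    intro i u t
    induction u with
    | zero => simp
    | add u v hu hv => simp [hu, hv]
    | tmul v w => simp
  rw [← (TensorProduct.equivFinsuppOfBasisRight b).symm_apply_apply u,
    TensorProduct.equivFinsuppOfBasisRight_symm_apply]
  refine sum_mem fun t _ => ?_
  obtain ⟨m, hm⟩ := h (TensorProduct.equivFinsuppOfBasisRight b u t) fun i => by
    rw [← key, hu, map_zero, Finsupp.zero_apply]
  exact ⟨m ⊗ₜ b t, by rw [LinearMap.rTensor_tmul, hm]⟩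

theorem mem_range_lTensor {I : Type*} {U : I → Type*} [∀ i, AddCommGroup (U i)]
    [∀ i, Module k (U i)] (j : M →ₗ[k] V) (f : ∀ i, V →ₗ[k] U i)
    (h : ∀ v, (∀ i, f i v = 0) → v ∈ LinearMap.range j) (u : W ⊗[k] V)
    (hu : ∀ i, (f i).lTensor W u = 0) : u ∈ LinearMap.range (j.lTensor W) := by
  obtain ⟨m, hm⟩ := mem_range_rTensor j f h (TensorProduct.comm k W V u) fun i => by
    have : (f i).rTensor W (TensorProduct.comm k W V u) =
        TensorProduct.comm k W (U i) ((f i).lTensor W u) := by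
      clear hu
      induction u with
      | zero => simp only [map_zero]
      | add u v hu hv => simp only [map_add, hu, hv]
      | tmul v w => simp
    rw [this, hu, map_zero]
  refine ⟨(TensorProduct.comm k W M).symm m, (TensorProduct.comm k W V).injective ?_⟩
  rw [← hm]
  clear hm hu
  induction m with
  | zero => simp only [map_zero]
  | add u v hu hv => simp only [map_add, hu, hv]
  | tmul v w => simp

/-- Tensors that are killed by all `f i ⊗ 1` and all `1 ⊗ g i`, where `M` is the common kernel of
the `f i` and `N` that of the `g i`, come from `M ⊗ N`. -/
theorem mem_range_map {I J : Type*} {U : I → Type*} [∀ i, AddCommGroup (U i)]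
    [∀ i, Module k (U i)] {T : J → Type*} [∀ i, AddCommGroup (T i)] [∀ i, Module k (T i)]
    {j : M →ₗ[k] V} (hj : Function.Injective j) (f : ∀ i, V →ₗ[k] U i)
    (h : ∀ v, (∀ i, f i v = 0) → v ∈ LinearMap.range j)
    (l : N →ₗ[k] W) (g : ∀ i, W →ₗ[k] T i)
    (h' : ∀ w, (∀ i, g i w = 0) → w ∈ LinearMap.range l) (u : V ⊗[k] W)
    (hu : ∀ i, (f i).rTensor W u = 0) (hu' : ∀ i, (g i).lTensor V u = 0) :
    u ∈ LinearMap.range (TensorProduct.map j l) := by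
  obtain ⟨u, rfl⟩ := mem_range_rTensor j f h u hu
  -- The conditions on the second factor descend from `V ⊗ W` to `M ⊗ W` because tensoring the
  -- injection `j` with `T i` keeps it injective.
  obtain ⟨u, rfl⟩ := mem_range_lTensor l g h' u fun i => by
    apply Module.Flat.rTensor_preserves_injective_linearMap j hj
    rw [map_zero, ← hu' i, ← LinearMap.comp_apply, ← LinearMap.comp_apply,
      LinearMap.rTensor_comp_lTensor, LinearMap.lTensor_comp_rTensor]
  exact ⟨u, by rw [← LinearMap.comp_apply, LinearMap.rTensor_comp_lTensor]⟩

end LinearAlgebra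

/-! ### Centric subgroups of the product fusion system. -/

section Centric

variable {S S₁ S₂ : Type} [Group S] [Group S₁] [Group S₂]

namespace FusionSystem

theorem centric_top [Finite S] (F : FusionSystem S) : F.Centric ⊤ := by
  rintro P ⟨e, -, -⟩
  have : P = ⊤ := Subgroup.eq_top_of_card_eq P (by
    rw [← Nat.card_congr e.toEquiv, Subgroup.card_top])
  rw [this]
  exact le_top

variable (F₁ : FusionSystem S₁) (F₂ : FusionSystem S₂)

/-- An `F₁`-isomorphism from the projection of `P` onto `P'`, paired with the identity on the second
coordinate, is a morphism of the product on `P`, with image `R`, say. If `s` centralizes `P'`, then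
`(s, 1)` centralizes `R`, hence lies in `R`, and `s` lies in `P'`. -/
theorem Centric.map_fst {F₁ : FusionSystem S₁} {F₂ : FusionSystem S₂} {P : Subgroup (S₁ × S₂)}
    (hP : (F₁.prod F₂).Centric P) : F₁.Centric (P.map (MonoidHom.fst S₁ S₂)) := by
  rintro P' ⟨e, he, -⟩ s hs
  let φ : P →* (⊤ : Subgroup (S₁ × S₂)) :=
    { toFun := fun x => ⟨(e ⟨x.1.1, Subgroup.mem_map_of_mem (MonoidHom.fst S₁ S₂) x.2⟩, x.1.2),
        trivial⟩
      map_one' := by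
        refine Subtype.ext (Prod.ext ?_ rfl)
        exact congr(($(map_one e) : S₁))
      map_mul' := fun x y => by
        refine Subtype.ext (Prod.ext ?_ rfl)
        exact congrArg Subtype.val (map_mul e
          ⟨x.1.1, Subgroup.mem_map_of_mem (MonoidHom.fst S₁ S₂) x.2⟩
          ⟨y.1.1, Subgroup.mem_map_of_mem (MonoidHom.fst S₁ S₂) y.2⟩) }
  have hφ : φ ∈ (F₁.prod F₂).Hom P ⊤ :=
    ⟨_, F₁.comp_mem he (F₁.inclusion_mem le_top), _, F₂.inclusion_mem le_top, fun x => rfl⟩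
  obtain ⟨R, hR, f, hf, hf', hφf⟩ := (F₁.prod F₂).factor hφ
  have hval : ∀ x, (f x : S₁ × S₂) = φ x := fun x => congr(($hφf x : S₁ × S₂)).symm
  have hs' : (s, (1 : S₂)) ∈ Subgroup.centralizer (R : Set (S₁ × S₂)) := by
    rw [Subgroup.mem_centralizer_iff] at hs ⊢
    intro y hy
    obtain ⟨x, hx⟩ := f.surjective ⟨y, hy⟩
    have hy' : y = φ x := by rw [← hval, hx]
    rw [hy']
    exact Prod.ext (hs _ (e _).2) (by simp)
  obtain ⟨x, hx⟩ := f.surjective ⟨_, hP R ⟨f, hf, hf'⟩ hs'⟩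
  have : s = (φ x : S₁ × S₂).1 := by rw [← hval, hx]
  rw [this]
  exact (e _).2

theorem Centric.map_snd {F₁ : FusionSystem S₁} {F₂ : FusionSystem S₂} {P : Subgroup (S₁ × S₂)}
    (hP : (F₁.prod F₂).Centric P) : F₂.Centric (P.map (MonoidHom.snd S₁ S₂)) := by
  rintro P' ⟨e, he, -⟩ s hs
  let φ : P →* (⊤ : Subgroup (S₁ × S₂)) :=
    { toFun := fun x => ⟨(x.1.1, e ⟨x.1.2, Subgroup.mem_map_of_mem (MonoidHom.snd S₁ S₂) x.2⟩),
        trivial⟩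
      map_one' := by
        refine Subtype.ext (Prod.ext rfl ?_)
        exact congr(($(map_one e) : S₂))
      map_mul' := fun x y => by
        refine Subtype.ext (Prod.ext rfl ?_)
        exact congrArg Subtype.val (map_mul e
          ⟨x.1.2, Subgroup.mem_map_of_mem (MonoidHom.snd S₁ S₂) x.2⟩
          ⟨y.1.2, Subgroup.mem_map_of_mem (MonoidHom.snd S₁ S₂) y.2⟩) }
  have hφ : φ ∈ (F₁.prod F₂).Hom P ⊤ :=
    ⟨_, F₁.inclusion_mem le_top, _, F₂.comp_mem he (F₂.inclusion_mem le_top), fun x => rfl⟩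
  obtain ⟨R, hR, f, hf, hf', hφf⟩ := (F₁.prod F₂).factor hφ
  have hval : ∀ x, (f x : S₁ × S₂) = φ x := fun x => congr(($hφf x : S₁ × S₂)).symm
  have hs' : ((1 : S₁), s) ∈ Subgroup.centralizer (R : Set (S₁ × S₂)) := by
    rw [Subgroup.mem_centralizer_iff] at hs ⊢
    intro y hy
    obtain ⟨x, hx⟩ := f.surjective ⟨y, hy⟩
    have hy' : y = φ x := by rw [← hval, hx]
    rw [hy']
    exact Prod.ext (by simp) (hs _ (e _).2)
  obtain ⟨x, hx⟩ := f.surjective ⟨_, hP R ⟨f, hf, hf'⟩ hs'⟩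
  have : s = (φ x : S₁ × S₂).2 := by rw [← hval, hx]
  rw [this]
  exact (e _).2

theorem map_fst_prod (P₁ : Subgroup S₁) (P₂ : Subgroup S₂) :
    (P₁.prod P₂).map (MonoidHom.fst S₁ S₂) = P₁ := by
  ext x
  constructor
  · rintro ⟨y, hy, rfl⟩
    exact hy.1
  · exact fun hx => ⟨(x, 1), ⟨hx, one_mem _⟩, rfl⟩

theorem map_snd_prod (P₁ : Subgroup S₁) (P₂ : Subgroup S₂) :
    (P₁.prod P₂).map (MonoidHom.snd S₁ S₂) = P₂ := by
  ext x
  constructor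
  · rintro ⟨y, hy, rfl⟩
    exact hy.2
  · exact fun hx => ⟨(1, x), ⟨one_mem _, hx⟩, rfl⟩

/-- A conjugate of `P₁ × P₂` has the form `T₁ × T₂` with `Tᵢ` conjugate to `Pᵢ`. Its elements with
one trivial coordinate show that a centralizing `s` centralizes each factor separately. -/
theorem Centric.prod {F₁ : FusionSystem S₁} {F₂ : FusionSystem S₂} {P₁ : Subgroup S₁}
    {P₂ : Subgroup S₂} (h₁ : F₁.Centric P₁) (h₂ : F₂.Centric P₂) :
    (F₁.prod F₂).Centric (P₁.prod P₂) := by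
  rintro R ⟨e, ⟨φ₁, hφ₁, φ₂, hφ₂, h⟩, -⟩ s hs
  obtain ⟨T₁, hT₁, e₁, he₁, he₁', hf₁⟩ := F₁.factor hφ₁
  obtain ⟨T₂, hT₂, e₂, he₂, he₂', hf₂⟩ := F₂.factor hφ₂
  subst hf₁ hf₂
  rw [← map_fst_prod P₁ P₂] at h₁
  rw [← map_snd_prod P₁ P₂] at h₂
  rw [Subgroup.mem_centralizer_iff] at hs
  have hs₁ : s.1 ∈ T₁ := h₁ T₁ ⟨e₁, he₁, he₁'⟩ (Subgroup.mem_centralizer_iff.2 fun t ht => by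
    obtain ⟨⟨_, x, hx, rfl⟩, hxt⟩ := e₁.surjective ⟨t, ht⟩
    have h1 := congr(($(hs _ (e ⟨(x.1, 1), hx.1, one_mem _⟩).2)).1)
    have h2 := congr(($(h ⟨(x.1, 1), hx.1, one_mem _⟩)).1)
    have h3 : ((e ⟨(x.1, 1), hx.1, one_mem _⟩ : R) : S₁ × S₂).1 = t :=
      h2.trans congr(($hxt : S₁))
    rw [← h3]
    exact h1)
  have hs₂ : s.2 ∈ T₂ := h₂ T₂ ⟨e₂, he₂, he₂'⟩ (Subgroup.mem_centralizer_iff.2 fun t ht => by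
    obtain ⟨⟨_, x, hx, rfl⟩, hxt⟩ := e₂.surjective ⟨t, ht⟩
    have h1 := congr(($(hs _ (e ⟨(1, x.2), one_mem _, hx.2⟩).2)).2)
    have h2 := congr(($(h ⟨(1, x.2), one_mem _, hx.2⟩)).2)
    have h3 : ((e ⟨(1, x.2), one_mem _, hx.2⟩ : R) : S₁ × S₂).2 = t :=
      h2.trans congr(($hxt : S₂))
    rw [← h3]
    exact h1)
  obtain ⟨⟨_, x, hx, rfl⟩, hxs⟩ := e₁.surjective ⟨s.1, hs₁⟩
  obtain ⟨⟨_, y, hy, rfl⟩, hys⟩ := e₂.surjective ⟨s.2, hs₂⟩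
  have h1 := h ⟨(x.1, y.2), hx.1, hy.2⟩
  have h2 : ((e ⟨(x.1, y.2), hx.1, hy.2⟩ : R) : S₁ × S₂) = s :=
    h1.trans (Prod.ext congr(($hxs : S₁)) congr(($hys : S₂)))
  rw [← h2]
  exact (e _).2

/-- The restriction of `φ₁ × φ₂` to `P₁ × P₂`. -/
def prodMor {P₁ : Subgroup S₁} {P₂ : Subgroup S₂} (φ₁ : P₁ →* (⊤ : Subgroup S₁))
    (φ₂ : P₂ →* (⊤ : Subgroup S₂)) : P₁.prod P₂ →* (⊤ : Subgroup (S₁ × S₂)) where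
  toFun x := ⟨(φ₁ ⟨x.1.1, x.2.1⟩, φ₂ ⟨x.1.2, x.2.2⟩), trivial⟩
  map_one' := Subtype.ext (Prod.ext congr(($(map_one φ₁) : S₁)) congr(($(map_one φ₂) : S₂)))
  map_mul' x y := Subtype.ext (Prod.ext
    (congrArg Subtype.val (map_mul φ₁ ⟨x.1.1, x.2.1⟩ ⟨y.1.1, y.2.1⟩))
    (congrArg Subtype.val (map_mul φ₂ ⟨x.1.2, x.2.2⟩ ⟨y.1.2, y.2.2⟩)))

theorem prodMor_mem {P₁ : Subgroup S₁} {P₂ : Subgroup S₂} {φ₁ : P₁ →* (⊤ : Subgroup S₁)}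
    {φ₂ : P₂ →* (⊤ : Subgroup S₂)} (h₁ : φ₁ ∈ F₁.Hom P₁ ⊤) (h₂ : φ₂ ∈ F₂.Hom P₂ ⊤) :
    prodMor φ₁ φ₂ ∈ (F₁.prod F₂).Hom (P₁.prod P₂) ⊤ :=
  ⟨_, F₁.comp_mem (F₁.inclusion_mem (map_fst_prod P₁ P₂).le) h₁,
    _, F₂.comp_mem (F₂.inclusion_mem (map_snd_prod P₁ P₂).le) h₂, fun _ => rfl⟩

/-- A homomorphism `π : S' → S` that maps centric subgroups to centric subgroups and induces a
functor of fusion systems. -/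
structure IsFusionMap {S' : Type} [Group S'] (F' : FusionSystem S') (F : FusionSystem S)
    (π : S' →* S) : Prop where
  centric : ∀ P, F'.Centric P → F.Centric (P.map π)
  hom : ∀ P Q, ∀ φ ∈ F'.Hom P Q, ∃ ψ ∈ F.Hom (P.map π) (Q.map π),
    ψ.comp (π.subgroupMap P) = (π.subgroupMap Q).comp φ

theorem isFusionMap_fst : IsFusionMap (F₁.prod F₂) F₁ (MonoidHom.fst S₁ S₂) where
  centric _ h := h.map_fst
  hom P Q φ := by
    rintro ⟨φ₁, h₁, φ₂, h₂, h⟩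
    refine ⟨((Subgroup.subtype ⊤).comp φ₁).codRestrict _ ?_, F₁.corestrict_mem h₁ _ fun _ => rfl,
      MonoidHom.ext fun x => Subtype.ext congr(($(h x)).1).symm⟩
    rintro ⟨_, x, hx, rfl⟩
    exact ⟨φ ⟨x, hx⟩, (φ ⟨x, hx⟩).2, congr(($(h ⟨x, hx⟩)).1)⟩

theorem isFusionMap_snd : IsFusionMap (F₁.prod F₂) F₂ (MonoidHom.snd S₁ S₂) where
  centric _ h := h.map_snd
  hom P Q φ := by
    rintro ⟨φ₁, h₁, φ₂, h₂, h⟩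
    refine ⟨((Subgroup.subtype ⊤).comp φ₂).codRestrict _ ?_, F₂.corestrict_mem h₂ _ fun _ => rfl,
      MonoidHom.ext fun x => Subtype.ext congr(($(h x)).2).symm⟩
    rintro ⟨_, x, hx, rfl⟩
    exact ⟨φ ⟨x, hx⟩, (φ ⟨x, hx⟩).2, congr(($(h ⟨x, hx⟩)).2)⟩

end FusionSystem

end Centric

/-! ### Stable elements: `H^*(F)` inside `H^*(S)`. -/

section Stable

set_option linter.unusedSectionVars false

open FusionSystem

variable {k : Type} [Field k] {S S' : Type} [Group S] [Group S'] {F : FusionSystem S}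
  {F' : FusionSystem S'}

/-- The component at a centric subgroup `P`. -/
def evalAt (k : Type) [Field k] (F : FusionSystem S) (P : {P : Subgroup S // F.Centric P}) :
    FusionCoh k F →ₗ[k] TotalCoh k P.1 :=
  FusionCoh.lift fun n => inTot k P.1 n ∘ₗ LinearMap.proj P ∘ₗ (HF k F n).subtype

theorem evalAt_inDeg (P : {P : Subgroup S // F.Centric P}) {n : ℕ} (x : HF k F n) :
    evalAt k F P (inDeg k F n x) = inTot k P.1 n (x.1 P) :=
  FusionCoh.lift_inDeg _ _ _

theorem totPull_evalAt {P Q : {P : Subgroup S // F.Centric P}} {φ : P.1 →* Q.1}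
    (hφ : φ ∈ F.Hom P.1 Q.1) (z : FusionCoh k F) :
    totPull k φ (evalAt k F Q z) = evalAt k F P z := by
  refine LinearMap.congr_fun (f := totPull k φ ∘ₗ evalAt k F Q) (FusionCoh.hom_ext fun n x => ?_) z
  rw [LinearMap.comp_apply, evalAt_inDeg, evalAt_inDeg, totPull_inTot, x.2 P Q φ hφ]

/-- The homogeneous component of degree `n`. -/
def FusionCoh.component (k : Type) [Field k] (F : FusionSystem S) (n : ℕ) :
    FusionCoh k F →ₗ[k] HF k F n :=
  DirectSum.component k ℕ (fun n => HF k F n) n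

theorem FusionCoh.component_inDeg {n : ℕ} (x : HF k F n) :
    FusionCoh.component k F n (inDeg k F n x) = x :=
  DirectSum.component.lof_self k (M := fun n => HF k F n) n x

theorem FusionCoh.component_inDeg_of_ne {m n : ℕ} (h : m ≠ n) (x : HF k F m) :
    FusionCoh.component k F n (inDeg k F m x) = 0 :=
  DirectSum.of_eq_of_ne (β := fun n => HF k F n) _ _ _ h.symm

theorem evalAt_component (P : {P : Subgroup S // F.Centric P}) (z : FusionCoh k F) (n : ℕ) :
    evalAt k F P z n = (FusionCoh.component k F n z).1 P := by
  refine LinearMap.congr_fun (f := DirectSum.component k ℕ (Coh k P.1) n ∘ₗ evalAt k F P)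
    (g := LinearMap.proj P ∘ₗ (HF k F n).subtype ∘ₗ FusionCoh.component k F n)
    (FusionCoh.hom_ext fun m x => ?_) z
  simp only [LinearMap.comp_apply]
  rw [evalAt_inDeg]
  by_cases h : m = n
  · subst h
    rw [DirectSum.component.lof_self, FusionCoh.component_inDeg]
    rfl
  · rw [FusionCoh.component_inDeg_of_ne h, map_zero, map_zero]
    exact DirectSum.of_eq_of_ne _ _ _ (Ne.symm h)

theorem evalAt_ext {y z : FusionCoh k F} (h : ∀ P, evalAt k F P y = evalAt k F P z) : y = z :=
  DFinsupp.ext fun n => Subtype.ext (funext fun P => by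
    have := congr($(h P) n)
    rwa [evalAt_component, evalAt_component] at this)

/-- The group `S` as a centric subgroup. -/
abbrev topCentric [Finite S] (F : FusionSystem S) : {P : Subgroup S // F.Centric P} :=
  ⟨⊤, F.centric_top⟩

/-- Inclusions into `S` are morphisms, so the member at `S` determines the family. -/
theorem evalAt_top_injective [Finite S] : Function.Injective (evalAt k F (topCentric F)) :=
  fun y z h => evalAt_ext fun P => by
    have key := fun z => totPull_evalAt (k := k) (P := P) (Q := topCentric F)
      (F.inclusion_mem le_top) z
    rw [← key, h, key]

/-- The morphisms from centric subgroups to `S`. -/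
abbrev MorTop (F : FusionSystem S) : Type :=
  Σ P : {P : Subgroup S // F.Centric P}, F.Hom P.1 ⊤

/-- The stability condition given by a morphism from a centric subgroup to `S`. -/
def stab (k : Type) [Field k] (F : FusionSystem S) (i : MorTop F) :
    TotalCoh k (⊤ : Subgroup S) →ₗ[k] TotalCoh k i.1.1 :=
  totPull k i.2.1 - totPull k (Subgroup.inclusion le_top)

/-- The family of restrictions of `v` is compatible: a morphism `P → Q` followed by the inclusion of
`Q` is a morphism to `S`, where stability applies. With injectivity this presents `H^*(F)` in the
form that `mem_range_map` needs. -/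
theorem mem_range_evalAt [Finite S] (v : TotalCoh k (⊤ : Subgroup S))
    (hv : ∀ i : MorTop F, stab k F i v = 0) :
    v ∈ LinearMap.range (evalAt k F (topCentric F)) := by
  have hn : ∀ n, ∃ x : HF k F n, x.1 (topCentric F) = v n := fun n => by
    refine ⟨⟨fun P => pull k (Subgroup.inclusion le_top) n (v n), fun P Q φ hφ => ?_⟩, ?_⟩
    · rw [pull_pull]
      have := congr($(hv ⟨P, _, F.comp_mem hφ (F.inclusion_mem le_top)⟩) n)
      exact sub_eq_zero.1 this
    · exact pull_id _
  classical
  rw [← DirectSum.sum_support_of v]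
  refine sum_mem fun n _ => ?_
  obtain ⟨x, hx⟩ := hn n
  refine ⟨inDeg k F n x, ?_⟩
  rw [evalAt_inDeg, hx]
  rfl

namespace HF

/-- The pullback of compatible families. -/
def comap {π : S' →* S} (h : IsFusionMap F' F π) (n : ℕ) : HF k F n →ₗ[k] HF k F' n where
  toFun x := ⟨fun P => pull k (π.subgroupMap P.1) n (x.1 ⟨_, h.centric _ P.2⟩), fun P Q φ hφ => by
    obtain ⟨ψ, hψ, e⟩ := h.hom P.1 Q.1 φ hφ
    rw [pull_pull, ← e, ← pull_pull,
      x.2 ⟨_, h.centric _ P.2⟩ ⟨_, h.centric _ Q.2⟩ ψ hψ]⟩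
  map_add' x y := Subtype.ext (funext fun P => map_add (pull k (π.subgroupMap P.1) n) _ _)
  map_smul' c x := Subtype.ext (funext fun P => map_smul (pull k (π.subgroupMap P.1) n) _ _)

theorem comap_apply {π : S' →* S} (h : IsFusionMap F' F π) {n : ℕ} (x : HF k F n)
    (P : {P : Subgroup S' // F'.Centric P}) :
    (comap h n x).1 P = pull k (π.subgroupMap P.1) n (x.1 ⟨_, h.centric _ P.2⟩) := rfl

/-- Compatibility with inclusions allows `π(P)` to be replaced by any centric subgroup containing
it. The formula for the external product thus holds for all admissible `P₁` and `P₂`. -/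
theorem comap_eq {π : S' →* S} (h : IsFusionMap F' F π) {n : ℕ} (x : HF k F n)
    (P : {P : Subgroup S' // F'.Centric P}) (Q : {Q : Subgroup S // F.Centric Q})
    (f : P.1 →* Q.1) (hf : ∀ s, (f s : S) = π s) :
    (comap h n x).1 P = pull k f n (x.1 Q) := by
  have hPQ : P.1.map π ≤ Q.1 := by
    rintro _ ⟨s, hs, rfl⟩
    rw [← hf ⟨s, hs⟩]
    exact (f _).2
  have e : (Subgroup.inclusion hPQ).comp (π.subgroupMap P.1) = f :=
    MonoidHom.ext fun s => Subtype.ext (hf s).symm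
  rw [comap_apply, ← x.2 ⟨_, h.centric _ P.2⟩ Q _ (F.inclusion_mem hPQ), pull_pull, e]

end HF

/-- The homomorphism of algebras induced by a map of fusion systems. -/
def FusionCoh.comap {π : S' →* S} (h : IsFusionMap F' F π) : FusionCoh k F →ₐ[k] FusionCoh k F' :=
  AlgHom.ofLinearMap (FusionCoh.lift fun n => inDeg k F' n ∘ₗ HF.comap h n)
    (by
      change FusionCoh.lift _ (inDeg k F 0 HF.one) = inDeg k F' 0 HF.one
      rw [FusionCoh.lift_inDeg, LinearMap.comp_apply]
      congr 1
      exact Subtype.ext (funext fun P => pull_one _))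
    (by
      rw [LinearMap.map_mul_iff]
      refine FusionCoh.hom_ext fun m x => FusionCoh.hom_ext fun n y => ?_
      simp only [LinearMap.compr₂_apply, LinearMap.mul_apply', LinearMap.compl₂_apply,
        LinearMap.comp_apply]
      rw [inDeg_mul, FusionCoh.lift_inDeg, FusionCoh.lift_inDeg, FusionCoh.lift_inDeg,
        LinearMap.comp_apply, LinearMap.comp_apply, LinearMap.comp_apply, inDeg_mul]
      congr 1
      exact Subtype.ext (funext fun P => pull_cup _ _ _))

theorem FusionCoh.comap_inDeg {π : S' →* S} (h : IsFusionMap F' F π) {n : ℕ} (x : HF k F n) :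
    FusionCoh.comap h (inDeg k F n x) = inDeg k F' n (HF.comap h n x) :=
  FusionCoh.lift_inDeg (fun n => inDeg k F' n ∘ₗ HF.comap h n) n x

end Stable

theorem tensor_map_injective {k : Type*} [Field k] {M N V W : Type*} [AddCommGroup M] [Module k M]
    [AddCommGroup N] [Module k N] [AddCommGroup V] [Module k V] [AddCommGroup W] [Module k W]
    {f : M →ₗ[k] V} {g : N →ₗ[k] W} (hf : Function.Injective f) (hg : Function.Injective g) :
    Function.Injective (TensorProduct.map f g) :=
  TensorProduct.map_injective_of_flat_flat f g hf hg

/-! ### The external product of fusion systems is bijective. -/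

section Kunneth

set_option linter.unusedSectionVars false

open FusionSystem

variable {k : Type} [Field k] {S₁ S₂ : Type} [Group S₁] [Group S₂] {F₁ : FusionSystem S₁}
  {F₂ : FusionSystem S₂}

/-- The external product of two compatible families. -/
def HF.extProd {m n : ℕ} (x : HF k F₁ m) (y : HF k F₂ n) : HF k (F₁.prod F₂) (m + n) :=
  HF.mul (HF.comap (isFusionMap_fst F₁ F₂) m x) (HF.comap (isFusionMap_snd F₁ F₂) n y)

theorem HF.isExternalProduct_extProd {m n : ℕ} (x : HF k F₁ m) (y : HF k F₂ n) :
    IsExternalProduct x y (HF.extProd x y) := by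
  intro P P₁ P₂ h₁ h₂
  rw [← HF.comap_eq (isFusionMap_fst F₁ F₂) x P P₁ (projFst P.1 P₁.1 h₁) fun _ => rfl,
    ← HF.comap_eq (isFusionMap_snd F₁ F₂) y P P₂ (projSnd P.1 P₂.1 h₂) fun _ => rfl]
  rfl

/-- The external product `H^*(F₁) ⊗ H^*(F₂) → H^*(F₁ × F₂)`. -/
def FusionCoh.extProd (k : Type) [Field k] (F₁ : FusionSystem S₁) (F₂ : FusionSystem S₂) :
    FusionCoh k F₁ ⊗[k] FusionCoh k F₂ →ₗ[k] FusionCoh k (F₁.prod F₂) :=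
  LinearMap.mul' k (FusionCoh k (F₁.prod F₂)) ∘ₗ
    TensorProduct.map (FusionCoh.comap (isFusionMap_fst F₁ F₂)).toLinearMap
      (FusionCoh.comap (isFusionMap_snd F₁ F₂)).toLinearMap

theorem FusionCoh.extProd_inDeg {m n : ℕ} (x : HF k F₁ m) (y : HF k F₂ n) :
    FusionCoh.extProd k F₁ F₂ (inDeg k F₁ m x ⊗ₜ inDeg k F₂ n y) =
      inDeg k (F₁.prod F₂) (m + n) (HF.extProd x y) := by
  rw [HF.extProd, ← inDeg_mul, ← FusionCoh.comap_inDeg, ← FusionCoh.comap_inDeg]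
  rfl

theorem evalAt_extProd (u : FusionCoh k F₁ ⊗[k] FusionCoh k F₂)
    (P : {P : Subgroup (S₁ × S₂) // (F₁.prod F₂).Centric P})
    (P₁ : {P : Subgroup S₁ // F₁.Centric P}) (P₂ : {P : Subgroup S₂ // F₂.Centric P})
    (h₁ : ∀ s ∈ P.1, s.1 ∈ P₁.1) (h₂ : ∀ s ∈ P.1, s.2 ∈ P₂.1) :
    evalAt k (F₁.prod F₂) P (FusionCoh.extProd k F₁ F₂ u) =
      ext k (projFst P.1 P₁.1 h₁) (projSnd P.1 P₂.1 h₂)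
        (TensorProduct.map (evalAt k F₁ P₁) (evalAt k F₂ P₂) u) := by
  refine LinearMap.congr_fun
    (f := evalAt k (F₁.prod F₂) P ∘ₗ FusionCoh.extProd k F₁ F₂)
    (g := ext k (projFst P.1 P₁.1 h₁) (projSnd P.1 P₂.1 h₂) ∘ₗ
      TensorProduct.map (evalAt k F₁ P₁) (evalAt k F₂ P₂))
    (TensorProduct.ext (FusionCoh.hom_ext fun m x => FusionCoh.hom_ext fun n y => ?_)) u
  change evalAt k _ P (FusionCoh.extProd k F₁ F₂ (inDeg k F₁ m x ⊗ₜ inDeg k F₂ n y)) =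
    ext k (projFst P.1 P₁.1 h₁) (projSnd P.1 P₂.1 h₂)
      (TensorProduct.map (evalAt k F₁ P₁) (evalAt k F₂ P₂) (inDeg k F₁ m x ⊗ₜ inDeg k F₂ n y))
  rw [FusionCoh.extProd_inDeg, TensorProduct.map_tmul, evalAt_inDeg, evalAt_inDeg, evalAt_inDeg,
    ext_tmul, extBilin_apply, HF.isExternalProduct_extProd x y P P₁ P₂ h₁ h₂]

theorem projTop_bijective (P₁ : Subgroup S₁) (P₂ : Subgroup S₂) :
    Function.Bijective ((projFst (P₁.prod P₂) P₁ fun _ h => h.1).prod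
      (projSnd (P₁.prod P₂) P₂ fun _ h => h.2)) :=
  ⟨fun _ _ h => Subtype.ext (Prod.ext congr((($h).1 : S₁)) congr((($h).2 : S₂))),
    fun x => ⟨⟨(x.1, x.2), x.1.2, x.2.2⟩, rfl⟩⟩

theorem totPull_prodMor {P₁ : Subgroup S₁} {P₂ : Subgroup S₂} (φ₁ : P₁ →* (⊤ : Subgroup S₁))
    (φ₂ : P₂ →* (⊤ : Subgroup S₂))
    (u : TotalCoh k (⊤ : Subgroup S₁) ⊗[k] TotalCoh k (⊤ : Subgroup S₂)) :
    totPull k (prodMor φ₁ φ₂) (ext k (projFst ⊤ ⊤ fun _ _ => trivial)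
        (projSnd ⊤ ⊤ fun _ _ => trivial) u) =
      ext k (projFst (P₁.prod P₂) P₁ fun _ h => h.1) (projSnd (P₁.prod P₂) P₂ fun _ h => h.2)
        (TensorProduct.map (totPull k φ₁) (totPull k φ₂) u) :=
  have h₁ : (projFst ⊤ ⊤ fun _ _ => trivial).comp (prodMor φ₁ φ₂) =
      φ₁.comp (projFst (P₁.prod P₂) P₁ fun _ h => h.1) := rfl
  have h₂ : (projSnd ⊤ ⊤ fun _ _ => trivial).comp (prodMor φ₁ φ₂) =
      φ₂.comp (projSnd (P₁.prod P₂) P₂ fun _ h => h.2) := rfl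
  ext_natural h₁ h₂ u

variable [Finite S₁] [Finite S₂]

theorem FusionCoh.extProd_bijective : Function.Bijective (FusionCoh.extProd k F₁ F₂) := by
  let p₁ := projFst (⊤ : Subgroup (S₁ × S₂)) ⊤ fun _ _ => trivial
  let p₂ := projSnd (⊤ : Subgroup (S₁ × S₂)) ⊤ fun _ _ => trivial
  have hp : Function.Bijective (p₁.prod p₂) :=
    ⟨fun _ _ h => Subtype.ext (Prod.ext congr((($h).1 : S₁)) congr((($h).2 : S₂))),
      fun x => ⟨⟨(x.1, x.2), trivial⟩, rfl⟩⟩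
  have key : ∀ u, evalAt k (F₁.prod F₂) (topCentric _) (FusionCoh.extProd k F₁ F₂ u) =
      ext k p₁ p₂ (TensorProduct.map (evalAt k F₁ (topCentric F₁)) (evalAt k F₂ (topCentric F₂)) u) :=
    fun u => evalAt_extProd u (topCentric _) (topCentric F₁) (topCentric F₂) _ _
  refine ⟨fun u v h => ?_, fun z => ?_⟩
  · refine tensor_map_injective evalAt_top_injective evalAt_top_injective
      ((ext_bijective hp).1 ?_)
    rw [← key, ← key, h]
  · obtain ⟨u, hu⟩ := (ext_bijective (k := k) hp).2
      (evalAt k (F₁.prod F₂) (topCentric _) z)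
    -- Stability of `z` under `φ₁ × φ₂` on the centric subgroup `P₁ × P₂`: the right side does not
    -- depend on the choice of the two morphisms.
    have hmor : ∀ (i₁ : MorTop F₁) (i₂ : MorTop F₂),
        ext k (projFst (i₁.1.1.prod i₂.1.1) i₁.1.1 fun _ h => h.1)
          (projSnd (i₁.1.1.prod i₂.1.1) i₂.1.1 fun _ h => h.2)
          (TensorProduct.map (totPull k i₁.2.1) (totPull k i₂.2.1) u) =
        evalAt k (F₁.prod F₂) ⟨i₁.1.1.prod i₂.1.1, i₁.1.2.prod i₂.1.2⟩ z := fun i₁ i₂ => by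
      have h := totPull_evalAt (k := k) (F := F₁.prod F₂)
        (P := ⟨i₁.1.1.prod i₂.1.1, i₁.1.2.prod i₂.1.2⟩)
        (Q := topCentric (F₁.prod F₂)) (prodMor_mem F₁ F₂ i₁.2.2 i₂.2.2) z
      rw [← hu] at h
      exact (totPull_prodMor i₁.2.1 i₂.2.1 u).symm.trans h
    -- The pairs `(φ, id)` and `(incl, id)` on `P₁ × S₂` give the same class, and injectivity in the
    -- Künneth theorem for `P₁ × S₂` turns this into an equality of tensors.
    have hu₁ : ∀ i, (stab k F₁ i).rTensor _ u = 0 := fun i => by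
      have := (hmor i ⟨topCentric F₂, _, F₂.id_mem ⊤⟩).trans
        (hmor ⟨i.1, _, F₁.inclusion_mem le_top⟩ ⟨topCentric F₂, _, F₂.id_mem ⊤⟩).symm
      have := (ext_bijective (projTop_bijective _ _)).1 this
      rw [stab, LinearMap.rTensor_sub, LinearMap.sub_apply, sub_eq_zero]
      rw [totPull_id] at this
      exact this
    have hu₂ : ∀ i, (stab k F₂ i).lTensor _ u = 0 := fun i => by
      have := (hmor ⟨topCentric F₁, _, F₁.id_mem ⊤⟩ i).trans
        (hmor ⟨topCentric F₁, _, F₁.id_mem ⊤⟩ ⟨i.1, _, F₂.inclusion_mem le_top⟩).symm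
      have := (ext_bijective (projTop_bijective _ _)).1 this
      rw [stab, LinearMap.lTensor_sub, LinearMap.sub_apply, sub_eq_zero]
      rw [totPull_id] at this
      exact this
    obtain ⟨w, rfl⟩ := mem_range_map evalAt_top_injective (stab k F₁) mem_range_evalAt _
      (stab k F₂) mem_range_evalAt u hu₁ hu₂
    exact ⟨w, evalAt_top_injective ((key w).trans hu)⟩

end Kunneth

/-! ### Multiplicativity and the graded tensor product. -/

section Algebra

variable {k : Type} [Field k] {S₁ S₂ : Type} [Group S₁] [Group S₂]

open FusionSystem

theorem uzpow_smul_eq {M : Type*} [AddCommGroup M] [Module k M] (n : ℕ) (x : M) :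
    ((-1 : ℤˣ) ^ n) • x = (-1 : k) ^ n • x := by
  obtain h | h := Nat.even_or_odd n <;> simp [h.neg_one_pow, Units.smul_def]

theorem comap_mul_comap_comm (F₁ : FusionSystem S₁) (F₂ : FusionSystem S₂) {m n : ℕ}
    (x : HF k F₁ m) (y : HF k F₂ n) :
    FusionCoh.comap (isFusionMap_fst F₁ F₂) (inDeg k F₁ m x) *
        FusionCoh.comap (isFusionMap_snd F₁ F₂) (inDeg k F₂ n y) =
      (-1 : k) ^ (n * m) • (FusionCoh.comap (isFusionMap_snd F₁ F₂) (inDeg k F₂ n y) *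
        FusionCoh.comap (isFusionMap_fst F₁ F₂) (inDeg k F₁ m x)) := by
  refine evalAt_ext fun P => ?_
  rw [FusionCoh.comap_inDeg, FusionCoh.comap_inDeg, inDeg_mul, inDeg_mul, map_smul, evalAt_inDeg,
    evalAt_inDeg]
  exact inTot_cup_comm _ _ _ _

/-- The external product as an isomorphism of graded algebras. -/
def kunnethEquiv (k : Type) [Field k] [Finite S₁] [Finite S₂] (F₁ : FusionSystem S₁)
    (F₂ : FusionSystem S₂) :
    (cohGrading k F₁) ᵍ⊗[k] (cohGrading k F₂) ≃ₐ[k] FusionCoh k (F₁.prod F₂) :=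
  AlgEquiv.ofBijective
    (GradedTensorProduct.lift (cohGrading k F₁) (cohGrading k F₂)
      (FusionCoh.comap (isFusionMap_fst F₁ F₂)) (FusionCoh.comap (isFusionMap_snd F₁ F₂))
      (by
        rintro i j ⟨_, x, rfl⟩ ⟨_, y, rfl⟩
        exact (comap_mul_comap_comm F₁ F₂ x y).trans (uzpow_smul_eq _ _).symm))
    -- The sign rule affects only the multiplication: the underlying function of the lift is
    -- definitionally `FusionCoh.extProd`.
    FusionCoh.extProd_bijective

theorem kunnethEquiv_inDeg [Finite S₁] [Finite S₂] {F₁ : FusionSystem S₁} {F₂ : FusionSystem S₂}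
    {m n : ℕ} (x : HF k F₁ m) (y : HF k F₂ n) :
    kunnethEquiv k F₁ F₂ (inDeg k F₁ m x ᵍ⊗ₜ[k] inDeg k F₂ n y) =
      inDeg k (F₁.prod F₂) (m + n) (HF.extProd x y) :=
  FusionCoh.extProd_inDeg x y

end Algebra

/-! ### Compatibility with operations satisfying a Cartan formula. -/

section Operations

variable {k : Type} [Field k] {S S₁ S₂ : Type} [Group S] [Group S₁] [Group S₂]

open FusionSystem

/-- The operation `θ_a` on compatible families. -/
def CartanFamily.onHF [Finite S] (Θ : CartanFamily k) (F : FusionSystem S) (a : Θ.Index) {n : ℕ}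
    (x : HF k F n) : HF k F (n + Θ.deg a) :=
  ⟨fun P => Θ.op a P.1 n (x.1 P), fun P Q φ hφ => by rw [Θ.natural, x.2 P Q φ hφ]⟩

theorem CartanFamily.onFusion_inDeg [Finite S] (Θ : CartanFamily k) (F : FusionSystem S)
    (a : Θ.Index) {n : ℕ} (x : HF k F n) :
    Θ.onFusion F a (inDeg k F n x) = inDeg k F (n + Θ.deg a) (Θ.onHF F a x) :=
  FusionCoh.lift_inDeg _ n x

theorem CartanFamily.onHF_comap [Finite S] [Finite S₁] (Θ : CartanFamily k) {F : FusionSystem S}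
    {F' : FusionSystem S₁} {π : S₁ →* S} (h : IsFusionMap F' F π) (a : Θ.Index) {n : ℕ}
    (x : HF k F n) : Θ.onHF F' a (HF.comap h n x) = HF.comap h _ (Θ.onHF F a x) :=
  Subtype.ext (funext fun _ => (Θ.natural _ _ _ _ _ _).symm)

/-- At each centric `P` the external product is a cup product of pulled back classes. The Cartan
formula for the group `P` applies to it, and naturality moves the operations back through the two
projections. -/
theorem CartanFamily.onFusion_kunnethEquiv [Finite S₁] [Finite S₂] (Θ : CartanFamily k)
    (F₁ : FusionSystem S₁) (F₂ : FusionSystem S₂) (a : Θ.Index) {m n : ℕ} (x : HF k F₁ m)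
    (y : HF k F₂ n) :
    Θ.onFusion (F₁.prod F₂) a (kunnethEquiv k F₁ F₂ (inDeg k F₁ m x ᵍ⊗ₜ[k] inDeg k F₂ n y)) =
      (Θ.coprod a).sum fun b c => (c * (-1) ^ (Θ.deg b.2 * m)) •
        kunnethEquiv k F₁ F₂ (Θ.onFusion F₁ b.1 (inDeg k F₁ m x) ᵍ⊗ₜ[k]
          Θ.onFusion F₂ b.2 (inDeg k F₂ n y)) := by
  refine evalAt_ext fun P => ?_
  rw [kunnethEquiv_inDeg, Θ.onFusion_inDeg, evalAt_inDeg, Finsupp.sum, map_sum]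
  refine (Θ.cartan a P.1 m n _ _).trans (Finset.sum_congr rfl fun b _ => ?_)
  rw [map_smul, Θ.onFusion_inDeg, Θ.onFusion_inDeg, kunnethEquiv_inDeg, evalAt_inDeg,
    HF.extProd, ← Θ.onHF_comap, ← Θ.onHF_comap]
  rfl

end Operations

end FusionKunneth

end

open FusionKunneth in
theorem mainTheorem4 (p : ℕ) [Fact p.Prime] (S₁ S₂ : Type) [Group S₁] [Group S₂] [Finite S₁]
    [Finite S₂] (hS₁ : IsPGroup p S₁) (hS₂ : IsPGroup p S₂) (F₁ : FusionSystem S₁)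
    (F₂ : FusionSystem S₂) (hF₁ : F₁.IsSaturated p) (hF₂ : F₂.IsSaturated p) :
    ∃ e : (cohGrading (ZMod p) F₁) ᵍ⊗[ZMod p] (cohGrading (ZMod p) F₂) ≃ₐ[ZMod p] FusionCoh (ZMod p) (F₁.prod F₂),
      (∀ (m n : ℕ) (x : HF (ZMod p) F₁ m) (y : HF (ZMod p) F₂ n),
        ∃ z : HF (ZMod p) (F₁.prod F₂) (m + n), IsExternalProduct x y z ∧
          e (inDeg (ZMod p) F₁ m x ᵍ⊗ₜ[ZMod p] inDeg (ZMod p) F₂ n y) = inDeg (ZMod p) (F₁.prod F₂) (m + n) z) ∧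
      (∀ (Θ : CartanFamily (ZMod p)) (a : Θ.Index) (m n : ℕ) (x : HF (ZMod p) F₁ m) (y : HF (ZMod p) F₂ n),
        Θ.onFusion (F₁.prod F₂) a (e (inDeg (ZMod p) F₁ m x ᵍ⊗ₜ[ZMod p] inDeg (ZMod p) F₂ n y)) =
          (Θ.coprod a).sum fun b c => (c * (-1) ^ (Θ.deg b.2 * m)) •
            e (Θ.onFusion F₁ b.1 (inDeg (ZMod p) F₁ m x) ᵍ⊗ₜ[ZMod p]
              Θ.onFusion F₂ b.2 (inDeg (ZMod p) F₂ n y))) :=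
  ⟨kunnethEquiv (ZMod p) F₁ F₂,
    fun _ _ x y => ⟨HF.extProd x y, HF.isExternalProduct_extProd x y, kunnethEquiv_inDeg x y⟩,
    fun Θ a _ _ x y => Θ.onFusion_kunnethEquiv F₁ F₂ a x y⟩
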